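/- Cylindric algebras of dimension $\alpha$ ($\alpha$ an ordinal) are Boolean algebras with unary operations ${\sf c}_i$ and constants ${\sf d}_{ij}$ ($i,j<\alpha$) satisfying, for all $i,j,k<\alpha$: ${\sf c}_i0=0$; $x\le {\sf c}_ix$; ${\sf c}_i(x\cdot{\sf c}_iy)={\sf c}_ix\cdot{\sf c}_iy$; ${\sf c}_i{\sf c}_jx={\sf c}_j{\sf c}_ix$; ${\sf d}_{ii}=1$; ${\sf d}_{ij}={\sf c}_k({\sf d}_{ik}\cdot{\sf d}_{kj})$ if $k\ne i,j$; ${\sf c}_i({\sf d}_{ij}\cdot x)\cdot{\sf c}_i({\sf d}_{ij}\cdot -x)=0$ if $i\ne j$. Let $\mathsf{CA}_\alpha$ be the class of all of them. For ordinals $n<m$ and $\mathfrak B\in\mathsf{CA}_m$, let $\mathfrak{Nr}_n\mathfrak B\in\mathsf{CA}_n$ be the algebra of those $x\in\mathfrak B$ with ${\sf c}_jx=x$ for all $n\le j<m$, with the operations of $\mathfrak B$ indexed by dimensions below $n$; let $\mathsf{Nr}_n\mathsf{CA}_m$ be the class of all algebras isomorphic to some $\mathfrak{Nr}_n\mathfrak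 B$, $\mathfrak B\in\mathsf{CA}_m$. A class of structures is pseudo-elementary if it consists, up to isomorphism, of the structures on the first sort of the models of some many-sorted first-order theory (in an extended signature with finitely many sorts, all nonempty). For a class $K$ let $EL\,K$ be its elementary closure, the class of all models of the first-order theory of $K$. Theorem. Let $1<n<m$ be ordinals. 1. $\mathsf{Nr}_n\mathsf{CA}_m$ is pseudo-elementary. It can be defined by a theory with two sorts if $m<\omega$, with three sorts if $n<\omega\le m$, and with four sorts if $n\ge\omega$. 2. $\mathsf{Nr}_n\mathsf{CA}_m$ is not elementary. 3. $EL\,\mathsf{Nr}_n\mathsf{CA}_m$ is recursively enumerable: for every injective numbering of the dimensions $i<n$ by a recursive set of natural numbers (which exists if and only if $n$ is countable), the set of Gödel numbers of the first-order sentences true in $EL\,\mathsf{Nr}_n\mathsf{CA}_m$ is recursively enumerable. 4. If $n>2$, then $EL\,\mathsf{Nr}_n\mathsf{CA}_m$ is not finitely axiomatizable, i.e. it is not the class of models of a finite set of first-order sentences. -/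

import Mathlib

universe u v w

open scoped FirstOrder

/-! ### Cylindric algebras and neat reducts -/

/-- A cylindric algebra whose dimensions are indexed by `I`: a Boolean algebra with
cylindrifications `c i` and diagonal elements `d i j`. One-element algebras are allowed. -/
class CylindricAlgebra (I : Type v) (A : Type u) extends BooleanAlgebra A where
  c : I → A → A
  d : I → I → A
  c_bot : ∀ i, c i ⊥ = ⊥
  le_c : ∀ i x, x ≤ c i x
  c_inf_c : ∀ i x y, c i (x ⊓ c i y) = c i x ⊓ c i y
  c_comm : ∀ i j x, c i (c j x) = c j (c i x)
  d_self : ∀ i, d i i = ⊤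
  d_eq : ∀ i j k, k ≠ i → k ≠ j → d i j = c k (d i k ⊓ d k j)
  c_d_disjoint : ∀ i j x, i ≠ j → c i (d i j ⊓ x) ⊓ c i (d i j ⊓ xᶜ) = ⊥

namespace CylindricAlgebra

variable {I : Type v} {J : Type w}

theorem c_c {B : Type u} [CylindricAlgebra J B] (j : J) (x : B) : c j (c j x) = c j x := by
  have h1 : c j (⊤ : B) = ⊤ := top_le_iff.mp (le_c j ⊤)
  have h := c_inf_c j (⊤ : B) x
  rwa [top_inf_eq, h1, top_inf_eq] at h

theorem compl_fixed {B : Type u} [CylindricAlgebra J B] (j : J) (x : B) (hx : c j x = x) :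
    c j xᶜ = xᶜ := by
  have h := c_inf_c j xᶜ x
  rw [hx, compl_inf_eq_bot, c_bot] at h
  exact le_antisymm (le_compl_iff_disjoint_right.mpr (disjoint_iff.mpr h.symm)) (le_c j _)

theorem inf_fixed {B : Type u} [CylindricAlgebra J B] (j : J) (x y : B) (hx : c j x = x)
    (hy : c j y = y) : c j (x ⊓ y) = x ⊓ y := by
  have h := c_inf_c j x y
  rwa [hy, hx] at h

/-- The universe of the neat reduct of `B` to the dimensions in the range of `ι`: the elements
fixed by all cylindrifications in the other dimensions. -/
def neatReduct (ι : I ↪ J) (B : Type u) [CylindricAlgebra J B] : BooleanSubalgebra B where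
  carrier := {x | ∀ j, j ∉ Set.range ι → c j x = x}
  supClosed' := by
    intro x hx y hy j hj
    have h := compl_fixed j _ (inf_fixed j _ _ (compl_fixed j x (hx j hj))
      (compl_fixed j y (hy j hj)))
    simpa [compl_inf] using h
  infClosed' := fun x hx y hy j hj => inf_fixed j x y (hx j hj) (hy j hj)
  compl_mem' := fun hx j hj => compl_fixed j _ (hx j hj)
  bot_mem' := fun j _ => c_bot j

/-- The neat reduct, as a cylindric algebra with dimensions indexed by `I`. -/
instance (ι : I ↪ J) (B : Type u) [CylindricAlgebra J B] :
    CylindricAlgebra I (neatReduct ι B) where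
  c i x := ⟨c (ι i) x.1, fun j hj => by rw [c_comm, x.2 j hj]⟩
  d i k := ⟨d (ι i) (ι k), fun j hj => by
    rw [d_eq (ι i) (ι k) j (fun h => hj ⟨i, h.symm⟩) (fun h => hj ⟨k, h.symm⟩), c_c]⟩
  c_bot i := Subtype.ext (c_bot (ι i))
  le_c i x := le_c (ι i) x.1
  c_inf_c i x y := Subtype.ext (c_inf_c (ι i) x.1 y.1)
  c_comm i j x := Subtype.ext (c_comm (ι i) (ι j) x.1)
  d_self i := Subtype.ext (d_self (ι i))
  d_eq i j k h h' := Subtype.ext (d_eq (ι i) (ι j) (ι k) (ι.injective.ne h) (ι.injective.ne h'))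
  c_d_disjoint i j x h := Subtype.ext (c_d_disjoint (ι i) (ι j) x.1 (ι.injective.ne h))

end CylindricAlgebra

/-! ### The first-order language of cylindric algebras -/

/-- The operation symbols of cylindric algebras with dimensions indexed by `I`. -/
inductive CAFunc (I : Type u) : ℕ → Type u
  | bot : CAFunc I 0
  | top : CAFunc I 0
  | compl : CAFunc I 1
  | sup : CAFunc I 2
  | inf : CAFunc I 2
  | c (i : I) : CAFunc I 1
  | d (i j : I) : CAFunc I 0

/-- The first-order language of cylindric algebras with dimensions indexed by `I`. -/
def caLanguage (I : Type u) : FirstOrder.Language.{u, 0} := ⟨CAFunc I, fun _ => Empty⟩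

/-- The interpretation of the operation symbols in a cylindric algebra. -/
def caFunMap {I : Type v} {A : Type u} [CylindricAlgebra I A] :
    {k : ℕ} → CAFunc I k → (Fin k → A) → A
  | _, .bot, _ => ⊥
  | _, .top, _ => ⊤
  | _, .compl, x => (x 0)ᶜ
  | _, .sup, x => x 0 ⊔ x 1
  | _, .inf, x => x 0 ⊓ x 1
  | _, .c i, x => CylindricAlgebra.c i (x 0)
  | _, .d i j, _ => CylindricAlgebra.d i j

/-- A cylindric algebra as a first-order structure. -/
instance caStructure (I : Type v) (A : Type u) [CylindricAlgebra I A] :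
    (caLanguage I).Structure A where
  funMap f x := caFunMap (I := I) f x
  RelMap r _ := Empty.elim r

/-! ### Classes of structures -/

/-- A class of `L`-structures. -/
def StructureClass (L : FirstOrder.Language.{v, w}) := (A : Type u) → L.Structure A → Prop

namespace StructureClass

variable {L : FirstOrder.Language.{v, w}}

/-- The first-order theory of a class of structures. -/
def theory (K : StructureClass.{u} L) : L.Theory :=
  {φ | ∀ (A : Type u) (S : L.Structure A), K A S → A ⊨ φ}

/-- The class of models of a theory. -/
def models (T : L.Theory) : StructureClass.{u} L := fun A _ => A ⊨ T

/-- A class is elementary if it is the class of models of some first-order theory. -/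
def IsElementary (K : StructureClass.{u} L) : Prop := ∃ T : L.Theory, K = models T

/-- The elementary closure of a class: the least elementary class containing it. -/
def elementaryClosure (K : StructureClass.{u} L) : StructureClass.{u} L := models K.theory

/-- A class is finitely axiomatizable if it is the class of models of a finite theory. -/
def IsFinitelyAxiomatizable (K : StructureClass.{u} L) : Prop :=
  ∃ T : L.Theory, T.Finite ∧ K = models T

end StructureClass

/-! ### Many-sorted first-order logic and pseudo-elementary classes -/

/-- A many-sorted signature with sorts `S`: function symbols by list of argument sorts and value
sort, relation symbols by list of argument sorts. -/
structure ManySorted (S : Type) where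
  Func : (k : ℕ) → (Fin k → S) → S → Type u
  Rel : (k : ℕ) → (Fin k → S) → Type u

namespace ManySorted

variable {S : Type}

/-- Terms of each sort; the variables of sort `s` are indexed by natural numbers. -/
inductive Term (Sg : ManySorted.{u} S) : S → Type u
  | var (s : S) (i : ℕ) : Term Sg s
  | app {k : ℕ} {a : Fin k → S} {s : S} (f : Sg.Func k a s) (ts : ∀ i, Term Sg (a i)) : Term Sg s

/-- Many-sorted first-order formulas, with equality in each sort. -/
inductive Formula (Sg : ManySorted.{u} S) : Type u
  | falsum : Formula Sg
  | eq {s : S} (t t' : Sg.Term s) : Formula Sg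
  | rel {k : ℕ} {a : Fin k → S} (r : Sg.Rel k a) (ts : ∀ i, Sg.Term (a i)) : Formula Sg
  | imp (φ ψ : Formula Sg) : Formula Sg
  | all (s : S) (i : ℕ) (φ : Formula Sg) : Formula Sg

/-- Many-sorted structures: each sort has a nonempty carrier. -/
structure Model (Sg : ManySorted.{u} S) where
  Carrier : S → Type u
  nonempty : ∀ s, Nonempty (Carrier s)
  func : ∀ {k : ℕ} {a : Fin k → S} {s : S}, Sg.Func k a s → (∀ i, Carrier (a i)) → Carrier s
  rel : ∀ {k : ℕ} {a : Fin k → S}, Sg.Rel k a → (∀ i, Carrier (a i)) → Prop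

variable {Sg : ManySorted.{u} S}

/-- Assignments of values to the variables of all sorts. -/
abbrev Model.Assignment (M : Sg.Model) := (p : S × ℕ) → M.Carrier p.1

/-- The value of a term. -/
def Model.eval (M : Sg.Model) (v : M.Assignment) : {s : S} → Sg.Term s → M.Carrier s
  | _, .var s i => v (s, i)
  | _, .app f ts => M.func f fun i => M.eval v (ts i)

/-- Satisfaction of a formula under an assignment. -/
def Model.Sat [DecidableEq S] (M : Sg.Model) : M.Assignment → Sg.Formula → Prop
  | _, .falsum => False
  | v, .eq t t' => M.eval v t = M.eval v t'
  | v, .rel r ts => M.rel r fun i => M.eval v (ts i)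
  | v, .imp φ ψ => M.Sat v φ → M.Sat v ψ
  | v, .all s i φ => ∀ x : M.Carrier s, M.Sat (Function.update v (s, i) x) φ

/-- `M` is a model of the set `T` of axioms; free variables in axioms are read as universally
quantified. -/
def Model.Models [DecidableEq S] (M : Sg.Model) (T : Set Sg.Formula) : Prop :=
  ∀ φ ∈ T, ∀ v : M.Assignment, M.Sat v φ

/-- An inclusion of a one-sorted language `L` in a many-sorted signature, on the sort `s`. -/
structure Inclusion (L : FirstOrder.Language.{v, w}) (Sg : ManySorted.{u} S) (s : S) where
  onFunc : ∀ {k : ℕ}, L.Functions k → Sg.Func k (fun _ => s) s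
  onRel : ∀ {k : ℕ}, L.Relations k → Sg.Rel k (fun _ => s)
  onFunc_injective : ∀ k, Function.Injective (onFunc (k := k))
  onRel_injective : ∀ k, Function.Injective (onRel (k := k))

/-- The `L`-structure that a many-sorted structure has on the sort `s`. -/
@[reducible] def Model.sortReduct {L : FirstOrder.Language.{v, w}} {s : S} (M : Sg.Model)
    (e : Inclusion L Sg s) : L.Structure (M.Carrier s) where
  funMap f x := M.func (e.onFunc f) x
  RelMap r x := M.rel (e.onRel r) x

end ManySorted

namespace StructureClass

variable {L : FirstOrder.Language.{v, w}}

/-- `K` is defined by a many-sorted first-order theory with `k` sorts: it consists, up to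
isomorphism, of the `L`-structures on the first sort of the models of that theory. -/
def IsPseudoElementaryWith (k : ℕ) [NeZero k] (K : StructureClass.{u} L) : Prop :=
  ∃ (Sg : ManySorted.{u} (Fin k)) (e : ManySorted.Inclusion L Sg 0) (T : Set Sg.Formula),
    ∀ (A : Type u) (SA : L.Structure A), K A SA ↔
      ∃ M : Sg.Model, M.Models T ∧
        Nonempty (@FirstOrder.Language.Equiv L A (M.Carrier 0) SA (M.sortReduct e))

/-- A class is pseudo-elementary if it consists of the first sorts of the models of some
many-sorted first-order theory (with finitely many sorts). -/
def IsPseudoElementary (K : StructureClass.{u} L) : Prop :=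
  ∃ (k : ℕ) (_ : NeZero k), IsPseudoElementaryWith k K

end StructureClass

/-! ### Gödel numbering and recursive enumerability -/

/-- Codes of operation symbols, given codes of the dimensions. -/
def caFuncCode {I : Type u} (e : I → ℕ) : {k : ℕ} → CAFunc I k → ℕ
  | _, .bot => 0
  | _, .top => 1
  | _, .compl => 2
  | _, .sup => 3
  | _, .inf => 4
  | _, .c i => 5 + 2 * e i
  | _, .d i j => 6 + 2 * Nat.pair (e i) (e j)

/-- Codes of terms, given codes of the dimensions and of the variables. -/
def caTermCode {I : Type u} (e : I → ℕ) {α : Type} (a : α → ℕ) : (caLanguage I).Term α → ℕ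
  | .var x => Nat.pair 0 (a x)
  | .func f ts => Nat.pair (caFuncCode (I := I) e f + 1)
      (Encodable.encode (List.ofFn fun i => caTermCode e a (ts i)))

/-- Codes of formulas all of whose variables are bound, or among `k` variables in scope. -/
def caFormulaCode {I : Type u} (e : I → ℕ) :
    {k : ℕ} → (caLanguage I).BoundedFormula Empty k → ℕ
  | _, .falsum => Nat.pair 0 0
  | _, .equal t t' => Nat.pair 1 (Nat.pair
      (caTermCode e (Sum.elim Empty.elim Fin.val) t) (caTermCode e (Sum.elim Empty.elim Fin.val) t'))
  | _, .rel r _ => Empty.elim r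
  | _, .imp φ ψ => Nat.pair 2 (Nat.pair (caFormulaCode e φ) (caFormulaCode e ψ))
  | _, .all φ => Nat.pair 3 (caFormulaCode e φ)

/-- A class of algebras in the language of cylindric algebras is recursively enumerable if the set
of (codes of) sentences true in it is, where the dimensions may be numbered by any recursive set of
natural numbers. -/
def IsREClass {I : Type u} (K : StructureClass.{u} (caLanguage I)) : Prop :=
  ∀ e : I → ℕ, Function.Injective e → ComputablePred (fun k => k ∈ Set.range e) →
    REPred fun k : ℕ => ∃ φ ∈ K.theory, caFormulaCode e φ = k

/-! ### The class of neat reducts -/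

/-- The inclusion of the ordinal `n` in the ordinal `m`. -/
noncomputable def ordinalInclusion {n m : Ordinal.{u}} (h : n ≤ m) : n.ToType ↪ m.ToType where
  toFun i := Ordinal.ToType.mk ⟨(Ordinal.ToType.toOrd i).1,
    Set.mem_Iio.mpr (lt_of_lt_of_le (Set.mem_Iio.mp (Ordinal.ToType.toOrd i).2) h)⟩
  inj' i j hij := by
    have h := congrArg Subtype.val (Ordinal.ToType.mk.injective hij)
    exact Ordinal.ToType.mk.symm.injective (Subtype.ext h)

/-- The class of (algebras isomorphic to) neat reducts to dimension `n` of cylindric algebras of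
dimension `m`. -/
def NrCA {n m : Ordinal.{u}} (h : n ≤ m) : StructureClass.{u} (caLanguage n.ToType) :=
  fun A SA => ∃ (B : Type u) (_ : CylindricAlgebra m.ToType B),
    Nonempty (@FirstOrder.Language.Equiv (caLanguage n.ToType) A
      (CylindricAlgebra.neatReduct (ordinalInclusion h) B) SA
      (caStructure n.ToType (CylindricAlgebra.neatReduct (ordinalInclusion h) B)))

/-! Pseudo-elementarity. An algebra belongs to the class iff it is isomorphic to the algebra of
elements fixed by the removed cylindrifications of some cylindric algebra. This is expressed with
one additional sort, which holds both the elements and the dimensions of the large algebra: a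
preorder compares elements, an equivalence relation identifies dimensions, a predicate marks the
removed dimensions, and there is a constant for each dimension below `m` (`models_theory_iff`). A
model may have more removed dimensions than `m` asks for. This is harmless, because the elements
fixed by the surplus form an algebra of dimension `m` with the same neat reduct
(`nrCA_neatReduct_inl`). So two sorts always suffice, and further sorts are padding.

Failure of elementarity. Let `i`, `j` be dimensions of the neat reduct and `k` a removed one. The
term `c k (d k i ⊓ c i (d i j ⊓ c j (d j k ⊓ x)))` interchanges the coordinates `i` and `j` of
elements that do not depend on `k`. It is injective on them and its values lie in the neat reduct
again, so it compares the sizes of two relativizations (`NrCA.exists_injective_interchange`). Now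
consider sequences with entries in disjoint copies of an abelian group `G`, one copy for each
dimension, and the sets of sequences invariant under translations of total degree zero. The
sequences whose copies are prescribed by a permutation are classified by their sum, so they carry
the power set of `G`. On the component of the identity every cylindrification is everything or
nothing (`TypedAlgebra.isPowerComponent`). Hence, if the power set of `G` is replaced in this
component by that of a quotient `S`, a back-and-forth game shows that sentences of quantifier rank
`r` do not notice, provided that `G` and `S` have at least `2 ^ r` points
(`IsPowerComponent.realize_sentence_iff`). The component of the transposition of `i` and `j` still
carries the power set of `G`. With `G = ℝ` and `S = ℕ` the new algebra is elementarily equivalent to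
a neat reduct, but the interchange would inject the power set of `ℝ` into that of `ℕ`. With `S` of
size `2 ^ r` it satisfies every axiom of rank at most `r`, but violates a first-order counting
consequence of the interchange; this refutes finite axiomatizability.

Enumerability. Elements, dimensions, assignments and Skolem witnesses are coded by numbers, and a
computable set of propositional clauses says that they describe a neat reduct in which the sentence
with code `a` is false. The clauses are satisfiable iff there is a countermodel (`exists_good`,
`Good.exists_countermodel`), and by compactness unsatisfiability is recursively enumerable. If
infinitely many dimensions are removed, the clauses provide only countably many of them, and an
ultrapower supplies the rest. -/

open CylindricAlgebra

/-! ### Substitution and interchange of dimensions -/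

namespace CylindricAlgebra

section Basic

variable {I : Type*} {A : Type*} [CylindricAlgebra I A]

theorem c_top (i : I) : c i (⊤ : A) = ⊤ := top_le_iff.mp (le_c i ⊤)

theorem c_inf_of_fixed {i : I} {y : A} (hy : c i y = y) (x : A) : c i (x ⊓ y) = c i x ⊓ y := by
  conv_lhs => rw [← hy]
  rw [c_inf_c, hy]

theorem c_mono (i : I) {x y : A} (h : x ≤ y) : c i x ≤ c i y := by
  have h1 : x ⊓ c i y = x := inf_eq_left.mpr (h.trans (le_c i y))
  have h2 := c_inf_c i x y
  rw [h1] at h2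
  exact h2 ▸ inf_le_right

theorem c_d_of_ne {i j k : I} (h : k ≠ i) (h' : k ≠ j) : c k (d i j : A) = d i j := by
  rw [d_eq i j k h h', c_c]

theorem c_right_d {i k : I} : c k (d i k : A) = ⊤ := by
  rcases eq_or_ne k i with rfl | h
  · rw [d_self, c_top]
  · refine top_le_iff.mp ?_
    rw [← d_self (A := A) i, d_eq i i k h h]
    exact c_mono k inf_le_left

theorem c_left_d {i k : I} : c i (d i k : A) = ⊤ := by
  rcases eq_or_ne i k with rfl | h
  · rw [d_self, c_top]
  · refine top_le_iff.mp ?_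
    rw [← d_self (A := A) k, d_eq k k i h h]
    exact c_mono i inf_le_right

/-- A part of the left side outside `x` would lie in both factors of `c_d_disjoint`: on the
diagonal, the entry `i` is determined by the entry `j`. -/
theorem d_inf_c_le {i j : I} (h : i ≠ j) (x : A) : d i j ⊓ c i (d i j ⊓ x) ≤ x := by
  rw [← sdiff_eq_bot_iff, sdiff_eq, eq_bot_iff, ← c_d_disjoint i j x h]
  refine le_inf (inf_le_left.trans inf_le_right) (le_trans ?_ (le_c i _))
  exact le_inf (inf_le_left.trans inf_le_left) inf_le_right

theorem d_inf_c_eq {i j : I} (h : i ≠ j) (x : A) : d i j ⊓ c i (d i j ⊓ x) = d i j ⊓ x :=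
  le_antisymm (le_inf inf_le_left (d_inf_c_le h x)) (le_inf inf_le_left (le_c i _))

/-- The interchange of the dimensions `i` and `j`, with `k` as a spare dimension. -/
def interchange (i j k : I) (x : A) : A := c k (d k i ⊓ c i (d i j ⊓ c j (d j k ⊓ x)))

/-- For `x` independent of `j` the map only renames the coordinate `i` as `j`, and `c j (d i j ⊓ ·)`
renames it back. -/
theorem subst_injOn {i j : I} (h : i ≠ j) :
    Set.InjOn (fun x : A => c i (d i j ⊓ x)) {x | c j x = x} := by
  have key : ∀ x : A, c j x = x → c j (d i j ⊓ c i (d i j ⊓ x)) = x := fun x hx => by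
    rw [d_inf_c_eq h, c_inf_of_fixed hx, c_right_d, top_inf_eq]
  intro x hx y hy hxy
  rw [← key x hx, ← key y hy]
  exact congrArg (fun z => c j (d i j ⊓ z)) hxy

theorem subst_of_fixed {i j : I} {x : A} (hx : c i x = x) : c i (d i j ⊓ x) = x := by
  rw [c_inf_of_fixed hx, c_left_d, top_inf_eq]

theorem interchange_mono (i j k : I) {x y : A} (h : x ≤ y) :
    interchange i j k x ≤ interchange i j k y :=
  c_mono _ (inf_le_inf_left _ (c_mono _ (inf_le_inf_left _ (c_mono _ (inf_le_inf_left _ h)))))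

/-- Three renamings in a row: `j` to `k`, `i` to `j`, `k` to `i`. Each one frees the coordinate that
the next one needs to be free in order to be injective. -/
theorem interchange_injOn {i j k : I} (hij : i ≠ j) (hik : i ≠ k) (hjk : j ≠ k) :
    Set.InjOn (interchange (A := A) i j k) {x | c k x = x} := by
  intro x hx y hy hxy
  refine subst_injOn hjk hx hy (subst_injOn hij (c_c j _) (c_c j _) ?_)
  exact subst_injOn hik.symm (c_c i _) (c_c i _) hxy

/-- The condition `p`, which does not see `j`, is moved from `i` to `j`; `q`, which does not see
`i`, is moved from `j` to `i`; `w` sees neither. The bound is a term without the spare dimension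
`k`, so it makes sense inside the neat reduct. -/
theorem interchange_le {i j k : I} (hij : i ≠ j) (hik : i ≠ k) (hjk : j ≠ k) {p q w x : A}
    (hp : c j p = p) (hpk : c k p = p) (hq : c i q = q) (hqk : c k q = q)
    (hwi : c i w = w) (hwj : c j w = w) (hwk : c k w = w) (hx : x ≤ p ⊓ q ⊓ w) :
    interchange i j k x ≤ c i (d i j ⊓ p) ⊓ c j (d j i ⊓ q) ⊓ w := by
  have fixd : ∀ {a b e : I} (y : A), e ≠ a → e ≠ b → c e y = y → c e (d a b ⊓ y) = d a b ⊓ y :=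
    fun y h h' hy => inf_fixed _ _ _ (c_d_of_ne h h') hy
  refine le_inf (le_inf ?_ ?_) ?_
  · refine (interchange_mono i j k (hx.trans (inf_le_left.trans inf_le_left))).trans_eq ?_
    rw [interchange, subst_of_fixed hp, subst_of_fixed]
    rw [c_comm, fixd p hik.symm hjk.symm hpk]
  · refine (interchange_mono i j k (hx.trans (inf_le_left.trans inf_le_right))).trans_eq ?_
    have h1 : c i (c j (d j k ⊓ q)) = c j (d j k ⊓ q) := by rw [c_comm, fixd q hij hik hq]
    -- The middle renaming is void here, and the outer two compose through `k` to the diagonal `d j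
    -- i` by `d_eq`.
    rw [interchange, subst_of_fixed h1, inf_comm,
      ← c_inf_of_fixed (c_d_of_ne (k := j) hjk hij.symm), c_comm, inf_right_comm,
      c_inf_of_fixed hqk, ← d_eq j i k hjk.symm hik.symm]
  · refine (interchange_mono i j k (hx.trans inf_le_right)).trans_eq ?_
    rw [interchange, subst_of_fixed hwj, subst_of_fixed hwi, subst_of_fixed hwk]

/-- The case `l = k` is included, as `c k` is the outermost operation. Hence the interchange does
not lead out of the neat reduct. -/
theorem c_interchange {i j k l : I} (hi : l ≠ i) (hj : l ≠ j) {x : A} (hx : c l x = x) :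
    c l (interchange i j k x) = interchange i j k x := by
  rcases eq_or_ne l k with rfl | hk
  · exact c_c l _
  · have fixd : ∀ {a b e : I} (y : A), e ≠ a → e ≠ b → c e y = y → c e (d a b ⊓ y) = d a b ⊓ y :=
      fun y h h' hy => inf_fixed _ _ _ (c_d_of_ne h h') hy
    have h1 : c l (c j (d j k ⊓ x)) = c j (d j k ⊓ x) := by rw [c_comm, fixd x hj hk hx]
    have h2 : c l (c i (d i j ⊓ c j (d j k ⊓ x))) = c i (d i j ⊓ c j (d j k ⊓ x)) := by
      rw [c_comm, fixd _ hi hj h1]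
    rw [interchange, c_comm, fixd _ hk hi h2]

/-- A Boolean subalgebra closed under the cylindric operations is a cylindric algebra. -/
abbrev ofSubalgebra (S : BooleanSubalgebra A) (hc : ∀ (i : I), ∀ x ∈ S, c i x ∈ S)
    (hd : ∀ i j : I, d i j ∈ S) : CylindricAlgebra I S where
  c i x := ⟨c i x.1, hc i _ x.2⟩
  d i j := ⟨d i j, hd i j⟩
  c_bot i := Subtype.ext (c_bot i)
  le_c i x := le_c i x.1
  c_inf_c i x y := Subtype.ext (c_inf_c i x.1 y.1)
  c_comm i j x := Subtype.ext (c_comm i j x.1)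
  d_self i := Subtype.ext (d_self i)
  d_eq i j k h h' := Subtype.ext (d_eq i j k h h')
  c_d_disjoint i j x h := Subtype.ext (c_d_disjoint i j x.1 h)

/-- The reduct of a cylindric algebra to a subset of its dimensions. -/
abbrev reduct {D : Type*} (g : I ↪ D) (B : Type*) [CylindricAlgebra D B] :
    CylindricAlgebra I B where
  c i := c (g i)
  d i j := d (g i) (g j)
  c_bot i := c_bot (g i)
  le_c i := le_c (g i)
  c_inf_c i := c_inf_c (g i)
  c_comm i j := c_comm (g i) (g j)
  d_self i := d_self (g i)
  d_eq i j k h h' := d_eq (g i) (g j) (g k) (g.injective.ne h) (g.injective.ne h')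
  c_d_disjoint i j x h := c_d_disjoint (g i) (g j) x (g.injective.ne h)

end Basic

/-- A bijection that preserves the operations, as an isomorphism of first-order structures. -/
def equivOfOps {I : Type u} {A : Type v} {A' : Type w} [CylindricAlgebra I A]
    [CylindricAlgebra I A'] (f : A ≃ A')
    (bot : f ⊥ = ⊥) (top : f ⊤ = ⊤) (compl : ∀ x, f xᶜ = (f x)ᶜ)
    (sup : ∀ x y, f (x ⊔ y) = f x ⊔ f y) (inf : ∀ x y, f (x ⊓ y) = f x ⊓ f y)
    (hc : ∀ (i : I) x, f (c i x) = c i (f x)) (hd : ∀ i j : I, f (d i j) = d i j) :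
    (caLanguage I).Equiv A A' where
  toEquiv := f
  map_fun' := by
    intro k g x
    cases g
    exacts [bot, top, compl _, sup _ _, inf _ _, hc _ _, hd _ _]
  map_rel' r := Empty.elim r

section Maps

variable {I : Type u} {A : Type v} {A' : Type w} [CylindricAlgebra I A] [CylindricAlgebra I A']
  (e : (caLanguage I).Equiv A A')

theorem equiv_inf (x y : A) : e (x ⊓ y) = e x ⊓ e y :=
  e.map_fun (CAFunc.inf : CAFunc I 2) ![x, y]

theorem equiv_c (i : I) (x : A) : e (c i x) = c i (e x) :=
  e.map_fun (CAFunc.c i : CAFunc I 1) ![x]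

theorem equiv_d (i j : I) : e (d i j) = d i j :=
  e.map_fun (CAFunc.d i j : CAFunc I 0) ![]

theorem equiv_le {x y : A} (h : x ≤ y) : e x ≤ e y := by
  rw [← inf_eq_left] at h ⊢
  rw [← equiv_inf, h]

theorem equiv_le_iff {x y : A} : e x ≤ e y ↔ x ≤ y := by
  refine ⟨fun h => ?_, equiv_le e⟩
  rw [← inf_eq_left] at h ⊢
  exact e.injective (by rw [equiv_inf, h])

end Maps

theorem neatReduct_val_c {I : Type v} {J : Type w} (ι : I ↪ J) {B : Type u}
    [CylindricAlgebra J B] (i : I) (x : neatReduct ι B) : (c i x).1 = c (ι i) x.1 := rfl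

end CylindricAlgebra

/-! ### Neat reducts between ordinals and their interchange maps -/

section NrCA

variable {n m : Ordinal.{u}} {h : n ≤ m}

/-- The dimensions that are removed in the passage from dimension `m` to dimension `n`. -/
abbrev RemovedDim (h : n ≤ m) : Type u := {j : m.ToType // j ∉ Set.range (ordinalInclusion h)}

theorem exists_removedDim (h : n < m) : Nonempty (RemovedDim h.le) := by
  refine ⟨⟨Ordinal.ToType.mk ⟨n, h⟩, ?_⟩⟩
  rintro ⟨i, hi⟩
  have h1 := congrArg Subtype.val (Ordinal.ToType.mk.injective hi)
  exact absurd h1 (ne_of_lt (Ordinal.ToType.toOrd i).2)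

theorem NrCA.of_equiv {A A' : Type u} {S : (caLanguage n.ToType).Structure A}
    {S' : (caLanguage n.ToType).Structure A'} (hA : NrCA h A S)
    (e : @FirstOrder.Language.Equiv _ A' A S' S) : NrCA h A' S' := by
  obtain ⟨B, hB, ⟨f⟩⟩ := hA
  exact ⟨B, hB, ⟨f.comp e⟩⟩

open Classical in
/-- The dimensions below `m`, split into those below `n` and the removed ones. -/
noncomputable def splitDim (h : n ≤ m) : m.ToType ≃ n.ToType ⊕ RemovedDim h :=
  ((Equiv.sumCongr (Equiv.ofInjective _ (ordinalInclusion h).injective) (Equiv.refl _)).trans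
    (Equiv.Set.sumCompl (Set.range (ordinalInclusion h)))).symm

theorem splitDim_inclusion (i : n.ToType) : splitDim h (ordinalInclusion h i) = Sum.inl i :=
  (Equiv.symm_apply_eq _).mpr rfl

theorem splitDim_removed (j : RemovedDim h) : splitDim h j.1 = Sum.inr j :=
  (Equiv.symm_apply_eq _).mpr rfl

/-- Neat reducts of algebras with more additional dimensions than `m` has over `n` are neat
reducts of algebras of dimension `m`. -/
theorem nrCA_neatReduct_inl {J : Type*} (o : RemovedDim h ↪ J) (B : Type u)
    [CylindricAlgebra (n.ToType ⊕ J) B] :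
    NrCA h (neatReduct (Function.Embedding.inl : n.ToType ↪ n.ToType ⊕ J) B)
      (caStructure n.ToType _) := by
  -- The elements fixed by the dimensions outside the range of `g` form an algebra of dimension `m`.
  -- Its neat reduct to `n` again consists of the elements fixed by all of `J`.
  let g : m.ToType ↪ n.ToType ⊕ J :=
    (splitDim h).toEmbedding.trans ((Function.Embedding.refl _).sumMap o)
  have g_inl : ∀ i, g (ordinalInclusion h i) = Sum.inl i := fun i => by
    simp [g, splitDim_inclusion]
  have g_inr : ∀ j : RemovedDim h, g j.1 = Sum.inr (o j) := fun j => by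
    simp [g, splitDim_removed]
  have inr_not_mem : ∀ j : J, (Sum.inr j : n.ToType ⊕ J) ∉
      Set.range (Function.Embedding.inl : n.ToType ↪ n.ToType ⊕ J) := by simp
  refine ⟨neatReduct g B, inferInstance, ⟨equivOfOps
    { toFun := fun x => ⟨⟨x.1, fun a ha => ?_⟩, fun j hj => Subtype.ext ?_⟩
      invFun := fun x => ⟨x.1.1, fun a ha => ?_⟩
      left_inv := fun x => rfl
      right_inv := fun x => rfl } rfl rfl (fun _ => rfl) (fun _ _ => rfl) (fun _ _ => rfl) ?_ ?_⟩⟩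
  · rcases a with i | j
    · exact absurd ⟨_, g_inl i⟩ ha
    · exact x.2 _ (inr_not_mem j)
  · rw [neatReduct_val_c, g_inr ⟨j, hj⟩]
    exact x.2 _ (inr_not_mem _)
  · rcases a with i | j
    · exact absurd ⟨i, rfl⟩ ha
    · by_cases hj : Sum.inr j ∈ Set.range g
      · obtain ⟨l, hl⟩ := hj
        have h1 : l ∉ Set.range (ordinalInclusion h) := by
          rintro ⟨i, rfl⟩
          rw [g_inl] at hl
          cases hl
        have h2 := congrArg Subtype.val (x.2 l h1)
        rwa [neatReduct_val_c, hl] at h2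
      · exact x.1.2 _ hj
  · intro i x
    refine Subtype.ext (Subtype.ext ?_)
    change c (Sum.inl i) x.1 = c (g (ordinalInclusion h i)) x.1
    rw [g_inl]
  · intro i j
    refine Subtype.ext (Subtype.ext ?_)
    change d (Sum.inl i) (Sum.inl j) = d (g (ordinalInclusion h i)) (g (ordinalInclusion h j))
    rw [g_inl, g_inl]

/-- In a neat reduct with at least one removed dimension, interchanging two dimensions maps one
relativization injectively into another one. -/
theorem NrCA.exists_injective_interchange (hnm : n < m) {A : Type u} [CylindricAlgebra n.ToType A]
    (hA : NrCA hnm.le A (caStructure n.ToType A)) {i j : n.ToType} (hij : i ≠ j) {p q w : A}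
    (hp : c j p = p) (hq : c i q = q) (hwi : c i w = w) (hwj : c j w = w) :
    ∃ f : {x // x ≤ p ⊓ q ⊓ w} → {x // x ≤ c i (d i j ⊓ p) ⊓ c j (d j i ⊓ q) ⊓ w},
      Function.Injective f := by
  obtain ⟨B, hB, ⟨e⟩⟩ := hA
  -- Any removed dimension can serve as the spare one, since elements of the neat reduct do not
  -- depend on it.
  obtain ⟨k, hk⟩ := exists_removedDim hnm
  set ι := ordinalInclusion hnm.le with hι
  have hik : ι i ≠ k := fun h => hk ⟨i, h⟩
  have hjk : ι j ≠ k := fun h => hk ⟨j, h⟩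
  have hij' : ι i ≠ ι j := ι.injective.ne hij
  have fix : ∀ {l : n.ToType} {x : A}, c l x = x → c (ι l) (e x).1 = (e x).1 := fun {l x} hx => by
    rw [← neatReduct_val_c, ← equiv_c, hx]
  let s : A → neatReduct ι B := fun x =>
    ⟨interchange (ι i) (ι j) k (e x).1, fun l hl => c_interchange (fun h => hl ⟨i, h.symm⟩)
      (fun h => hl ⟨j, h.symm⟩) ((e x).2 l hl)⟩
  refine ⟨fun x => ⟨e.symm (s x.1), ?_⟩, fun x y hxy => ?_⟩
  · rw [← equiv_le_iff e, e.apply_symm_apply]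
    have h1 := interchange_le hij' hik hjk (fix hp) ((e p).2 k hk) (fix hq) ((e q).2 k hk)
      (fix hwi) (fix hwj) ((e w).2 k hk)
      (show (e x.1).1 ≤ (e p).1 ⊓ (e q).1 ⊓ (e w).1 by
        have := equiv_le e x.2
        rwa [equiv_inf, equiv_inf] at this)
    rw [equiv_inf, equiv_inf, equiv_c, equiv_c, equiv_inf, equiv_inf, equiv_d, equiv_d]
    exact h1
  · have h1 : s x.1 = s y.1 := e.symm.injective (congrArg Subtype.val hxy)
    have h2 := interchange_injOn hij' hik hjk ((e x.1).2 k hk) ((e y.1).2 k hk)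
      (congrArg Subtype.val h1)
    exact Subtype.ext (e.injective (Subtype.ext h2))

end NrCA

/-! ### Splitting sets whose truncated cardinalities agree -/

section Cardinals

/-- Totals that agree up to `2 * N` are split by cutting off `min p N`. If `p < N` the cut is exact;
otherwise `p` and `q` are both at least `N`, and at least `N` remain after the cut. -/
theorem ENat.min_add_eq_min_aux {p q v : ℕ∞} {N : ℕ} (h : p < N ∨ N ≤ q)
    (hpq : min (p + q) ((2 * N : ℕ) : ℕ∞) = min v ((2 * N : ℕ) : ℕ∞)) :
    min p N ≤ v ∧ ∀ q', min p N + q' = v → min q N = min q' N := by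
  have castmin : ∀ a b : ℕ, min (a : ℕ∞) (b : ℕ∞) = ((min a b : ℕ) : ℕ∞) := fun a b =>
    (Nat.mono_cast.map_min).symm
  refine ⟨?_, fun q' hq' => ?_⟩
  · induction p <;> induction q <;> induction v <;>
      simp only [top_add, add_top, min_eq_right, le_top, ← Nat.cast_add, castmin, Nat.cast_inj,
        Nat.cast_lt, not_top_lt, Nat.cast_le, false_or, or_true] at h hpq ⊢ <;> omega
  · induction p <;> induction q <;> induction v <;> induction q' <;>
      simp only [top_add, add_top, min_eq_right, le_top, ← Nat.cast_add, castmin, Nat.cast_inj,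
        Nat.cast_lt, not_top_lt, Nat.cast_le, false_or, or_true, ENat.natCast_ne_top,
        ENat.top_ne_natCast] at h hpq hq' ⊢ <;> omega

variable {S T : Type*}

theorem Set.exists_subset_min_encard_eq {U : Set S} {V : Set T} {N : ℕ}
    (h : min U.encard ((2 * N : ℕ) : ℕ∞) = min V.encard ((2 * N : ℕ) : ℕ∞)) {D : Set S}
    (hD : D ⊆ U) :
    ∃ D' ⊆ V, min D.encard (N : ℕ∞) = min D'.encard (N : ℕ∞) ∧
      min (U \ D).encard (N : ℕ∞) = min (V \ D').encard (N : ℕ∞) := by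
  have key : ∀ {E : Set S}, E ⊆ U → (E.encard < N ∨ N ≤ (U \ E).encard) →
      ∃ E' ⊆ V, min E.encard (N : ℕ∞) = min E'.encard (N : ℕ∞) ∧
        min (U \ E).encard (N : ℕ∞) = min (V \ E').encard (N : ℕ∞) := fun {E} hE hc => by
    rw [← Set.encard_sdiff_add_encard_of_subset hE, add_comm] at h
    obtain ⟨h1, h2⟩ := ENat.min_add_eq_min_aux hc h
    obtain ⟨E', hE', h3⟩ := Set.exists_subset_encard_eq h1
    refine ⟨E', hE', by rw [h3, min_assoc, min_self], h2 _ ?_⟩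
    rw [add_comm, ← h3, Set.encard_sdiff_add_encard_of_subset hE']
  by_cases hc : D.encard < N ∨ N ≤ (U \ D).encard
  · exact key hD hc
  -- Now the complement of `D` is the small part; it is split off instead, and the two parts change
  -- roles.
  · rw [not_or, not_le] at hc
    obtain ⟨E', hE', h1, h2⟩ := key (E := U \ D) Set.sdiff_subset (Or.inl hc.2)
    rw [Set.sdiff_sdiff_cancel_left hD] at h2
    exact ⟨V \ E', Set.sdiff_subset, h2, by rwa [Set.sdiff_sdiff_cancel_left hE']⟩

theorem Set.exists_min_encard_fiber_eq {C : Type*} {a : S → C} {b : T → C} {N : ℕ}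
    (h : ∀ x, min {s | a s = x}.encard ((2 * N : ℕ) : ℕ∞) =
      min {t | b t = x}.encard ((2 * N : ℕ) : ℕ∞)) (D : Set S) :
    ∃ D' : Set T, ∀ x,
      min {s | a s = x ∧ s ∈ D}.encard (N : ℕ∞) = min {t | b t = x ∧ t ∈ D'}.encard (N : ℕ∞) ∧
      min {s | a s = x ∧ s ∉ D}.encard (N : ℕ∞) = min {t | b t = x ∧ t ∉ D'}.encard (N : ℕ∞) := by
  choose E hE h1 h2 using fun x =>
    Set.exists_subset_min_encard_eq (h x) (D := {s | a s = x ∧ s ∈ D}) (fun s hs => hs.1)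
  refine ⟨{t | t ∈ E (b t)}, fun x => ⟨?_, ?_⟩⟩
  · rw [h1]
    congr 2
    ext t
    exact ⟨fun ht => ⟨hE x ht, by rwa [Set.mem_ofPred_eq, show b t = x from hE x ht]⟩,
      fun ht => by have := ht.2; rwa [Set.mem_ofPred_eq, ht.1] at this⟩
  · have e1 : {s | a s = x ∧ s ∉ D} = {s | a s = x} \ {s | a s = x ∧ s ∈ D} := by
      ext s; simp only [Set.mem_ofPred_eq, Set.mem_sdiff]; tauto
    have e2 : {t | b t = x ∧ t ∉ {t | t ∈ E (b t)}} = {t | b t = x} \ E x := by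
      ext t
      simp only [Set.mem_ofPred_eq, Set.mem_sdiff]
      exact and_congr_right fun ht => by rw [ht]
    rw [e1, e2, h2]

end Cardinals

/-- The quantifier rank of a formula. -/
def FirstOrder.Language.BoundedFormula.quantifierRank {L : FirstOrder.Language} {α : Type*} :
    {k : ℕ} → L.BoundedFormula α k → ℕ
  | _, .falsum => 0
  | _, .equal _ _ => 0
  | _, .rel _ _ => 0
  | _, .imp φ ψ => max φ.quantifierRank ψ.quantifierRank
  | _, .all φ => φ.quantifierRank + 1

/-! ### A back-and-forth game on membership patterns -/

section Game

variable {A : Type u} [BooleanAlgebra A] {G : Type w} {a : A} {ρ : A → Set G} {S : Type*}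

/-- The membership pattern of a point of `G` given by a tuple of elements. -/
def memberPattern {A : Type*} {G : Type*} (ρ : A → Set G) {k : ℕ} (x : Fin k → A)
    (g : G) : Fin k → Prop := fun i => g ∈ ρ (x i)

/-- Two tuples that agree outside of the power component and cannot be distinguished there by `r`
rounds of the comparison game. The points of the power component of the coarsened algebra are
represented by the section `σ`. -/
structure GameSimilar (a : A) (ρ : A → Set G) (σ : S → G) (r : ℕ) {k : ℕ}
    (x y : Fin k → A) : Prop where
  off : ∀ i, x i ⊓ aᶜ = y i ⊓ aᶜ
  card : ∀ C : Fin k → Prop, min {s | memberPattern ρ x (σ s) = C}.encard ((2 ^ r : ℕ) : ℕ∞) =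
    min {g | memberPattern ρ y g = C}.encard ((2 ^ r : ℕ) : ℕ∞)

/-- The threshold `2 ^ r` is at least one, so truncated cardinalities decide whether a pattern
occurs. -/
theorem GameSimilar.nonempty_iff {σ : S → G} {r k : ℕ} {x y : Fin k → A}
    (h : GameSimilar a ρ σ r x y)
    (β : Set (Fin k → Prop)) :
    {s | memberPattern ρ x (σ s) ∈ β}.Nonempty ↔ {g | memberPattern ρ y g ∈ β}.Nonempty := by
  have key : ∀ C, {s | memberPattern ρ x (σ s) = C}.Nonempty ↔
      {g | memberPattern ρ y g = C}.Nonempty := by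
    intro C
    have h1 := h.card C
    rw [← not_iff_not, Set.not_nonempty_iff_eq_empty, Set.not_nonempty_iff_eq_empty]
    have h0 : ((2 ^ r : ℕ) : ℕ∞) ≠ 0 := by simp
    constructor <;> intro h2
    · rw [h2, Set.encard_empty, zero_min] at h1
      rw [← Set.encard_eq_zero]
      exact (min_eq_bot.mp h1.symm).resolve_right h0
    · rw [h2, Set.encard_empty, zero_min] at h1
      rw [← Set.encard_eq_zero]
      exact (min_eq_bot.mp h1).resolve_right h0
  constructor
  · rintro ⟨s, hs⟩
    obtain ⟨g, hg⟩ := (key _).mp ⟨s, rfl⟩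
    exact ⟨g, by rw [Set.mem_ofPred_eq, show memberPattern ρ y g = _ from hg]; exact hs⟩
  · rintro ⟨g, hg⟩
    obtain ⟨s, hs⟩ := (key _).mpr ⟨g, rfl⟩
    exact ⟨s, by rw [Set.mem_ofPred_eq, show memberPattern ρ x (σ s) = _ from hs]; exact hg⟩

theorem memberPattern_snoc {A G : Type*} {ρ : A → Set G} {k : ℕ} (x : Fin k → A)
    (z : A) (g : G) (C : Fin (k + 1) → Prop) :
    memberPattern ρ (Fin.snoc x z) g = C ↔
      memberPattern ρ x g = Fin.init C ∧ (g ∈ ρ z ↔ C (Fin.last k)) := by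
  constructor
  · rintro rfl
    refine ⟨funext fun i => ?_, ?_⟩
    · simp [memberPattern, Fin.init]
    · simp [memberPattern]
  · rintro ⟨h1, h2⟩
    refine funext fun i => Fin.lastCases ?_ (fun j => ?_) i
    · simpa [memberPattern] using h2
    · have := congrFun h1 j
      simpa [memberPattern, Fin.init] using this

/-- A new element splits every pattern class in two. It suffices to match both halves up to half of
the old threshold. -/
theorem GameSimilar.snoc {σ : S → G} {r k : ℕ} {x y : Fin k → A} {z z' : A}
    (h : GameSimilar a ρ σ (r + 1) x y) (hz : z ⊓ aᶜ = z' ⊓ aᶜ)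
    (h1 : ∀ C, min {s | memberPattern ρ x (σ s) = C ∧ σ s ∈ ρ z}.encard ((2 ^ r : ℕ) : ℕ∞) =
      min {g | memberPattern ρ y g = C ∧ g ∈ ρ z'}.encard ((2 ^ r : ℕ) : ℕ∞))
    (h2 : ∀ C, min {s | memberPattern ρ x (σ s) = C ∧ σ s ∉ ρ z}.encard ((2 ^ r : ℕ) : ℕ∞) =
      min {g | memberPattern ρ y g = C ∧ g ∉ ρ z'}.encard ((2 ^ r : ℕ) : ℕ∞)) :
    GameSimilar a ρ σ r (Fin.snoc x z : Fin (k + 1) → A) (Fin.snoc y z') where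
  off i := Fin.lastCases (by simpa using hz) (fun j => by simpa using h.off j) i
  card C := by
    simp only [memberPattern_snoc]
    by_cases hC : C (Fin.last k)
    · simpa only [hC, iff_true] using h1 (Fin.init C)
    · simpa only [hC, iff_false] using h2 (Fin.init C)

end Game

/-- The relativization of the cylindric algebra `A` to its element `a` is the power set of `G`,
and the cylindrifications do not distinguish the nonzero elements of this relativization. -/
structure IsPowerComponent (I : Type v) {A : Type u} [CylindricAlgebra I A] {G : Type w} (a : A)
    (ρ : A → Set G) : Prop where
  inf : ∀ x y, ρ (x ⊓ y) = ρ x ∩ ρ y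
  compl : ∀ x, ρ xᶜ = (ρ x)ᶜ
  c : ∀ (i : I) x, ρ (c i x) = ∅ ∨ ρ (c i x) = Set.univ
  d : ∀ i j : I, ρ (d i j) = ∅ ∨ ρ (d i j) = Set.univ
  c_congr : ∀ (i : I) x y, x ⊓ aᶜ = y ⊓ aᶜ → ((ρ x).Nonempty ↔ (ρ y).Nonempty) →
    CylindricAlgebra.c i x = CylindricAlgebra.c i y
  ext : ∀ x y, x ⊓ aᶜ = y ⊓ aᶜ → ρ x = ρ y → x = y
  surj : ∀ x (X : Set G), ∃ y, y ⊓ aᶜ = x ⊓ aᶜ ∧ ρ y = X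

/-! ### Coarsening a power component -/

namespace IsPowerComponent

variable {I : Type v} {A : Type u} [CylindricAlgebra I A] {G : Type w} {a : A} {ρ : A → Set G}
  {S : Type*}

theorem bot (hρ : IsPowerComponent I a ρ) : ρ ⊥ = ∅ := by
  rw [← inf_compl_self (⊥ : A), hρ.inf, hρ.compl, Set.inter_compl_self]

theorem top (hρ : IsPowerComponent I a ρ) : ρ ⊤ = Set.univ := by
  rw [← compl_bot, hρ.compl, hρ.bot, Set.compl_empty]

theorem sup (hρ : IsPowerComponent I a ρ) (x y : A) : ρ (x ⊔ y) = ρ x ∪ ρ y := by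
  rw [← compl_compl (x ⊔ y), compl_sup, hρ.compl, hρ.inf, hρ.compl, hρ.compl, Set.compl_inter,
    compl_compl, compl_compl]

/-- The elements whose part in the power component is saturated for the map `f`. -/
def coarsening (hρ : IsPowerComponent I a ρ) (f : G → S) : BooleanSubalgebra A where
  carrier := {x | ∃ X : Set S, ρ x = f ⁻¹' X}
  supClosed' := by
    rintro x ⟨X, hX⟩ y ⟨Y, hY⟩
    exact ⟨X ∪ Y, by rw [hρ.sup, hX, hY, Set.preimage_union]⟩
  infClosed' := by
    rintro x ⟨X, hX⟩ y ⟨Y, hY⟩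
    exact ⟨X ∩ Y, by rw [hρ.inf, hX, hY, Set.preimage_inter]⟩
  compl_mem' := by
    rintro x ⟨X, hX⟩
    exact ⟨Xᶜ, by rw [hρ.compl, hX, Set.preimage_compl]⟩
  bot_mem' := ⟨∅, by rw [hρ.bot, Set.preimage_empty]⟩

theorem mem_coarsening_of_trivial (hρ : IsPowerComponent I a ρ) (f : G → S) {x : A}
    (h : ρ x = ∅ ∨ ρ x = Set.univ) : x ∈ hρ.coarsening f := by
  rcases h with h | h
  · exact ⟨∅, by rw [h, Set.preimage_empty]⟩
  · exact ⟨Set.univ, by rw [h, Set.preimage_univ]⟩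

instance (hρ : IsPowerComponent I a ρ) (f : G → S) : CylindricAlgebra I (hρ.coarsening f) :=
  ofSubalgebra (hρ.coarsening f) (fun i x _ => hρ.mem_coarsening_of_trivial f (hρ.c i x))
    (fun i j => hρ.mem_coarsening_of_trivial f (hρ.d i j))

/-- Inside the component every term is a Boolean combination `β` of its arguments, the same for both
tuples: cylindrifications and diagonals are trivial there, and by `c_congr` a cylindrification sees
the component part of its argument only through emptiness. In the coarsening the pattern can be read
at `σ (f g)` because elements are saturated for `f`. -/
theorem exists_realize_eq (hρ : IsPowerComponent I a ρ) {f : G → S} {σ : S → G}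
    (hσ : Function.RightInverse σ f) {r k : ℕ} {x : Fin k → hρ.coarsening f} {y : Fin k → A}
    (h : GameSimilar a ρ σ r (fun i => (x i).1) y) (t : (caLanguage I).Term (Empty ⊕ Fin k)) :
    (t.realize (Sum.elim Empty.elim x)).1 ⊓ aᶜ = t.realize (Sum.elim Empty.elim y) ⊓ aᶜ ∧
    ∃ β : Set (Fin k → Prop),
      ρ (t.realize (Sum.elim Empty.elim x)).1 =
        {g | memberPattern ρ (fun i => (x i).1) (σ (f g)) ∈ β} ∧
      ρ (t.realize (Sum.elim Empty.elim y)) = {g | memberPattern ρ y g ∈ β} := by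
  have triv : ∀ z : A, ρ z = ∅ ∨ ρ z = Set.univ → ∃ β : Set (Fin k → Prop),
      ρ z = {g | memberPattern ρ (fun i => (x i).1) (σ (f g)) ∈ β} ∧
        ρ z = {g | memberPattern ρ y g ∈ β} := fun z hz => by
    rcases hz with hz | hz
    · exact ⟨∅, by simp [hz], by simp [hz]⟩
    · exact ⟨Set.univ, by simp [hz], by simp [hz]⟩
  induction t with
  | var z =>
    rcases z with z | i
    · exact z.elim
    · refine ⟨h.off i, {C | C i}, ?_, rfl⟩
      obtain ⟨X, hX⟩ := (x i).2
      ext g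
      change g ∈ ρ (x i).1 ↔ σ (f g) ∈ ρ (x i).1
      rw [hX, Set.mem_preimage, Set.mem_preimage, hσ]
  | func F ts ih =>
    cases F with
    | bot => exact ⟨rfl, triv ⊥ (Or.inl hρ.bot)⟩
    | top => exact ⟨rfl, triv ⊤ (Or.inr hρ.top)⟩
    | compl =>
      obtain ⟨h1, β, h2, h3⟩ := ih 0
      set X := ((ts 0).realize (Sum.elim Empty.elim x))
      set Y := ((ts 0).realize (Sum.elim Empty.elim y))
      change (X.1)ᶜ ⊓ aᶜ = Yᶜ ⊓ aᶜ ∧ ∃ β, ρ (X.1)ᶜ = _ ∧ ρ Yᶜ = _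
      refine ⟨?_, βᶜ, by rw [hρ.compl, h2]; rfl, by rw [hρ.compl, h3]; rfl⟩
      have : ∀ z : A, zᶜ ⊓ aᶜ = (z ⊓ aᶜ)ᶜ ⊓ aᶜ := fun z => by
        rw [compl_inf, compl_compl, inf_sup_right, inf_compl_self, sup_bot_eq]
      rw [this, h1, ← this]
    | sup =>
      obtain ⟨h1, β, h2, h3⟩ := ih 0
      obtain ⟨h1', β', h2', h3'⟩ := ih 1
      set X := ((ts 0).realize (Sum.elim Empty.elim x))
      set Y := ((ts 0).realize (Sum.elim Empty.elim y))
      set X' := ((ts 1).realize (Sum.elim Empty.elim x))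
      set Y' := ((ts 1).realize (Sum.elim Empty.elim y))
      change (X.1 ⊔ X'.1) ⊓ aᶜ = (Y ⊔ Y') ⊓ aᶜ ∧ ∃ β, ρ (X.1 ⊔ X'.1) = _ ∧ ρ (Y ⊔ Y') = _
      refine ⟨by rw [inf_sup_right, inf_sup_right, h1, h1'], β ∪ β', ?_, ?_⟩
      · rw [hρ.sup, h2, h2']; rfl
      · rw [hρ.sup, h3, h3']; rfl
    | inf =>
      obtain ⟨h1, β, h2, h3⟩ := ih 0
      obtain ⟨h1', β', h2', h3'⟩ := ih 1
      set X := ((ts 0).realize (Sum.elim Empty.elim x))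
      set Y := ((ts 0).realize (Sum.elim Empty.elim y))
      set X' := ((ts 1).realize (Sum.elim Empty.elim x))
      set Y' := ((ts 1).realize (Sum.elim Empty.elim y))
      change (X.1 ⊓ X'.1) ⊓ aᶜ = (Y ⊓ Y') ⊓ aᶜ ∧ ∃ β, ρ (X.1 ⊓ X'.1) = _ ∧ ρ (Y ⊓ Y') = _
      refine ⟨by rw [inf_assoc, h1', inf_left_comm, h1, inf_left_comm, inf_assoc], β ∩ β', ?_, ?_⟩
      · rw [hρ.inf, h2, h2']; rfl
      · rw [hρ.inf, h3, h3']; rfl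
    | c i =>
      obtain ⟨h1, β, h2, h3⟩ := ih 0
      set X := ((ts 0).realize (Sum.elim Empty.elim x))
      set Y := ((ts 0).realize (Sum.elim Empty.elim y))
      change CylindricAlgebra.c i X.1 ⊓ aᶜ = CylindricAlgebra.c i Y ⊓ aᶜ ∧
        ∃ β, ρ (CylindricAlgebra.c i X.1) = _ ∧ ρ (CylindricAlgebra.c i Y) = _
      have h4 : CylindricAlgebra.c i X.1 = CylindricAlgebra.c i Y := by
        refine hρ.c_congr i _ _ h1 ?_
        rw [h2, h3, ← h.nonempty_iff]
        exact ⟨fun ⟨g, hg⟩ => ⟨f g, hg⟩, fun ⟨s, hs⟩ => ⟨σ s, by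
          rwa [Set.mem_ofPred_eq, hσ]⟩⟩
      rw [h4]
      exact ⟨rfl, triv _ (hρ.c i Y)⟩
    | d i j => exact ⟨rfl, triv _ (hρ.d i j)⟩

/-- Two values are equal iff they agree outside the component and no pattern in `symmDiff β β'`
occurs, which both tuples see alike. A quantifier uses up one round of the game, and `surj` realizes
the answers. -/
theorem realize_iff (hρ : IsPowerComponent I a ρ) {f : G → S} {σ : S → G}
    (hσ : Function.RightInverse σ f) {k : ℕ} (φ : (caLanguage I).BoundedFormula Empty k) :
    ∀ (r : ℕ), φ.quantifierRank ≤ r → ∀ (x : Fin k → hρ.coarsening f) (y : Fin k → A),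
      GameSimilar a ρ σ r (fun i => (x i).1) y →
      (φ.Realize Empty.elim x ↔ φ.Realize Empty.elim y) := by
  induction φ with
  | falsum => intros; rfl
  | equal t t' =>
    intro r _ x y h
    obtain ⟨h1, β, h2, h3⟩ := exists_realize_eq hρ hσ h t
    obtain ⟨h1', β', h2', h3'⟩ := exists_realize_eq hρ hσ h t'
    change t.realize _ = t'.realize _ ↔ t.realize _ = t'.realize _
    set X := t.realize (Sum.elim Empty.elim x)
    set Y := t.realize (Sum.elim Empty.elim y)
    set X' := t'.realize (Sum.elim Empty.elim x)
    set Y' := t'.realize (Sum.elim Empty.elim y)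
    have h4 := h.nonempty_iff (symmDiff β β')
    have h5 : {s | memberPattern ρ (fun i => (x i).1) (σ s) ∈ symmDiff β β'}.Nonempty ↔
        ρ X.1 ≠ ρ X'.1 := by
      rw [h2, h2', ← Set.symmDiff_nonempty]
      exact ⟨fun ⟨s, hs⟩ => ⟨σ s, by
        change memberPattern ρ _ (σ (f (σ s))) ∈ symmDiff β β'; rwa [hσ]⟩, fun ⟨g, hg⟩ => ⟨f g, hg⟩⟩
    have h6 : {g | memberPattern ρ y g ∈ symmDiff β β'}.Nonempty ↔ ρ Y ≠ ρ Y' := by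
      rw [h3, h3', ← Set.symmDiff_nonempty]
      rfl
    rw [h5, h6, not_iff_not] at h4
    constructor
    · intro h7
      refine hρ.ext _ _ (by rw [← h1, ← h1', h7]) (h4.mp (by rw [h7]))
    · intro h7
      refine Subtype.ext (hρ.ext _ _ (by rw [h1, h1', h7]) (h4.mpr (by rw [h7])))
  | rel r => exact Empty.elim r
  | imp φ ψ ih1 ih2 =>
    intro r hr x y h
    exact imp_congr (ih1 r ((le_max_left _ _).trans hr) x y h)
      (ih2 r ((le_max_right _ _).trans hr) x y h)
  | @all k φ ih =>
    intro r hr x y h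
    obtain ⟨r, rfl⟩ : ∃ r', r = r' + 1 := ⟨r - 1, by
      have : φ.quantifierRank + 1 ≤ r := hr
      omega⟩
    have hr' : φ.quantifierRank ≤ r := Nat.le_of_succ_le_succ hr
    have hcard := h.card
    -- The threshold becomes `2 * 2 ^ r`, twice the one needed after the round.
    rw [pow_succ'] at hcard
    have coe_snoc : ∀ z, (fun i => ((Fin.snoc x z : Fin (k + 1) → hρ.coarsening f) i).1) =
        (Fin.snoc (fun i => (x i).1) z.1 : Fin (k + 1) → A) := fun z =>
      funext fun i => Fin.lastCases (by simp) (fun j => by simp) i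
    change (∀ z, φ.Realize _ (Fin.snoc x z)) ↔ (∀ z, φ.Realize _ (Fin.snoc y z))
    constructor
    · intro hall z
      obtain ⟨D, hD⟩ := Set.exists_min_encard_fiber_eq (fun C => (hcard C).symm) (ρ z)
      -- The answer copies `z` outside the component; inside, a preimage under `f` is saturated, so
      -- the answer lies in the coarsening.
      obtain ⟨z', hz1, hz2⟩ := hρ.surj z (f ⁻¹' D)
      have hz3 : ∀ s, σ s ∈ ρ z' ↔ s ∈ D := fun s => by rw [hz2, Set.mem_preimage, hσ]
      refine (ih r hr' (Fin.snoc x ⟨z', D, hz2⟩) (Fin.snoc y z) ?_).mp (hall _)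
      rw [coe_snoc]
      refine h.snoc hz1 (fun C => ?_) (fun C => ?_)
      · simp only [hz3]; exact ((hD C).1).symm
      · simp only [hz3]; exact ((hD C).2).symm
    · intro hall z
      obtain ⟨D, hD⟩ := Set.exists_min_encard_fiber_eq hcard {s | σ s ∈ ρ z.1}
      obtain ⟨z', hz1, hz2⟩ := hρ.surj z.1 D
      refine (ih r hr' (Fin.snoc x z) (Fin.snoc y z') ?_).mpr (hall _)
      rw [coe_snoc]
      refine h.snoc hz1.symm (fun C => ?_) (fun C => ?_)
      · rw [hz2]; exact (hD C).1
      · rw [hz2]; exact (hD C).2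

/-- An algebra and its coarsening satisfy the same sentences of quantifier rank at most `r`,
provided that the coarsened power component has enough points. -/
theorem realize_sentence_iff (hρ : IsPowerComponent I a ρ) {f : G → S}
    (hf : Function.Surjective f) {r : ℕ} (hG : ((2 ^ r : ℕ) : ℕ∞) ≤ ENat.card G)
    (hS : ((2 ^ r : ℕ) : ℕ∞) ≤ ENat.card S) (φ : (caLanguage I).Sentence)
    (hφ : φ.quantifierRank ≤ r) : hρ.coarsening f ⊨ φ ↔ A ⊨ φ := by
  have e0 : (Empty.elim : Empty → A) = default := Subsingleton.elim _ _
  have e1 : (Empty.elim : Empty → hρ.coarsening f) = default := Subsingleton.elim _ _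
  have h := realize_iff hρ (Function.rightInverse_surjInv hf) φ r hφ default default
    -- The empty tuple has a single pattern, shared by all points, so both cardinalities truncate to
    -- `2 ^ r`.
    ⟨fun i => i.elim0, fun C => by
      rw [show {s | memberPattern ρ _ (Function.surjInv hf s) = C} = Set.univ by
          ext t; simp [Subsingleton.elim _ C],
        show {g | memberPattern ρ _ g = C} = Set.univ by ext t; simp [Subsingleton.elim _ C],
        Set.encard_univ, Set.encard_univ, min_eq_right hG, min_eq_right hS]⟩
  rw [e0, e1] at h
  exact h

end IsPowerComponent

/-! Sequences of points that belong to groups indexed by the dimensions. -/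

section TypedPoints

/-- Sequences over `Option (I × G)` that differ in finitely many places from the sequence which
has the zero of the `i`-th copy of `G` in the dimension `i : I`. -/
abbrev TypedSeq (I O G : Type u) [Zero G] : Type u :=
  {s : I ⊕ O → Option (I × G) //
    {j | s j ≠ Sum.elim (fun i => some (i, 0)) (fun _ => none) j}.Finite}

namespace TypedSeq

variable {I O G : Type u} [AddCommGroup G]

theorem ext {s t : TypedSeq I O G} (h : ∀ j, s.1 j = t.1 j) : s = t := Subtype.ext (funext h)

open Classical in
/-- The sequence `s` with `u` in place of the entry in dimension `j`. -/
noncomputable def update (s : TypedSeq I O G) (j : I ⊕ O) (u : Option (I × G)) : TypedSeq I O G :=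
  ⟨Function.update s.1 j u, (s.2.insert j).subset fun k hk => by
    by_cases h : k = j
    · exact Or.inl h
    · exact Or.inr (by rwa [Set.mem_ofPred_eq, Function.update_of_ne h] at hk)⟩

theorem update_self (s : TypedSeq I O G) (j : I ⊕ O) (u : Option (I × G)) :
    (s.update j u).1 j = u := by classical exact Function.update_self ..

theorem update_of_ne (s : TypedSeq I O G) {j k : I ⊕ O} (h : k ≠ j) (u : Option (I × G)) :
    (s.update j u).1 k = s.1 k := by classical exact Function.update_of_ne h ..

theorem update_eq (s : TypedSeq I O G) (j : I ⊕ O) : s.update j (s.1 j) = s :=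
  Subtype.ext (by classical exact Function.update_eq_self ..)

theorem update_update (s : TypedSeq I O G) (j : I ⊕ O) (u v : Option (I × G)) :
    (s.update j u).update j v = s.update j v :=
  Subtype.ext (by classical exact Function.update_idem ..)

theorem update_comm (s : TypedSeq I O G) {j k : I ⊕ O} (h : j ≠ k) (u v : Option (I × G)) :
    (s.update j u).update k v = (s.update k v).update j u :=
  Subtype.ext (by classical exact Function.update_comm h ..)

/-- The cylindric set algebra of all sets of sequences. -/
noncomputable instance : CylindricAlgebra (I ⊕ O) (Set (TypedSeq I O G)) where
  c j Y := {s | ∃ u, s.update j u ∈ Y}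
  d i j := {s | s.1 i = s.1 j}
  c_bot j := by ext s; simp
  le_c j Y s hs := ⟨s.1 j, by rwa [update_eq]⟩
  c_inf_c j Y Z := by
    ext s
    constructor
    · rintro ⟨u, h1, v, h2⟩
      exact ⟨⟨u, h1⟩, v, by rwa [update_update] at h2⟩
    · rintro ⟨⟨u, h1⟩, v, h2⟩
      exact ⟨u, h1, v, by rwa [update_update]⟩
  c_comm i j Y := by
    rcases eq_or_ne i j with rfl | h
    · rfl
    ext s
    constructor
    · rintro ⟨u, v, h1⟩
      exact ⟨v, u, by rwa [update_comm _ h.symm]⟩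
    · rintro ⟨u, v, h1⟩
      exact ⟨v, u, by rwa [update_comm _ h]⟩
  d_self i := by ext s; simp
  d_eq i j k h h' := by
    ext s
    constructor
    · intro hs
      refine ⟨s.1 i, ?_, ?_⟩
      · change (s.update k _).1 i = (s.update k _).1 k
        rw [update_self, update_of_ne _ h.symm]
      · change (s.update k _).1 k = (s.update k _).1 j
        rw [update_self, update_of_ne _ h'.symm]
        exact hs
    · rintro ⟨u, h1, h2⟩
      change (s.update k _).1 i = (s.update k _).1 k at h1
      change (s.update k _).1 k = (s.update k _).1 j at h2
      have h3 := h1.trans h2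
      rwa [update_of_ne _ h.symm, update_of_ne _ h'.symm] at h3
  c_d_disjoint i j Y h := by
    refine Set.eq_empty_iff_forall_notMem.mpr ?_
    rintro s ⟨⟨u, h1, h2⟩, v, h3, h4⟩
    change (s.update i _).1 i = (s.update i _).1 j at h1 h3
    rw [update_self, update_of_ne _ h.symm] at h1 h3
    rw [h1] at h2
    rw [h3] at h4
    exact h4 h2

/-- Translation of the copies of `G`. -/
def shiftPoint (γ : I →₀ G) : Option (I × G) → Option (I × G) :=
  Option.map fun p => (p.1, p.2 + γ p.1)

theorem shiftPoint_some (γ : I →₀ G) (i : I) (g : G) :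
    shiftPoint γ (some (i, g)) = some (i, g + γ i) := rfl

theorem shiftPoint_injective (γ : I →₀ G) : Function.Injective (shiftPoint γ) := by
  refine Option.map_injective ?_
  rintro ⟨i, g⟩ ⟨j, h⟩ hij
  obtain ⟨rfl, h2⟩ := Prod.ext_iff.mp hij
  exact Prod.ext rfl (add_right_cancel h2)

theorem shiftPoint_shiftPoint (γ δ : I →₀ G) (x : Option (I × G)) :
    shiftPoint γ (shiftPoint δ x) = shiftPoint (δ + γ) x := by
  rcases x with _ | ⟨i, g⟩
  · rfl
  · simp [shiftPoint_some, add_assoc]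

/-- Translation of all entries of a sequence. -/
def shift (γ : I →₀ G) (s : TypedSeq I O G) : TypedSeq I O G :=
  ⟨fun j => shiftPoint γ (s.1 j),
    -- A translation fixes `none` and moves only finitely many entries of the base sequence.
    (s.2.union ((γ.hasFiniteSupport).image Sum.inl)).subset fun j hj => by
      by_contra h
      simp only [Set.mem_union, not_or, Set.mem_ofPred_eq, not_not, ne_eq] at h
      apply hj
      change shiftPoint γ (s.1 j) = _
      rw [h.1]
      rcases j with i | o
      · have : γ i = 0 := by
          by_contra hi
          exact h.2 ⟨i, by simpa using hi, rfl⟩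
        simp [shiftPoint_some, this]
      · rfl⟩

theorem shift_update (γ : I →₀ G) (s : TypedSeq I O G) (j : I ⊕ O) (u : Option (I × G)) :
    (s.update j u).shift γ = (s.shift γ).update j (shiftPoint γ u) := by
  refine ext fun k => ?_
  change shiftPoint γ ((s.update j u).1 k) = _
  by_cases h : k = j
  · subst h; rw [update_self, update_self]
  · rw [update_of_ne _ h, update_of_ne _ h]; rfl

theorem shift_neg_shift (γ : I →₀ G) (s : TypedSeq I O G) : (s.shift (-γ)).shift γ = s := by
  refine ext fun k => ?_
  change shiftPoint γ (shiftPoint (-γ) (s.1 k)) = s.1 k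
  rw [shiftPoint_shiftPoint, neg_add_cancel]
  rcases s.1 k with _ | ⟨i, g⟩
  · rfl
  · simp [shiftPoint_some]

variable (I O G) in
/-- The sets that are invariant under all translations of total degree zero. -/
def invariantSets : BooleanSubalgebra (Set (TypedSeq I O G)) where
  carrier := {Y | ∀ γ : I →₀ G, γ.degree = 0 → ∀ s, s.shift γ ∈ Y ↔ s ∈ Y}
  supClosed' _ hY _ hZ γ hγ s := or_congr (hY γ hγ s) (hZ γ hγ s)
  infClosed' _ hY _ hZ γ hγ s := and_congr (hY γ hγ s) (hZ γ hγ s)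
  compl_mem' hY γ hγ s := not_congr (hY γ hγ s)
  bot_mem' _ _ _ := Iff.rfl

/-- Translations permute the possible entries, so they preserve equality of entries and carry
updates to updates. -/
noncomputable instance : CylindricAlgebra (I ⊕ O) (invariantSets I O G) :=
  ofSubalgebra _
    (fun j Y hY γ hγ s => by
      have key : ∀ (γ : I →₀ G), γ.degree = 0 → ∀ s : TypedSeq I O G,
          (∃ u, s.update j u ∈ Y) → ∃ u, (s.shift γ).update j u ∈ Y := by
        rintro γ hγ s ⟨u, hu⟩
        exact ⟨shiftPoint γ u, by rw [← shift_update]; exact (hY γ hγ _).mpr hu⟩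
      refine ⟨fun h => ?_, key γ hγ s⟩
      have h1 := key (-γ) (by rw [map_neg, hγ, neg_zero]) _ h
      have h2 : (s.shift γ).shift (-γ) = s := by
        simpa using shift_neg_shift (-γ) s
      rwa [h2] at h1)
    (fun i j γ hγ s => (shiftPoint_injective γ).eq_iff)

end TypedSeq

/-- The neat reduct of the algebra of invariant sets of sequences. -/
abbrev TypedAlgebra (I O G : Type u) [AddCommGroup G] : Type u :=
  neatReduct (Function.Embedding.inl : I ↪ I ⊕ O) (TypedSeq.invariantSets I O G)

/-! ### The components of the typed algebra -/

namespace TypedAlgebra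

open TypedSeq

variable {I O G : Type u} [AddCommGroup G]

theorem mem_c {x : TypedAlgebra I O G} {i : I} {s : TypedSeq I O G} :
    s ∈ (c i x).1.1 ↔ ∃ u, s.update (Sum.inl i) u ∈ x.1.1 := Iff.rfl

theorem mem_d {i j : I} {s : TypedSeq I O G} :
    s ∈ (d i j : TypedAlgebra I O G).1.1 ↔ s.1 (Sum.inl i) = s.1 (Sum.inl j) := Iff.rfl

theorem mem_compl {x : TypedAlgebra I O G} {s : TypedSeq I O G} :
    s ∈ (xᶜ).1.1 ↔ s ∉ x.1.1 := Iff.rfl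

theorem mem_inf {x y : TypedAlgebra I O G} {s : TypedSeq I O G} :
    s ∈ (x ⊓ y).1.1 ↔ s ∈ x.1.1 ∧ s ∈ y.1.1 := Iff.rfl

theorem ext {x y : TypedAlgebra I O G} (h : ∀ s, s ∈ x.1.1 ↔ s ∈ y.1.1) : x = y :=
  Subtype.ext (Subtype.ext (Set.ext h))

theorem shift_mem {x : TypedAlgebra I O G} {γ : I →₀ G} (hγ : γ.degree = 0)
    {s : TypedSeq I O G} : s.shift γ ∈ x.1.1 ↔ s ∈ x.1.1 := x.1.2 γ hγ s

/-- The sequences differ in only finitely many removed dimensions. These entries can be changed one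
at a time, because the element is fixed by the corresponding cylindrifications. -/
theorem mem_of_agree {x : TypedAlgebra I O G} {s t : TypedSeq I O G}
    (h : ∀ i, s.1 (Sum.inl i) = t.1 (Sum.inl i)) (hs : s ∈ x.1.1) : t ∈ x.1.1 := by
  classical
  have key : ∀ (T : Finset O) (s : TypedSeq I O G), (∀ i, s.1 (Sum.inl i) = t.1 (Sum.inl i)) →
      (∀ o ∉ T, s.1 (Sum.inr o) = t.1 (Sum.inr o)) → s ∈ x.1.1 → t ∈ x.1.1 := by
    intro T
    induction T using Finset.induction_on with
    | empty =>
      intro s h1 h2 hs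
      have : s = t := TypedSeq.ext fun j => by
        rcases j with i | o
        · exact h1 i
        · exact h2 o (by simp)
      rwa [← this]
    | insert o T ho ih =>
      intro s h1 h2 hs
      refine ih (s.update (Sum.inr o) (t.1 (Sum.inr o))) (fun i => ?_) (fun o' ho' => ?_) ?_
      · rw [update_of_ne _ (by simp), h1]
      · by_cases h3 : o' = o
        · subst h3; rw [update_self]
        · rw [update_of_ne _ (by simpa using h3), h2 o' (by simp [h3, ho'])]
      · have h3 : c (Sum.inr o : I ⊕ O) x.1 = x.1 := x.2 _ (by simp)
        rw [← h3]
        exact ⟨s.1 (Sum.inr o), by rwa [update_update, update_eq]⟩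
  have hfin : {o : O | s.1 (Sum.inr o) ≠ t.1 (Sum.inr o)}.Finite := by
    refine ((s.2.union t.2).preimage (f := Sum.inr) Sum.inr_injective.injOn).subset fun o ho => ?_
    by_contra h1
    simp only [Set.mem_preimage, Set.mem_union, not_or, Set.mem_ofPred_eq, not_not, ne_eq] at h1
    exact ho (h1.1.trans h1.2.symm)
  exact key hfin.toFinset s h (fun o ho => by simpa using ho) hs

/-- Membership of a sequence in a set that does not depend on the removed dimensions. -/
theorem mem_iff_of_agree {x : TypedAlgebra I O G} {s t : TypedSeq I O G}
    (h : ∀ i, s.1 (Sum.inl i) = t.1 (Sum.inl i)) : s ∈ x.1.1 ↔ t ∈ x.1.1 :=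
  ⟨mem_of_agree h, mem_of_agree fun i => (h i).symm⟩

/-- The element of the algebra given by an invariant property of the first dimensions. -/
def mk (P : (I → Option (I × G)) → Prop)
    (hP : ∀ (γ : I →₀ G), γ.degree = 0 → ∀ s, P s → P fun i => shiftPoint γ (s i)) :
    TypedAlgebra I O G :=
  ⟨⟨{s | P fun i => s.1 (Sum.inl i)}, fun γ hγ s => ⟨fun h => by
    have h1 := hP (-γ) (by rw [map_neg, hγ, neg_zero]) _ h
    have h2 : (s.shift γ).shift (-γ) = s := by simpa using shift_neg_shift (-γ) s
    have h3 : (fun i => shiftPoint (-γ) ((s.shift γ).1 (Sum.inl i))) =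
        fun i => s.1 (Sum.inl i) := funext fun i => congrArg (fun t => t.1 (Sum.inl i)) h2
    rwa [h3] at h1, fun h => hP γ hγ _ h⟩⟩, fun j hj => by
      rcases j with i | o
      · exact absurd ⟨i, rfl⟩ hj
      · refine Subtype.ext (Set.ext fun s => ⟨?_, fun hs => ⟨s.1 (Sum.inr o), by
          rwa [update_eq]⟩⟩)
        rintro ⟨u, hu⟩
        simpa [update_of_ne] using hu⟩

/-- The sequences whose entry in dimension `i` lies in the `τ i`-th copy of `G`, with sum in
`X`. -/
noncomputable def component (τ : Equiv.Perm I) (X : Set G) : TypedAlgebra I O G :=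
  mk (fun s => ∃ h : I →₀ G, (∀ i, s i = some (τ i, h i)) ∧ h.degree ∈ X) <| by
    rintro γ hγ s ⟨h, h1, h2⟩
    -- The entry in dimension `i` lies in the copy `τ i` and moves by `γ (τ i)`. In total the sum
    -- changes by the degree of `γ`, which is zero.
    refine ⟨h + γ.equivMapDomain τ.symm, fun i => ?_, ?_⟩
    · change shiftPoint γ (s i) = _
      rw [h1, shiftPoint_some]
      simp [Finsupp.equivMapDomain_apply]
    · have : (γ.equivMapDomain τ.symm).degree = 0 := by
        rw [← hγ, Finsupp.equivMapDomain_eq_mapDomain, Finsupp.degree_mapDomain]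
      rwa [map_add, this, add_zero]

theorem mem_component {τ : Equiv.Perm I} {X : Set G} {s : TypedSeq I O G} :
    s ∈ (component τ X : TypedAlgebra I O G).1.1 ↔
      ∃ h : I →₀ G, (∀ i, s.1 (Sum.inl i) = some (τ i, h i)) ∧ h.degree ∈ X := Iff.rfl

/-- Sequences of the same type with equal sums differ, in the dimensions `I`, by a translation of
degree zero. So an element contains all or none of the sequences of a component with a given sum. -/
theorem mem_iff_of_degree_eq {x : TypedAlgebra I O G} {τ : Equiv.Perm I} {s t : TypedSeq I O G}
    {h h' : I →₀ G} (hs : ∀ i, s.1 (Sum.inl i) = some (τ i, h i))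
    (ht : ∀ i, t.1 (Sum.inl i) = some (τ i, h' i)) (hd : h.degree = h'.degree) :
    s ∈ x.1.1 ↔ t ∈ x.1.1 := by
  have hγ : ((h' - h).equivMapDomain τ).degree = 0 := by
    rw [Finsupp.equivMapDomain_eq_mapDomain, Finsupp.degree_mapDomain, map_sub, hd, sub_self]
  rw [← shift_mem hγ]
  refine mem_iff_of_agree fun i => ?_
  change shiftPoint _ (s.1 (Sum.inl i)) = _
  rw [hs, ht, shiftPoint_some]
  simp [Finsupp.equivMapDomain_apply]

/-- The entry in dimension `i` is free after the cylindrification, so it can absorb any difference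
of the sums. -/
theorem mem_c_of_mem_c {x : TypedAlgebra I O G} {i : I} {s t : TypedSeq I O G}
    {h h' : I →₀ G} (hs : ∀ i, s.1 (Sum.inl i) = some (i, h i))
    (ht : ∀ i, t.1 (Sum.inl i) = some (i, h' i)) (hx : s ∈ (c i x).1.1) : t ∈ (c i x).1.1 := by
  obtain ⟨u, hu⟩ := mem_c.mp hx
  -- This translation carries `s` to `t` in every dimension except `i`; the correction at `i` makes
  -- its degree zero.
  set γ : I →₀ G := (h' - h) - Finsupp.single i (h' - h).degree with hγ
  have hγ0 : γ.degree = 0 := by rw [hγ, map_sub, Finsupp.degree_single, sub_self]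
  refine mem_c.mpr ⟨shiftPoint γ u, ?_⟩
  rw [← shift_mem hγ0, shift_update] at hu
  refine mem_of_agree (fun k => ?_) hu
  by_cases hk : k = i
  · subst hk; rw [update_self, update_self]
  · have hk' : (Sum.inl k : I ⊕ O) ≠ Sum.inl i := by simpa using hk
    rw [update_of_ne _ hk', update_of_ne _ hk', ht]
    change shiftPoint γ (s.1 (Sum.inl k)) = _
    rw [hs, shiftPoint_some, hγ]
    simp [Finsupp.single_eq_of_ne hk]

/-- A sequence in the component of `τ` with sum `g`. -/
noncomputable def pointOf {τ : Equiv.Perm I} (hτ : {k | τ k ≠ k}.Finite) (i : I) (g : G) :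
    TypedSeq I O G :=
  ⟨Sum.elim (fun k => some (τ k, Finsupp.single i g k)) (fun _ => none),
    ((hτ.insert i).image Sum.inl).subset fun j hj => by
      by_contra h
      apply hj
      rcases j with k | o
      · have hk : ¬ (k = i ∨ τ k ≠ k) := fun hk => h ⟨k, hk, rfl⟩
        rw [not_or, not_not] at hk
        simp [Finsupp.single_eq_of_ne hk.1, hk.2]
      · rfl⟩

theorem pointOf_inl {τ : Equiv.Perm I} (hτ : {k | τ k ≠ k}.Finite) (i : I) (g : G) (k : I) :
    (pointOf hτ i g : TypedSeq I O G).1 (Sum.inl k) = some (τ k, Finsupp.single i g k) := rfl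

theorem pointOf_mem {τ : Equiv.Perm I} (hτ : {k | τ k ≠ k}.Finite) {i : I} {g : G} {X : Set G} :
    pointOf hτ i g ∈ (component τ X : TypedAlgebra I O G).1.1 ↔ g ∈ X := by
  rw [mem_component]
  constructor
  · rintro ⟨h, h3, h4⟩
    have : h = Finsupp.single i g := Finsupp.ext fun k => by
      have h5 := h3 k
      rw [pointOf_inl, Option.some_inj] at h5
      exact (congrArg Prod.snd h5).symm
    rwa [this, Finsupp.degree_single] at h4
  · exact fun h => ⟨_, pointOf_inl hτ i g, by rwa [Finsupp.degree_single]⟩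

theorem component_injective [Nonempty I] {τ : Equiv.Perm I} (hτ : {k | τ k ≠ k}.Finite) :
    Function.Injective (component τ : Set G → TypedAlgebra I O G) := fun X Y h => by
  ext g
  rw [← pointOf_mem (O := O) hτ (i := Classical.arbitrary I), h, pointOf_mem]

/-- A sequence in the component of the identity with sum `g`. -/
noncomputable def basePoint (i : I) (g : G) : TypedSeq I O G := pointOf (τ := 1) (by simp) i g

theorem basePoint_inl (i : I) (g : G) (k : I) :
    (basePoint i g : TypedSeq I O G).1 (Sum.inl k) = some (k, Finsupp.single i g k) := rfl

theorem mem_iff_basePoint_mem {x : TypedAlgebra I O G} {s : TypedSeq I O G} {h : I →₀ G}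
    (hs : ∀ i, s.1 (Sum.inl i) = some (i, h i)) (i : I) :
    s ∈ x.1.1 ↔ basePoint i h.degree ∈ x.1.1 :=
  mem_iff_of_degree_eq (τ := 1) hs (basePoint_inl i _) (Finsupp.degree_single i _).symm

/-- The sums classify the sequences of this component, with `basePoint` as representatives. Since `c
i x` contains all of the component or nothing of it, the cylindrification only sees whether `x`
meets the component. -/
theorem isPowerComponent (i₀ : I) :
    IsPowerComponent I (component 1 Set.univ : TypedAlgebra I O G)
      (fun x => {g | basePoint i₀ g ∈ x.1.1}) where
  inf x y := rfl
  compl x := rfl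
  c i x := by
    by_cases h : ∃ g, basePoint i₀ g ∈ (CylindricAlgebra.c i x).1.1
    · obtain ⟨g, hg⟩ := h
      exact Or.inr (Set.eq_univ_iff_forall.mpr fun g' =>
        mem_c_of_mem_c (basePoint_inl i₀ g) (basePoint_inl i₀ g') hg)
    · exact Or.inl (Set.eq_empty_iff_forall_notMem.mpr fun g hg => h ⟨g, hg⟩)
  d i j := by
    have h : ∀ g, basePoint i₀ g ∈ (CylindricAlgebra.d i j : TypedAlgebra I O G).1.1 ↔ i = j := by
      intro g
      rw [mem_d, basePoint_inl, basePoint_inl, Option.some_inj]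
      exact ⟨fun h => congrArg Prod.fst h, fun h => by rw [h]⟩
    by_cases hij : i = j
    · exact Or.inr (Set.eq_univ_iff_forall.mpr fun g => (h g).mpr hij)
    · exact Or.inl (Set.eq_empty_iff_forall_notMem.mpr fun g hg => hij ((h g).mp hg))
  c_congr := by
    have key : ∀ (i : I) (x y : TypedAlgebra I O G), x ⊓ (component 1 Set.univ)ᶜ =
        y ⊓ (component 1 Set.univ)ᶜ →
        (({g | basePoint i₀ g ∈ x.1.1}.Nonempty ↔ {g | basePoint i₀ g ∈ y.1.1}.Nonempty)) →
        ∀ s, s ∈ (CylindricAlgebra.c i x).1.1 → s ∈ (CylindricAlgebra.c i y).1.1 := by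
      intro i x y hoff hne s hs
      obtain ⟨u, hu⟩ := mem_c.mp hs
      by_cases ha : s.update (Sum.inl i) u ∈ (component 1 Set.univ : TypedAlgebra I O G).1.1
      · obtain ⟨h, h1, -⟩ := mem_component.mp ha
        obtain ⟨g, hg⟩ := hne.mp ⟨_, (mem_iff_basePoint_mem h1 i₀).mp hu⟩
        have h2 : basePoint i₀ g ∈ (CylindricAlgebra.c i y).1.1 := ⟨_, by
          rw [update_eq]; exact hg⟩
        obtain ⟨v, hv⟩ := mem_c.mp (mem_c_of_mem_c (basePoint_inl i₀ g) h1 h2)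
        exact ⟨v, by rwa [update_update] at hv⟩
      · have h2 : s.update (Sum.inl i) u ∈ (x ⊓ (component 1 Set.univ)ᶜ).1.1 := ⟨hu, ha⟩
        rw [hoff] at h2
        exact ⟨u, h2.1⟩
    intro i x y hoff hne
    exact ext fun s => ⟨key i x y hoff hne s, key i y x hoff.symm hne.symm s⟩
  ext x y hoff hρ := by
    refine ext fun s => ?_
    by_cases ha : s ∈ (component 1 Set.univ : TypedAlgebra I O G).1.1
    · obtain ⟨h, h1, -⟩ := mem_component.mp ha
      rw [mem_iff_basePoint_mem h1 i₀, mem_iff_basePoint_mem h1 i₀]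
      exact Set.ext_iff.mp hρ _
    · have h1 : s ∈ (x ⊓ (component 1 Set.univ)ᶜ).1.1 ↔
          s ∈ (y ⊓ (component 1 Set.univ)ᶜ).1.1 := by rw [hoff]
      rw [mem_inf, mem_inf, mem_compl] at h1
      tauto
  surj x X := by
    have mem_univ : ∀ {s : TypedSeq I O G}, s ∈ (component 1 X : TypedAlgebra I O G).1.1 →
        s ∈ (component 1 Set.univ : TypedAlgebra I O G).1.1 :=
      fun ⟨h, h1, _⟩ => ⟨h, h1, trivial⟩
    refine ⟨(x ⊓ (component 1 Set.univ)ᶜ) ⊔ component 1 X, ?_, ?_⟩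
    · refine ext fun s => ?_
      change (s ∈ x.1.1 ∧ s ∉ _ ∨ s ∈ _) ∧ s ∉ _ ↔ s ∈ x.1.1 ∧ s ∉ _
      have := @mem_univ s
      tauto
    · ext g
      change (basePoint i₀ g ∈ x.1.1 ∧ basePoint i₀ g ∉ _ ∨ basePoint i₀ g ∈ _) ↔ g ∈ X
      have h1 : basePoint i₀ g ∈ (component 1 Set.univ : TypedAlgebra I O G).1.1 :=
        ⟨_, basePoint_inl i₀ g, trivial⟩
      have h2 : basePoint i₀ g ∈ (component 1 X : TypedAlgebra I O G).1.1 ↔ g ∈ X :=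
        pointOf_mem _
      tauto

/-- The sequences whose entry in dimension `i` lies in the `k`-th copy of `G`. -/
def hasType (i k : I) : TypedAlgebra I O G :=
  mk (fun s => ∃ g, s i = some (k, g)) <| by
    rintro γ - s ⟨g, hg⟩
    exact ⟨g + γ k, by
      change shiftPoint γ (s _) = _
      rw [hg]; rfl⟩

/-- The sequences whose entries in all dimensions except `i` and `j` are in the corresponding copy
of `G`. -/
def properOutside (i j : I) : TypedAlgebra I O G :=
  mk (fun s => ∀ k, k ≠ i → k ≠ j → ∃ g, s k = some (k, g)) <| by
    rintro γ - s hs k hi hj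
    obtain ⟨g, hg⟩ := hs k hi hj
    exact ⟨g + γ k, by
      change shiftPoint γ (s _) = _
      rw [hg]; rfl⟩

theorem mem_hasType {i k : I} {s : TypedSeq I O G} :
    s ∈ (hasType i k : TypedAlgebra I O G).1.1 ↔ ∃ g, s.1 (Sum.inl i) = some (k, g) := Iff.rfl

theorem mem_properOutside {i j : I} {s : TypedSeq I O G} :
    s ∈ (properOutside i j : TypedAlgebra I O G).1.1 ↔
      ∀ k, k ≠ i → k ≠ j → ∃ g, s.1 (Sum.inl k) = some (k, g) := Iff.rfl

theorem c_eq_self {x : TypedAlgebra I O G} {i : I}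
    (h : ∀ s u, s.update (Sum.inl i) u ∈ x.1.1 → s ∈ x.1.1) : c i x = x :=
  ext fun s => ⟨fun ⟨u, hu⟩ => h s u hu, fun hs => le_c (A := TypedAlgebra I O G) i x hs⟩

theorem c_hasType {i j k : I} (h : i ≠ j) : c j (hasType i k : TypedAlgebra I O G) = hasType i k :=
  c_eq_self fun s u hs => by
    rwa [mem_hasType, update_of_ne _ (by simpa using h)] at hs

theorem c_left_properOutside (i j : I) :
    c i (properOutside i j : TypedAlgebra I O G) = properOutside i j :=
  c_eq_self fun s u hs k hi hj => by
    have := mem_properOutside.mp hs k hi hj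
    rwa [update_of_ne _ (by simpa using hi)] at this

theorem c_right_properOutside (i j : I) :
    c j (properOutside i j : TypedAlgebra I O G) = properOutside i j :=
  c_eq_self fun s u hs k hi hj => by
    have := mem_properOutside.mp hs k hi hj
    rwa [update_of_ne _ (by simpa using hj)] at this

open Classical in
theorem component_swap_le {i j : I} (X : Set G) :
    (component (Equiv.swap i j) X : TypedAlgebra I O G) ≤
      hasType i j ⊓ hasType j i ⊓ properOutside i j := by
  intro s hs
  obtain ⟨h, h1, -⟩ := mem_component.mp hs
  refine ⟨⟨⟨h i, ?_⟩, ⟨h j, ?_⟩⟩, fun k hi hj => ⟨h k, ?_⟩⟩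
  · change s.1 (Sum.inl i) = _; rw [h1, Equiv.swap_apply_left]
  · change s.1 (Sum.inl j) = _; rw [h1, Equiv.swap_apply_right]
  · change s.1 (Sum.inl k) = _; rw [h1, Equiv.swap_apply_of_ne_of_ne hi hj]

/-- The first two conditions put the entry `j` in copy `j` and the entry `i` in copy `i`. The finite
support of the resulting family in `G` comes from the finiteness condition on sequences. -/
theorem le_component_one {i j : I} (hij : i ≠ j) :
    c i (d i j ⊓ hasType i j) ⊓ c j (d j i ⊓ hasType j i) ⊓ properOutside i j ≤
      (component 1 Set.univ : TypedAlgebra I O G) := by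
  rintro s ⟨⟨⟨u, hu1, hu2⟩, ⟨v, hv1, hv2⟩⟩, hw⟩
  have key : ∀ {a b : I} {u : Option (I × G)}, a ≠ b →
      s.update (Sum.inl a) u ∈ (d a b : TypedAlgebra I O G).1.1 →
      s.update (Sum.inl a) u ∈ (hasType a b : TypedAlgebra I O G).1.1 →
      ∃ g, s.1 (Sum.inl b) = some (b, g) := by
    intro a b u hab h1 h2
    rw [mem_d, update_self, update_of_ne _ (by simpa using hab.symm)] at h1
    rw [mem_hasType, update_self, h1] at h2
    exact h2
  have hall : ∀ k, ∃ g, s.1 (Sum.inl k) = some (k, g) := fun k => by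
    by_cases hk : k = i
    · subst hk; exact key hij.symm hv1 hv2
    · by_cases hk' : k = j
      · subst hk'; exact key hij hu1 hu2
      · exact hw k hk hk'
  choose g hg using hall
  have hfin : (Function.support g).Finite := by
    refine (s.2.preimage (f := Sum.inl) Sum.inl_injective.injOn).subset fun k hk => ?_
    change s.1 (Sum.inl k) ≠ some (k, 0)
    rw [hg]
    simpa using hk
  exact ⟨Finsupp.ofSupportFinite g hfin, hg, trivial⟩

end TypedAlgebra
end TypedPoints

/-! ### Sentences that count elements of relativizations -/

section Terms

variable {I : Type u} {α : Type*} {A : Type v} [CylindricAlgebra I A]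

/-- The term `c i t`. -/
def caTermC (i : I) (t : (caLanguage I).Term α) : (caLanguage I).Term α :=
  .func (CAFunc.c i : (caLanguage I).Functions 1) ![t]

/-- The term `d i j`. -/
def caTermD (i j : I) : (caLanguage I).Term α :=
  .func (CAFunc.d i j : (caLanguage I).Functions 0) ![]

/-- The term `t ⊓ t'`. -/
def caTermInf (t t' : (caLanguage I).Term α) : (caLanguage I).Term α :=
  .func (CAFunc.inf : (caLanguage I).Functions 2) ![t, t']

@[simp] theorem realize_caTermC (i : I) (t : (caLanguage I).Term α) (v : α → A) :
    (caTermC i t).realize v = c i (t.realize v) := rfl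

@[simp] theorem realize_caTermD (i j : I) (v : α → A) :
    (caTermD i j : (caLanguage I).Term α).realize v = d i j := rfl

@[simp] theorem realize_caTermInf (t t' : (caLanguage I).Term α) (v : α → A) :
    (caTermInf t t').realize v = t.realize v ⊓ t'.realize v := rfl

/-- The formula `t ≤ t'`. -/
def caLe (t t' : (caLanguage I).Term α) : (caLanguage I).Formula α := (caTermInf t t').equal t

@[simp] theorem realize_caLe (t t' : (caLanguage I).Term α) (v : α → A) :
    (caLe t t').Realize v ↔ t.realize v ≤ t'.realize v := by
  rw [caLe, FirstOrder.Language.Formula.realize_equal, realize_caTermInf, inf_eq_left]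

end Terms

section Counting

open FirstOrder.Language

/-- The property that a relativization has at most as many elements as the one obtained by
interchanging the dimensions `i` and `j`, as far as `N` elements are concerned. -/
def InterchangeCountLE {I : Type u} (A : Type v) [CylindricAlgebra I A] (i j : I) (N : ℕ) : Prop :=
  ∀ (p q w : A) (y : Fin N → A) (z : Fin (N + 1) → A),
    c j p = p → c i q = q → c i w = w → c j w = w → Function.Injective z →
    (∀ l, z l ≤ p ⊓ q ⊓ w) →
    ∃ x, x ≤ c i (d i j ⊓ p) ⊓ c j (d j i ⊓ q) ⊓ w ∧ ∀ l, x ≠ y l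

/-- The sentence that expresses `InterchangeCountLE`. -/
noncomputable def interchangeCountSentence {I : Type u} (i j : I) (N : ℕ) :
    (caLanguage I).Sentence :=
  let V := Fin 3 ⊕ (Fin N ⊕ Fin (N + 1))
  let p : (caLanguage I).Term (Empty ⊕ V) := .var (Sum.inr (Sum.inl 0))
  let q : (caLanguage I).Term (Empty ⊕ V) := .var (Sum.inr (Sum.inl 1))
  let w : (caLanguage I).Term (Empty ⊕ V) := .var (Sum.inr (Sum.inl 2))
  let z (l : Fin (N + 1)) : (caLanguage I).Term (Empty ⊕ V) := .var (Sum.inr (Sum.inr (Sum.inr l)))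
  let y' (l : Fin N) : (caLanguage I).Term ((Empty ⊕ V) ⊕ Unit) :=
    .var (Sum.inl (Sum.inr (Sum.inr (Sum.inl l))))
  let x' : (caLanguage I).Term ((Empty ⊕ V) ⊕ Unit) := .var (Sum.inr ())
  let a : (caLanguage I).Term (Empty ⊕ V) :=
    caTermInf (caTermInf (caTermC i (caTermInf (caTermD i j) p))
      (caTermC j (caTermInf (caTermD j i) q))) w
  Formula.iAlls V (
    (((((((caTermC j p).equal p ⊓ (caTermC i q).equal q) ⊓ (caTermC i w).equal w) ⊓
      (caTermC j w).equal w) ⊓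
      Formula.iInf (fun l : {l : Fin (N + 1) × Fin (N + 1) // l.1 ≠ l.2} =>
        (Formula.not ((z l.1.1).equal (z l.1.2)) : (caLanguage I).Formula _))) ⊓
      Formula.iInf (fun l => caLe (z l) (caTermInf (caTermInf p q) w)) :
        (caLanguage I).Formula _)).imp
    (Formula.iExs Unit
      (caLe x' (a.relabel Sum.inl) ⊓
        Formula.iInf (fun l => (Formula.not (x'.equal (y' l)) : (caLanguage I).Formula _)) :
        (caLanguage I).Formula _)))

theorem realize_interchangeCountSentence {I : Type u} {A : Type v} [CylindricAlgebra I A]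
    (i j : I) (N : ℕ) :
    A ⊨ interchangeCountSentence i j N ↔ InterchangeCountLE A i j N := by
  rw [interchangeCountSentence, Sentence.Realize, Formula.realize_iAlls]
  simp only [Formula.realize_imp, Formula.realize_inf, Formula.realize_iInf, Formula.realize_not,
    Formula.realize_equal, realize_caLe, Formula.realize_iExs, realize_caTermC, realize_caTermInf,
    realize_caTermD, Term.realize_var, Term.realize_relabel]
  simp only [Sum.elim_inr, Sum.elim_inl, Function.comp_def, Subtype.forall, Prod.forall]
  constructor
  · intro h p q w y z hp hq hwi hwj hz hle
    obtain ⟨x, hx1, hx2⟩ := h (Sum.elim ![p, q, w] (Sum.elim y z))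
      ⟨⟨⟨⟨⟨hp, hq⟩, hwi⟩, hwj⟩, fun k l hkl h => hkl (hz h)⟩, hle⟩
    exact ⟨x (), hx1, hx2⟩
  · rintro h v ⟨⟨⟨⟨⟨hp, hq⟩, hwi⟩, hwj⟩, hz⟩, hle⟩
    obtain ⟨x, hx1, hx2⟩ := h (v (Sum.inl 0)) (v (Sum.inl 1)) (v (Sum.inl 2))
      (fun l => v (Sum.inr (Sum.inl l))) (fun l => v (Sum.inr (Sum.inr l))) hp hq hwi hwj
      (fun k l hkl => by_contra fun hne => hz k l hne hkl) hle
    exact ⟨fun _ => x, hx1, hx2⟩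

end Counting

/-! ### Neat reducts are not elementary, and their closure is not finitely axiomatizable -/

section NotElementary

open FirstOrder.Language TypedAlgebra

variable {n m : Ordinal.{u}}

/-- If the values of `y` exhausted the target, the interchange would inject `N + 1` elements into
`N`. -/
theorem NrCA.interchangeCountLE (hnm : n < m) {A : Type u} [CylindricAlgebra n.ToType A]
    (hA : NrCA hnm.le A (caStructure n.ToType A)) {i j : n.ToType} (hij : i ≠ j) (N : ℕ) :
    InterchangeCountLE A i j N := by
  intro p q w y z hp hq hwi hwj hz hle
  obtain ⟨f, hf⟩ := hA.exists_injective_interchange hnm hij hp hq hwi hwj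
  by_contra hcon
  push Not at hcon
  choose g hg using fun l => hcon (f ⟨z l, hle l⟩).1 (f ⟨z l, hle l⟩).2
  have hinj : Function.Injective g := fun k l hkl => by
    have h1 : f ⟨z k, hle k⟩ = f ⟨z l, hle l⟩ := Subtype.ext (by rw [hg, hg, hkl])
    exact hz (congrArg Subtype.val (hf h1))
  simpa using Fintype.card_le_of_injective g hinj

theorem nrCA_typedAlgebra (hnm : n < m) (G : Type u) [AddCommGroup G] :
    NrCA hnm.le (TypedAlgebra n.ToType (RemovedDim hnm.le) G) (caStructure n.ToType _) :=
  nrCA_neatReduct_inl (Function.Embedding.refl _) _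

/-- The relativizations that `NrCA.exists_injective_interchange` compares, in a coarsened
algebra. -/
theorem exists_relativizations {I O G : Type u} [AddCommGroup G] {S : Type v} (f : G → S)
    {i j : I} (hij : i ≠ j) :
    ∃ p q w : (isPowerComponent (O := O) (G := G) i).coarsening f,
      c j p = p ∧ c i q = q ∧ c i w = w ∧ c j w = w ∧
      (∃ g : Set G → {x // x ≤ p ⊓ q ⊓ w}, Function.Injective g) ∧
      ∃ g : {x // x ≤ c i (d i j ⊓ p) ⊓ c j (d j i ⊓ q) ⊓ w} → Set S, Function.Injective g := by
  classical
  have hmem : ∀ x : TypedAlgebra I O G,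
      (∀ g, basePoint i g ∉ x.1.1) ∨ (∀ g, basePoint i g ∈ x.1.1) →
      x ∈ (isPowerComponent (O := O) (G := G) i).coarsening f := fun x hx =>
    IsPowerComponent.mem_coarsening_of_trivial _ f
      (hx.imp Set.eq_empty_iff_forall_notMem.mpr Set.eq_univ_iff_forall.mpr)
  have hne : ∀ {k l : I}, k ≠ l → ∀ g, basePoint i g ∉ (hasType k l : TypedAlgebra I O G).1.1 := by
    rintro k l hkl g ⟨g', hg'⟩
    exact hkl (congrArg Prod.fst (Option.some_inj.mp hg'))
  -- All three survive the coarsening because they are trivial on the identity component: the first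
  -- two miss it, as `i ≠ j`, and the third contains it.
  refine ⟨⟨hasType i j, hmem _ (Or.inl (hne hij))⟩, ⟨hasType j i, hmem _ (Or.inl (hne hij.symm))⟩,
    ⟨properOutside i j, hmem _ (Or.inr fun g k _ _ => ⟨_, basePoint_inl i g k⟩)⟩,
    Subtype.ext (c_hasType hij), Subtype.ext (c_hasType hij.symm),
    Subtype.ext (c_left_properOutside i j), Subtype.ext (c_right_properOutside i j), ?_, ?_⟩
  -- The component of the transposition is disjoint from that of the identity, so the coarsening
  -- leaves it untouched.
  · have hle := fun X => component_swap_le (O := O) (G := G) (i := i) (j := j) X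
    refine ⟨fun X => ⟨⟨component (Equiv.swap i j) X, hmem _ (Or.inl fun g hg =>
      hne hij g (hle X hg).1.1)⟩, hle X⟩, fun X Y hXY => ?_⟩
    have : Nonempty I := ⟨i⟩
    have hτ : {k | Equiv.swap i j k ≠ k}.Finite :=
      (Set.toFinite {i, j}).subset fun k hk => by
        by_contra hk'
        simp only [Set.mem_insert_iff, Set.mem_singleton_iff, not_or] at hk'
        exact hk (Equiv.swap_apply_of_ne_of_ne hk'.1 hk'.2)
    exact component_injective hτ (congrArg (fun x => x.1.1) hXY)
  -- An element below the identity component is determined by the subset of `S` that witnesses its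
  -- saturation.
  · refine ⟨fun x => x.1.2.choose, fun x y hxy => ?_⟩
    have h1 := x.1.2.choose_spec
    have h2 := y.1.2.choose_spec
    have h3 : ∀ z : (isPowerComponent (O := O) (G := G) i).coarsening f,
        z.1 ≤ component 1 Set.univ → z.1 ⊓ (component 1 Set.univ)ᶜ = ⊥ := fun z hz => by
      rw [← sdiff_eq, sdiff_eq_bot_iff]; exact hz
    refine Subtype.ext (Subtype.ext ((isPowerComponent i).ext _ _ ?_ ?_))
    · rw [h3 _ (le_trans x.2 (le_component_one hij)), h3 _ (le_trans y.2 (le_component_one hij))]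
    · have hxy' : x.1.2.choose = y.1.2.choose := hxy
      exact h1.trans ((congrArg (f ⁻¹' ·) hxy').trans h2.symm)

theorem exists_ne_of_one_lt (hn : 1 < n) : ∃ i j : n.ToType, i ≠ j := by
  refine ⟨Ordinal.ToType.mk ⟨0, zero_lt_one.trans hn⟩, Ordinal.ToType.mk ⟨1, hn⟩, fun h => ?_⟩
  exact zero_ne_one (congrArg Subtype.val (Ordinal.ToType.mk.injective h))

theorem enat_card_real : ENat.card (ULift.{u} ℝ) = ⊤ := ENat.card_eq_top_of_infinite

theorem not_isElementary_nrCA (hn : 1 < n) (hnm : n < m) : ¬ (NrCA hnm.le).IsElementary := by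
  rintro ⟨T, hT⟩
  obtain ⟨i, j, hij⟩ := exists_ne_of_one_lt hn
  -- `ℝ` and `ℕ` are both infinite, so no sentence detects the coarsening. As `ℝ` is equinumerous
  -- with `Set ℕ`, the interchange would inject `Set ℝ` into `ℝ`.
  obtain ⟨e⟩ : Nonempty (ℝ ≃ Set ℕ) := Cardinal.eq.mp (by simp [Cardinal.mk_real])
  let f : ULift.{u} ℝ → ℕ := fun x => ⌊|x.down|⌋₊
  have hf : Function.Surjective f := fun k => ⟨⟨k⟩, by simp [f]⟩
  let hρ := isPowerComponent (O := RemovedDim hnm.le) (G := ULift.{u} ℝ) i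
  have hA := nrCA_typedAlgebra hnm (ULift.{u} ℝ)
  have hC : NrCA hnm.le (hρ.coarsening f) (caStructure n.ToType _) := by
    rw [hT] at hA ⊢
    refine ⟨fun φ hφ => ?_⟩
    refine (hρ.realize_sentence_iff hf (r := φ.quantifierRank) ?_ ?_ φ le_rfl).mpr
      (hA.realize_of_mem φ hφ)
    · rw [enat_card_real]; exact le_top
    · simp
  obtain ⟨p, q, w, hp, hq, hwi, hwj, ⟨g₁, hg₁⟩, ⟨g₂, hg₂⟩⟩ :=
    exists_relativizations (O := RemovedDim hnm.le) f hij
  obtain ⟨s, hs⟩ := NrCA.exists_injective_interchange hnm hC hij hp hq hwi hwj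
  let F : Set (ULift.{u} ℝ) → ULift.{u} ℝ := fun X => ⟨e.symm (g₂ (s (g₁ X)))⟩
  refine Function.cantor_injective F fun X Y hXY => hg₁ (hs (hg₂ (e.symm.injective ?_)))
  exact congrArg ULift.down hXY

theorem mem_theory_interchangeCountSentence (hnm : n < m) {i j : n.ToType} (hij : i ≠ j) (N : ℕ) :
    interchangeCountSentence i j N ∈ (NrCA hnm.le).theory := by
  intro A S hA
  obtain ⟨B, hB, ⟨e⟩⟩ := hA
  have h1 : NrCA hnm.le (neatReduct (ordinalInclusion hnm.le) B) (caStructure n.ToType _) :=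
    ⟨B, hB, ⟨FirstOrder.Language.Equiv.refl _ _⟩⟩
  have h2 := (realize_interchangeCountSentence i j N).mpr (h1.interchangeCountLE hnm hij N)
  exact (FirstOrder.Language.StrongHomClass.realize_sentence e _).mpr h2

theorem StructureClass.le_elementaryClosure {L : FirstOrder.Language.{v, w}}
    {K : StructureClass.{u} L} {A : Type u} {S : L.Structure A} (h : K A S) :
    K.elementaryClosure A S :=
  ⟨fun _ hφ => hφ A S h⟩

theorem not_isFinitelyAxiomatizable_nrCA (hn : 1 < n) (hnm : n < m) :
    ¬ (NrCA hnm.le).elementaryClosure.IsFinitelyAxiomatizable := by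
  rintro ⟨T, hfin, hT⟩
  obtain ⟨i, j, hij⟩ := exists_ne_of_one_lt hn
  obtain ⟨r, hr⟩ : ∃ r : ℕ, ∀ φ ∈ T, φ.quantifierRank ≤ r := by
    obtain ⟨r, hr⟩ := (hfin.image fun φ => φ.quantifierRank).bddAbove
    exact ⟨r, fun φ hφ => hr ⟨φ, hφ, rfl⟩⟩
  -- With `2 ^ r` classes no axiom in `T` notices the coarsening, yet one relativization becomes
  -- finite, while the other contains a copy of `Set ℝ`.
  let f : ULift.{u} ℝ → Fin (2 ^ r) := fun x => ⟨⌊|x.down|⌋₊ % 2 ^ r, Nat.mod_lt _ (by positivity)⟩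
  have hf : Function.Surjective f := fun k => ⟨⟨k.1⟩, by
    refine Fin.ext ?_
    simp [f, Nat.mod_eq_of_lt k.2]⟩
  let hρ := isPowerComponent (O := RemovedDim hnm.le) (G := ULift.{u} ℝ) i
  have hA : (NrCA hnm.le).elementaryClosure _ _ :=
    StructureClass.le_elementaryClosure (nrCA_typedAlgebra hnm (ULift.{u} ℝ))
  have hC : (NrCA hnm.le).elementaryClosure (hρ.coarsening f) (caStructure n.ToType _) := by
    rw [hT] at hA ⊢
    refine ⟨fun φ hφ => ?_⟩
    refine (hρ.realize_sentence_iff hf (r := r) ?_ ?_ φ (hr φ hφ)).mpr (hA.realize_of_mem φ hφ)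
    · rw [enat_card_real]; exact le_top
    · simp
  obtain ⟨p, q, w, hp, hq, hwi, hwj, ⟨g₁, hg₁⟩, ⟨g₂, hg₂⟩⟩ :=
    exists_relativizations (O := RemovedDim hnm.le) f hij
  have : Finite {x // x ≤ c i (d i j ⊓ p) ⊓ c j (d j i ⊓ q) ⊓ w} := Finite.of_injective g₂ hg₂
  obtain ⟨N, ⟨y⟩⟩ := Finite.exists_equiv_fin {x // x ≤ c i (d i j ⊓ p) ⊓ c j (d j i ⊓ q) ⊓ w}
  let z : Fin (N + 1) ↪ Set (ULift.{u} ℝ) :=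
    Fin.valEmbedding.trans (Infinite.natEmbedding (Set (ULift.{u} ℝ)))
  obtain ⟨x, hx1, hx2⟩ := (realize_interchangeCountSentence i j N).mp
    (hC.realize_of_mem _ (mem_theory_interchangeCountSentence hnm hij N)) p q w
    (fun l => (y.symm l).1) (fun l => (g₁ (z l)).1) hp hq hwi hwj
    (fun k l hkl => z.injective (hg₁ (Subtype.ext hkl))) (fun l => (g₁ (z l)).2)
  exact hx2 (y ⟨x, hx1⟩) (by rw [y.symm_apply_apply])

end NotElementary

/-! ### Universal axioms for cylindric algebras with a sort of dimensions

Elements and dimensions are represented by the elements of one set `X`, so that the cylindric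
algebra and its dimensions are quotients of `X`. -/

/-- Terms for elements and dimensions. -/
inductive CylTerm
  | var (i : ℕ)
  | bot
  | top
  | compl (s : CylTerm)
  | sup (s t : CylTerm)
  | inf (s t : CylTerm)
  | c (s t : CylTerm)
  | d (s t : CylTerm)

/-- Atomic formulas: comparison of elements, equality of dimensions, and the distinction of the
dimensions that are removed in the neat reduct. -/
inductive CylAtom
  | le (s t : CylTerm)
  | ed (s t : CylTerm)
  | jp (s : CylTerm)

/-- Universally quantified clauses. -/
inductive CylClause
  | fact (φ : CylAtom)
  | imp (φ ψ : CylAtom)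
  | imp₂ (φ χ ψ : CylAtom)
  | alt (φ ψ : CylAtom)
  | alt₃ (φ χ ψ : CylAtom)

open CylTerm CylAtom CylClause in
/-- Universal axioms for cylindric algebras. -/
def cylAxioms : List CylClause :=
  let x := var 0
  let y := var 1
  let z := var 2
  [fact (le x x),
   imp₂ (le x y) (le y z) (le x z),
   fact (le bot x),
   fact (le x top),
   fact (le (inf x y) x),
   fact (le (inf x y) y),
   imp₂ (le x y) (le x z) (le x (inf y z)),
   fact (le x (sup x y)),
   fact (le y (sup x y)),
   imp₂ (le x z) (le y z) (le (sup x y) z),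
   fact (le (inf (sup x y) (sup x z)) (sup x (inf y z))),
   fact (le (inf x (compl x)) bot),
   fact (le top (sup x (compl x))),
   fact (ed x x),
   imp (ed x y) (ed y x),
   imp₂ (ed x y) (ed y z) (ed x z),
   imp₂ (ed x y) (jp x) (jp y),
   imp (le x y) (le (c z x) (c z y)),
   imp (ed x y) (le (c x z) (c y z)),
   imp (ed x y) (le (d x z) (d y z)),
   imp (ed x y) (le (d z x) (d z y)),
   fact (le (c z bot) bot),
   fact (le x (c z x)),
   fact (le (c z (inf x (c z y))) (inf (c z x) (c z y))),
   fact (le (inf (c z x) (c z y)) (c z (inf x (c z y)))),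
   fact (le (c x (c y z)) (c y (c x z))),
   fact (le top (d x x)),
   alt₃ (ed z x) (ed z y) (le (d x y) (c z (inf (d x z) (d z y)))),
   alt₃ (ed z x) (ed z y) (le (c z (inf (d x z) (d z y))) (d x y)),
   alt (ed x y) (le (inf (c x (inf (d x y) z)) (c x (inf (d x y) (compl z)))) bot)]

/-- A set with operations and relations that represent those of a cylindric algebra. -/
structure CylData (X : Type u) where
  le : X → X → Prop
  ed : X → X → Prop
  jp : X → Prop
  bot : X
  top : X
  compl : X → X
  sup : X → X → X
  inf : X → X → X
  c : X → X → X
  d : X → X → X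

namespace CylData

variable {X : Type u} (M : CylData X)

/-- The value of a term. -/
def eval (v : ℕ → X) : CylTerm → X
  | .var i => v i
  | .bot => M.bot
  | .top => M.top
  | .compl s => M.compl (eval v s)
  | .sup s t => M.sup (eval v s) (eval v t)
  | .inf s t => M.inf (eval v s) (eval v t)
  | .c s t => M.c (eval v s) (eval v t)
  | .d s t => M.d (eval v s) (eval v t)

/-- The truth of an atomic formula. -/
def Holds (v : ℕ → X) : CylAtom → Prop
  | .le s t => M.le (M.eval v s) (M.eval v t)
  | .ed s t => M.ed (M.eval v s) (M.eval v t)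
  | .jp s => M.jp (M.eval v s)

/-- The truth of a clause. -/
def HoldsClause (v : ℕ → X) : CylClause → Prop
  | .fact φ => M.Holds v φ
  | .imp φ ψ => M.Holds v φ → M.Holds v ψ
  | .imp₂ φ χ ψ => M.Holds v φ → M.Holds v χ → M.Holds v ψ
  | .alt φ ψ => M.Holds v φ ∨ M.Holds v ψ
  | .alt₃ φ χ ψ => M.Holds v φ ∨ M.Holds v χ ∨ M.Holds v ψ

/-- The data satisfy the axioms. -/
def IsPrecylindric : Prop := ∀ cl ∈ cylAxioms, ∀ v : ℕ → X, M.HoldsClause v cl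

/-- The maps `el` and `dm` interpret the data in a cylindric algebra, where `P` singles out the
removed dimensions. -/
structure Interprets {D : Type*} {B : Type*} [CylindricAlgebra D B] (el : X → B) (dm : X → D)
    (P : D → Prop) : Prop where
  le : ∀ x y, M.le x y ↔ el x ≤ el y
  ed : ∀ x y, M.ed x y ↔ dm x = dm y
  jp : ∀ x, M.jp x ↔ P (dm x)
  bot : el M.bot = ⊥
  top : el M.top = ⊤
  compl : ∀ x, el (M.compl x) = (el x)ᶜ
  sup : ∀ x y, el (M.sup x y) = el x ⊔ el y
  inf : ∀ x y, el (M.inf x y) = el x ⊓ el y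
  c : ∀ x y, el (M.c x y) = CylindricAlgebra.c (dm x) (el y)
  d : ∀ x y, el (M.d x y) = CylindricAlgebra.d (dm x) (dm y)

theorem Interprets.isPrecylindric {M : CylData X} {D : Type*} {B : Type*} [CylindricAlgebra D B]
    {el : X → B} {dm : X → D} {P : D → Prop} (h : M.Interprets el dm P) : M.IsPrecylindric := by
  intro cl hcl v
  simp only [cylAxioms, List.mem_cons, List.not_mem_nil, or_false] at hcl
  rcases hcl with rfl | rfl | rfl | rfl | rfl | rfl | rfl | rfl | rfl | rfl | rfl | rfl | rfl |
    rfl | rfl | rfl | rfl | rfl | rfl | rfl | rfl | rfl | rfl | rfl | rfl | rfl | rfl | rfl |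
    rfl | rfl <;>
  simp only [HoldsClause, Holds, eval, h.le, h.ed, h.jp, h.bot, h.top, h.compl, h.sup, h.inf,
    h.c, h.d]
  · exact le_rfl
  · exact le_trans
  · exact bot_le
  · exact le_top
  · exact inf_le_left
  · exact inf_le_right
  · exact le_inf
  · exact le_sup_left
  · exact le_sup_right
  · exact sup_le
  · exact le_sup_inf
  · exact inf_compl_eq_bot.le
  · exact sup_compl_eq_top.ge
  · exact Eq.symm
  · exact Eq.trans
  · exact fun h1 h2 => h1 ▸ h2
  · exact c_mono _
  · exact fun h1 => h1 ▸ le_rfl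
  · exact fun h1 => h1 ▸ le_rfl
  · exact fun h1 => h1 ▸ le_rfl
  · exact (c_bot _).le
  · exact le_c _ _
  · exact (c_inf_c _ _ _).le
  · exact (c_inf_c _ _ _).ge
  · exact (c_comm _ _ _).le
  · exact (d_self _).ge
  · exact or_iff_not_imp_left.mpr fun h1 => or_iff_not_imp_left.mpr fun h2 => (d_eq _ _ _ h1 h2).le
  · exact or_iff_not_imp_left.mpr fun h1 => or_iff_not_imp_left.mpr fun h2 => (d_eq _ _ _ h1 h2).ge
  · exact or_iff_not_imp_left.mpr fun h1 => (c_d_disjoint _ _ _ h1).le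

/-- The data given by the elements and the dimensions of a cylindric algebra. -/
def ofAlgebra (D : Type v) (B : Type u) [CylindricAlgebra D B] (P : D → Prop) [Inhabited D] :
    CylData (B × D) where
  le x y := x.1 ≤ y.1
  ed x y := x.2 = y.2
  jp x := P x.2
  bot := (⊥, default)
  top := (⊤, default)
  compl x := (x.1ᶜ, default)
  sup x y := (x.1 ⊔ y.1, default)
  inf x y := (x.1 ⊓ y.1, default)
  c x y := (CylindricAlgebra.c x.2 y.1, default)
  d x y := (CylindricAlgebra.d x.2 y.2, default)

theorem ofAlgebra_interprets (D : Type v) (B : Type u) [CylindricAlgebra D B] (P : D → Prop)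
    [Inhabited D] : (ofAlgebra D B P).Interprets Prod.fst Prod.snd P := by
  constructor <;> intros <;> rfl

/-- An assignment of three values. -/
def triple (x y z : X) : ℕ → X
  | 0 => x
  | 1 => y
  | _ => z

namespace IsPrecylindric

variable {M}

/-- No axiom has more than three variables. The index is the position in `cylAxioms`, counted from
zero. -/
theorem axiom_get (h : M.IsPrecylindric) (k : Fin 30) (x y z : X) :
    M.HoldsClause (triple x y z) (cylAxioms.get k) := h _ (List.get_mem cylAxioms k) _

/-- Elements represented by the data. -/
def elemSetoid (h : M.IsPrecylindric) : Setoid X where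
  r x y := M.le x y ∧ M.le y x
  iseqv :=
    { refl := fun x => ⟨h.axiom_get 0 x x x, h.axiom_get 0 x x x⟩
      symm := fun h1 => ⟨h1.2, h1.1⟩
      trans := fun {x y z} h1 h2 => ⟨h.axiom_get 1 x y z h1.1 h2.1, h.axiom_get 1 z y x h2.2 h1.2⟩ }

/-- Dimensions represented by the data. -/
def dimSetoid (h : M.IsPrecylindric) : Setoid X where
  r := M.ed
  iseqv :=
    { refl := fun x => h.axiom_get 13 x x x
      symm := fun {x y} => h.axiom_get 14 x y x
      trans := fun {x y z} => h.axiom_get 15 x y z }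

/-- The algebra represented by the data. -/
def Elem (h : M.IsPrecylindric) : Type u := Quotient h.elemSetoid

/-- The dimensions represented by the data. -/
def Dim (h : M.IsPrecylindric) : Type u := Quotient h.dimSetoid

/-- The element represented by `x`. -/
def elem (h : M.IsPrecylindric) (x : X) : h.Elem := Quotient.mk h.elemSetoid x

/-- The dimension represented by `x`. -/
def dim (h : M.IsPrecylindric) (x : X) : h.Dim := Quotient.mk h.dimSetoid x

theorem refl (h : M.IsPrecylindric) (x : X) : M.le x x := h.axiom_get 0 x x x

theorem trans (h : M.IsPrecylindric) {x y z : X} (h1 : M.le x y) (h2 : M.le y z) : M.le x z :=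
  h.axiom_get 1 x y z h1 h2

theorem le_inf (h : M.IsPrecylindric) {x y z : X} (h1 : M.le x y) (h2 : M.le x z) :
    M.le x (M.inf y z) := h.axiom_get 6 x y z h1 h2

theorem sup_le (h : M.IsPrecylindric) {x y z : X} (h1 : M.le x z) (h2 : M.le y z) :
    M.le (M.sup x y) z := h.axiom_get 9 x y z h1 h2

theorem sup_mono (h : M.IsPrecylindric) {x y x' y' : X} (h1 : M.le x x') (h2 : M.le y y') :
    M.le (M.sup x y) (M.sup x' y') :=
  h.sup_le (h.trans h1 (h.axiom_get 7 x' y' x')) (h.trans h2 (h.axiom_get 8 x' y' x'))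

theorem inf_mono (h : M.IsPrecylindric) {x y x' y' : X} (h1 : M.le x x') (h2 : M.le y y') :
    M.le (M.inf x y) (M.inf x' y') :=
  h.le_inf (h.trans (h.axiom_get 4 x y x) h1) (h.trans (h.axiom_get 5 x y x) h2)

/-- By distributivity, `yᶜ ≤ (xᶜ ⊔ x) ⊓ (xᶜ ⊔ yᶜ) ≤ xᶜ ⊔ (x ⊓ yᶜ)`, and `x ⊓ yᶜ` vanishes when `x ≤
y`. -/
theorem compl_anti (h : M.IsPrecylindric) {x y : X} (h1 : M.le x y) :
    M.le (M.compl y) (M.compl x) := by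
  have h2 : M.le (M.compl y) (M.inf (M.sup (M.compl x) x) (M.sup (M.compl x) (M.compl y))) := by
    refine h.le_inf ?_ (h.axiom_get 8 (M.compl x) (M.compl y) x)
    refine h.trans (h.axiom_get 3 (M.compl y) x x) (h.trans (h.axiom_get 12 x x x) ?_)
    exact h.sup_le (h.axiom_get 8 (M.compl x) x x) (h.axiom_get 7 (M.compl x) x x)
  refine h.trans h2 (h.trans (h.axiom_get 10 (M.compl x) x (M.compl y)) ?_)
  refine h.sup_le (h.refl _) (h.trans (h.inf_mono h1 (h.refl _)) ?_)
  exact h.trans (h.axiom_get 11 y y y) (h.axiom_get 2 (M.compl x) y y)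

instance booleanAlgebra (h : M.IsPrecylindric) : BooleanAlgebra h.Elem where
  le := Quotient.lift₂ M.le fun x y x' y' h1 h2 => propext
    ⟨fun h3 => h.trans h1.2 (h.trans h3 h2.1), fun h3 => h.trans h1.1 (h.trans h3 h2.2)⟩
  le_refl := Quotient.ind fun x => h.refl x
  le_trans := Quotient.ind fun x => Quotient.ind fun y => Quotient.ind fun z => h.trans
  le_antisymm := Quotient.ind fun x => Quotient.ind fun y => fun h1 h2 => Quotient.sound ⟨h1, h2⟩
  sup := Quotient.map₂ M.sup fun _ _ h1 _ _ h2 => ⟨h.sup_mono h1.1 h2.1, h.sup_mono h1.2 h2.2⟩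
  inf := Quotient.map₂ M.inf fun _ _ h1 _ _ h2 => ⟨h.inf_mono h1.1 h2.1, h.inf_mono h1.2 h2.2⟩
  compl := Quotient.map M.compl fun _ _ h1 => ⟨h.compl_anti h1.2, h.compl_anti h1.1⟩
  top := h.elem M.top
  bot := h.elem M.bot
  le_sup_left := Quotient.ind fun x => Quotient.ind fun y => h.axiom_get 7 x y x
  le_sup_right := Quotient.ind fun x => Quotient.ind fun y => h.axiom_get 8 x y x
  sup_le := Quotient.ind fun _ => Quotient.ind fun _ => Quotient.ind fun _ => h.sup_le
  inf_le_left := Quotient.ind fun x => Quotient.ind fun y => h.axiom_get 4 x y x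
  inf_le_right := Quotient.ind fun x => Quotient.ind fun y => h.axiom_get 5 x y x
  le_inf := Quotient.ind fun _ => Quotient.ind fun _ => Quotient.ind fun _ => h.le_inf
  le_sup_inf := Quotient.ind fun x => Quotient.ind fun y => Quotient.ind fun z =>
    h.axiom_get 10 x y z
  inf_compl_le_bot := Quotient.ind fun x => h.axiom_get 11 x x x
  top_le_sup_compl := Quotient.ind fun x => h.axiom_get 12 x x x
  le_top := Quotient.ind fun x => h.axiom_get 3 x x x
  bot_le := Quotient.ind fun x => h.axiom_get 2 x x x

theorem elem_eq (h : M.IsPrecylindric) {x y : X} :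
    h.elem x = h.elem y ↔ M.le x y ∧ M.le y x := Quotient.eq (r := h.elemSetoid)

theorem dim_eq (h : M.IsPrecylindric) {x y : X} : h.dim x = h.dim y ↔ M.ed x y :=
  Quotient.eq (r := h.dimSetoid)

theorem c_le (h : M.IsPrecylindric) {i j x y : X} (h1 : M.ed i j) (h2 : M.le x y) :
    M.le (M.c i x) (M.c j y) := h.trans (h.axiom_get 17 x y i h2) (h.axiom_get 18 i j y h1)

theorem d_le (h : M.IsPrecylindric) {i j i' j' : X} (h1 : M.ed i i') (h2 : M.ed j j') :
    M.le (M.d i j) (M.d i' j') :=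
  h.trans (h.axiom_get 19 i i' j h1) (h.axiom_get 20 j j' i' h2)

theorem ed_symm (h : M.IsPrecylindric) {i j : X} (h1 : M.ed i j) : M.ed j i :=
  h.axiom_get 14 i j i h1

instance cylindricAlgebra (h : M.IsPrecylindric) : CylindricAlgebra h.Dim h.Elem where
  c := Quotient.map₂ M.c fun _ _ h1 _ _ h2 => ⟨h.c_le h1 h2.1, h.c_le (h.ed_symm h1) h2.2⟩
  d := Quotient.lift₂ (fun i j => h.elem (M.d i j)) fun _ _ _ _ h1 h2 =>
    Quotient.sound ⟨h.d_le h1 h2, h.d_le (h.ed_symm h1) (h.ed_symm h2)⟩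
  c_bot := Quotient.ind fun i => Quotient.sound ⟨h.axiom_get 21 i i i, h.axiom_get 2 _ i i⟩
  le_c := Quotient.ind fun i => Quotient.ind fun x => h.axiom_get 22 x x i
  c_inf_c := Quotient.ind fun i => Quotient.ind fun x => Quotient.ind fun y =>
    Quotient.sound ⟨h.axiom_get 23 x y i, h.axiom_get 24 x y i⟩
  c_comm := Quotient.ind fun i => Quotient.ind fun j => Quotient.ind fun x =>
    Quotient.sound ⟨h.axiom_get 25 i j x, h.axiom_get 25 j i x⟩
  d_self := Quotient.ind fun i => Quotient.sound ⟨h.axiom_get 3 _ i i, h.axiom_get 26 i i i⟩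
  d_eq := Quotient.ind fun i => Quotient.ind fun j => Quotient.ind fun k => fun h1 h2 => by
    have h1' : ¬ M.ed k i := fun h3 => h1 (h.dim_eq.mpr h3)
    have h2' : ¬ M.ed k j := fun h3 => h2 (h.dim_eq.mpr h3)
    exact Quotient.sound ⟨((h.axiom_get 27 i j k).resolve_left h1').resolve_left h2',
      ((h.axiom_get 28 i j k).resolve_left h1').resolve_left h2'⟩
  c_d_disjoint := Quotient.ind fun i => Quotient.ind fun j => Quotient.ind fun x => fun h1 =>
    Quotient.sound ⟨(h.axiom_get 29 i j x).resolve_left fun h3 => h1 (h.dim_eq.mpr h3),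
      h.axiom_get 2 _ i i⟩

/-- The removed dimensions. -/
def Removed (h : M.IsPrecylindric) : h.Dim → Prop :=
  Quotient.lift M.jp fun x y h1 => propext
    ⟨h.axiom_get 16 x y x h1, h.axiom_get 16 y x y (h.ed_symm h1)⟩

theorem interprets (h : M.IsPrecylindric) : M.Interprets h.elem h.dim h.Removed where
  le _ _ := Iff.rfl
  ed _ _ := h.dim_eq.symm
  jp _ := Iff.rfl
  bot := rfl
  top := rfl
  compl _ := rfl
  sup _ _ := rfl
  inf _ _ := rfl
  c _ _ := rfl
  d _ _ := rfl

end IsPrecylindric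

end CylData

/-! ### Presentations of neat reducts -/

namespace CylData

variable {X : Type w} (M : CylData X) {I : Type v}

/-- The operations of cylindric algebras on `X`, where `k i` represents the dimension `i`. -/
def caOp (k : I → X) : {l : ℕ} → CAFunc I l → (Fin l → X) → X
  | _, .bot, _ => M.bot
  | _, .top, _ => M.top
  | _, .compl, x => M.compl (x 0)
  | _, .sup, x => M.sup (x 0) (x 1)
  | _, .inf, x => M.inf (x 0) (x 1)
  | _, .c i, x => M.c (k i) (x 0)
  | _, .d i j, _ => M.d (k i) (k j)

/-- Two elements of `X` represent the same element of the algebra. -/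
def Eqv (x y : X) : Prop := M.le x y ∧ M.le y x

/-- The element is fixed by the cylindrifications in the removed dimensions. -/
def Fixed (x : X) : Prop := ∀ j, M.jp j → M.le (M.c j x) x

/-- The data, with the dimensions `k i`, present `A` as a neat reduct. -/
structure Presents (k : I → X) (A : Type u) [(caLanguage I).Structure A] (emb : A → X) :
    Prop where
  pre : M.IsPrecylindric
  kept_injective : ∀ i j, M.ed (k i) (k j) → i = j
  kept : ∀ i, ¬ M.jp (k i)
  hom : ∀ {l : ℕ} (f : CAFunc I l) (x : Fin l → A),
    M.Eqv (emb (FirstOrder.Language.Structure.funMap (L := caLanguage I) f x))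
      (M.caOp k f fun i => emb (x i))
  injective : ∀ x y, M.Eqv (emb x) (emb y) → x = y
  fixed : ∀ x, M.Fixed (emb x)
  surjective : ∀ y, M.Fixed y → ∃ x, M.Eqv (emb x) y

namespace IsPrecylindric

variable {M}

/-- The kept and the removed dimensions, as dimensions of the algebra that is represented by the
data. -/
def dims (h : M.IsPrecylindric) {k : I → X} (kept_injective : ∀ i j, M.ed (k i) (k j) → i = j)
    (kept : ∀ i, ¬ M.jp (k i)) : I ⊕ {δ : h.Dim // h.Removed δ} ↪ h.Dim where
  toFun := Sum.elim (fun i => h.dim (k i)) Subtype.val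
  inj' := by
    rintro (i | i) (j | j) hij
    · exact congrArg Sum.inl (kept_injective i j (h.dim_eq.mp hij))
    · exact absurd (Eq.mpr (congrArg h.Removed (show h.dim (k i) = j.1 from hij)) j.2) (kept i)
    · exact absurd (Eq.mp (congrArg h.Removed (show i.1 = h.dim (k j) from hij)) i.2) (kept j)
    · exact congrArg Sum.inr (Subtype.ext hij)

theorem fixed_iff (h : M.IsPrecylindric) (x : X) :
    M.Fixed x ↔ ∀ δ : h.Dim, h.Removed δ → CylindricAlgebra.c δ (h.elem x) = h.elem x := by
  constructor
  · intro hx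
    exact Quotient.ind fun j hj => Quotient.sound ⟨hx j hj, h.axiom_get 22 x x j⟩
  · intro hx j hj
    exact (h.elem_eq.mp (hx (h.dim j) hj)).1

end IsPrecylindric

/-- In the quotient, `Fixed` becomes membership in the neat reduct. Dimensions that are neither
removed nor of the form `k i` play no role and are dropped by `reduct`. -/
theorem Presents.exists_equiv {M : CylData X} {I : Type u} {k : I → X} {A : Type v}
    [(caLanguage I).Structure A] {emb : A → X} (P : M.Presents k A emb) :
    ∃ _ : CylindricAlgebra (I ⊕ {δ : P.pre.Dim // P.pre.Removed δ}) P.pre.Elem,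
      Nonempty ((caLanguage I).Equiv A
        (neatReduct (Function.Embedding.inl : I ↪ I ⊕ {δ : P.pre.Dim // P.pre.Removed δ})
          P.pre.Elem)) := by
  let B := reduct (P.pre.dims P.kept_injective P.kept) P.pre.Elem
  refine ⟨B, ⟨?_⟩⟩
  have mem : ∀ x, P.pre.elem x ∈
      neatReduct (Function.Embedding.inl : I ↪ I ⊕ {δ : P.pre.Dim // P.pre.Removed δ})
        P.pre.Elem ↔ M.Fixed x := by
    intro x
    rw [P.pre.fixed_iff]
    constructor
    · intro hx δ hδ
      exact hx (Sum.inr ⟨δ, hδ⟩) (by simp)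
    · rintro hx (i | j) hj
      · exact absurd ⟨i, rfl⟩ hj
      · exact hx j.1 j.2
  let f : A → neatReduct (Function.Embedding.inl : I ↪ I ⊕ {δ : P.pre.Dim // P.pre.Removed δ})
      P.pre.Elem := fun x => ⟨P.pre.elem (emb x), (mem _).mpr (P.fixed x)⟩
  have bij : Function.Bijective f := by
    constructor
    · intro x y hxy
      exact P.injective x y (P.pre.elem_eq.mp (congrArg Subtype.val hxy))
    · rintro ⟨y, hy⟩
      induction y using Quotient.inductionOn with
      | h y =>
        obtain ⟨x, hx⟩ := P.surjective y ((mem y).mp hy)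
        exact ⟨x, Subtype.ext (P.pre.elem_eq.mpr hx)⟩
  refine { toEquiv := Equiv.ofBijective f bij, map_fun' := ?_, map_rel' := fun r => Empty.elim r }
  intro l g x
  refine Subtype.ext ((P.pre.elem_eq.mpr (P.hom g x)).trans ?_)
  cases g <;> rfl

/-- The neat reduct of the quotient algebra is presented by choosing representatives. -/
theorem IsPrecylindric.exists_presents {M : CylData X} (h : M.IsPrecylindric) {I : Type u}
    {k : I → X} (kept_injective : ∀ i j, M.ed (k i) (k j) → i = j) (kept : ∀ i, ¬ M.jp (k i)) :
    ∃ (A : Type w) (_ : (caLanguage I).Structure A) (emb : A → X), M.Presents k A emb := by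
  let B := reduct (h.dims kept_injective kept) h.Elem
  let A := neatReduct (Function.Embedding.inl : I ↪ I ⊕ {δ : h.Dim // h.Removed δ}) h.Elem
  have out : ∀ x : h.Elem, h.elem (Quotient.out x) = x := fun x => Quotient.out_eq x
  refine ⟨A, inferInstance, fun x => Quotient.out x.1, h, kept_injective, kept, ?_, ?_, ?_, ?_⟩
  · intro l f x
    rw [Eqv, ← h.elem_eq, out]
    cases f
    · rfl
    · rfl
    · exact congrArg (·ᶜ) (out _).symm
    · exact congrArg₂ max (out _).symm (out _).symm
    · exact congrArg₂ min (out _).symm (out _).symm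
    · exact congrArg (CylindricAlgebra.c (h.dim (k _))) (out _).symm
    · rfl
  · intro x y hxy
    have h1 := h.elem_eq.mpr hxy
    rw [out, out] at h1
    exact Subtype.ext h1
  · intro x
    rw [h.fixed_iff, out]
    exact fun δ hδ => x.2 (Sum.inr ⟨δ, hδ⟩) (by simp)
  · intro y hy
    rw [h.fixed_iff] at hy
    refine ⟨⟨h.elem y, ?_⟩, h.elem_eq.mp (out _)⟩
    rintro (i | j) hj
    · exact absurd ⟨i, rfl⟩ hj
    · exact hy j.1 j.2

theorem ofAlgebra_presents {I : Type u} {D : Type v} {B : Type w} [CylindricAlgebra D B]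
    [Inhabited D] (ι : I ↪ D) {A : Type*} [(caLanguage I).Structure A]
    (e : (caLanguage I).Equiv A (neatReduct ι B)) :
    (ofAlgebra D B (· ∉ Set.range ι)).Presents (fun i => (⊥, ι i)) A
      (fun x => ((e x).1, default)) where
  pre := (ofAlgebra_interprets D B _).isPrecylindric
  kept_injective i j hij := ι.injective hij
  kept i hi := hi ⟨i, rfl⟩
  hom {l} f x := by
    have h1 := congrArg Subtype.val (e.map_fun f x)
    have h2 : ∀ {x y : B × D}, x.1 = y.1 → (ofAlgebra D B (· ∉ Set.range ι)).Eqv x y :=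
      fun h => ⟨h.le, h.ge⟩
    refine h2 (h1.trans ?_)
    cases f <;> rfl
  injective x y hxy := e.injective (Subtype.ext (le_antisymm hxy.1 hxy.2))
  fixed x j hj := ((e x).2 j.2 hj).le
  surjective y hy := ⟨e.symm ⟨y.1, fun j hj => le_antisymm (hy (⊥, j) hj) (le_c _ _)⟩, by
    simp only [FirstOrder.Language.Equiv.apply_symm_apply]
    exact ⟨le_refl y.1, le_refl y.1⟩⟩

section NrCA

variable {n m : Ordinal.{u}} {h : n ≤ m} {A X : Type u} {S : (caLanguage n.ToType).Structure A}

/-- The family `o` guarantees at least as many removed dimensions as `m` requires; a surplus does no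
harm. -/
theorem Presents.nrCA {M : CylData X} {k : n.ToType → X} {emb : A → X} (P : M.Presents k A emb)
    (o : RemovedDim h → X) (ho : ∀ r, M.jp (o r)) (o_injective : ∀ r s, M.ed (o r) (o s) → r = s) :
    NrCA h A S := by
  obtain ⟨_, ⟨e⟩⟩ := P.exists_equiv
  exact (nrCA_neatReduct_inl (h := h) ⟨fun r => ⟨P.pre.dim (o r), ho r⟩, fun r s hrs =>
    o_injective r s (P.pre.dim_eq.mp (congrArg Subtype.val hrs))⟩ P.pre.Elem).of_equiv e

end NrCA

section Ultraproduct

variable {α : Type*} (U : Ultrafilter α)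

/-- The ultrapower of the data. -/
def ultrapower : CylData (α → X) where
  le x y := ∀ᶠ a in U, M.le (x a) (y a)
  ed x y := ∀ᶠ a in U, M.ed (x a) (y a)
  jp x := ∀ᶠ a in U, M.jp (x a)
  bot _ := M.bot
  top _ := M.top
  compl x a := M.compl (x a)
  sup x y a := M.sup (x a) (y a)
  inf x y a := M.inf (x a) (y a)
  c x y a := M.c (x a) (y a)
  d x y a := M.d (x a) (y a)

theorem ultrapower_eval (v : ℕ → α → X) (t : CylTerm) (a : α) :
    (M.ultrapower U).eval v t a = M.eval (fun i => v i a) t := by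
  induction t <;> simp_all [eval, ultrapower]

theorem ultrapower_holds (v : ℕ → α → X) (φ : CylAtom) :
    (M.ultrapower U).Holds v φ ↔ ∀ᶠ a in U, M.Holds (fun i => v i a) φ := by
  cases φ <;> simp only [Holds, ← ultrapower_eval M U v] <;> rfl

theorem IsPrecylindric.ultrapower {M : CylData X} (h : M.IsPrecylindric) :
    (M.ultrapower U).IsPrecylindric := by
  intro cl hcl v
  have h1 : ∀ᶠ a in (U : Filter α), M.HoldsClause (fun i => v i a) cl :=
    Filter.Eventually.of_forall fun a => h cl hcl _
  cases cl <;>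
  simpa only [HoldsClause, ultrapower_holds, Ultrafilter.eventually_imp,
    Ultrafilter.eventually_or] using h1

/-- Łoś's theorem for this particular list of first-order conditions. -/
theorem Presents.ultrapower {M : CylData X} {k : I → X} {A : Type v}
    [(caLanguage I).Structure A] {emb : A → X} (P : M.Presents k A emb) :
    (M.ultrapower U).Presents (fun i _ => k i) ((U : Filter α).Product fun _ => A)
      (fun x a => emb (Quotient.out x a)) := by
  have out : ∀ x : (U : Filter α).Product fun _ => A,
      ((Quotient.out x : α → A) : (U : Filter α).Product fun _ => A) = x :=
    fun x => Quotient.out_eq x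
  have out' : ∀ x : α → A, ∀ᶠ a in (U : Filter α),
      Quotient.out (x : (U : Filter α).Product fun _ => A) a = x a :=
    fun x => Quotient.exact (out _)
  refine ⟨P.pre.ultrapower U, ?_, ?_, ?_, ?_, ?_, ?_⟩
  · intro i j hij
    exact P.kept_injective i j (Filter.eventually_const.mp hij)
  · intro i hi
    exact P.kept i (Filter.eventually_const.mp hi)
  · intro l f x
    have h1 := out' fun a => FirstOrder.Language.Structure.funMap (L := caLanguage I) f
      fun i => Quotient.out (x i) a
    have h3 := FirstOrder.Language.Ultraproduct.funMap_cast (L := caLanguage I) (u := U) f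
      fun i => Quotient.out (x i)
    simp only [out] at h3
    rw [← h3] at h1
    have h2 : ∀ a,
        (M.ultrapower U).caOp (fun i _ => k i) f (fun i a => emb (Quotient.out (x i) a)) a =
        M.caOp k f fun i => emb (Quotient.out (x i) a) := by
      intro a
      cases f <;> rfl
    have h4 : ∀ᶠ a in (U : Filter α), M.Eqv (emb (Quotient.out
        (FirstOrder.Language.Structure.funMap (L := caLanguage I) f x) a))
        ((M.ultrapower U).caOp (fun i _ => k i) f (fun i a => emb (Quotient.out (x i) a)) a) :=
      h1.mono fun a ha =>
        Eq.mpr (congrArg₂ M.Eqv (congrArg emb ha) (h2 a)) (P.hom f _)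
    exact ⟨h4.mono fun a ha => ha.1, h4.mono fun a ha => ha.2⟩
  · intro x y hxy
    rw [← out x, ← out y]
    refine Quotient.sound ?_
    filter_upwards [hxy.1, hxy.2] with a h1 h2
    exact P.injective _ _ ⟨h1, h2⟩
  · intro x j hj
    filter_upwards [hj] with a ha
    exact P.fixed _ _ ha
  · intro y hy
    have h1 : ∀ᶠ a in (U : Filter α), M.Fixed (y a) := by
      by_contra h2
      -- If `y a` failed to be fixed for almost all `a`, removed dimensions witnessing this at each
      -- index would form a removed dimension of the ultrapower that contradicts `hy`.
      have h3 : ∀ a, ∃ j, ¬ M.Fixed (y a) → M.jp j ∧ ¬ M.le (M.c j (y a)) (y a) := by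
        intro a
        by_cases h4 : M.Fixed (y a)
        · exact ⟨y a, fun h => absurd h4 h⟩
        · have h5 := h4
          simp only [Fixed] at h5
          push Not at h5
          obtain ⟨j, hj⟩ := h5
          exact ⟨j, fun _ => hj⟩
      choose j hj using h3
      rw [← Ultrafilter.eventually_not] at h2
      have h4 := hy j (h2.mono fun a ha => (hj a ha).1)
      obtain ⟨a, ha, ha'⟩ := (h2.and h4).exists
      exact (hj a ha).2 ha'
    have h2 : ∀ a, ∃ x, M.Fixed (y a) → M.Eqv (emb x) (y a) := by
      intro a
      by_cases h4 : M.Fixed (y a)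
      · obtain ⟨x, hx⟩ := P.surjective _ h4
        exact ⟨x, fun _ => hx⟩
      · obtain ⟨x, hx⟩ := P.surjective M.bot fun j _ => P.pre.axiom_get 21 j j j
        exact ⟨x, fun h => absurd h h4⟩
    choose x hx using h2
    refine ⟨(x : (U : Filter α).Product fun _ => A), ?_, ?_⟩
    · filter_upwards [h1, out' x] with a h3 h4
      rw [h4]
      exact (hx a h3).1
    · filter_upwards [h1, out' x] with a h3 h4
      rw [h4]
      exact (hx a h3).2

/-- Almost every finite set `F` contains a given `r`, and the position of `r` in an enumeration of
`F` selects one of the countably many dimensions `s i`. Distinct members of `F` have distinct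
positions, so as many removed dimensions arise as `O` has elements. -/
theorem exists_ultrafilter_removed (M : CylData X) (O : Type u) (s : ℕ → X)
    (hs : ∀ i, M.jp (s i)) (s_injective : ∀ i j, M.ed (s i) (s j) → i = j) :
    ∃ (U : Ultrafilter (Finset O)) (o : O → Finset O → X),
      (∀ r, (M.ultrapower U).jp (o r)) ∧ ∀ r t, (M.ultrapower U).ed (o r) (o t) → r = t := by
  classical
  let U : Ultrafilter (Finset O) := Ultrafilter.of Filter.atTop
  have hU : ∀ r : O, ∀ᶠ F in (U : Filter (Finset O)), r ∈ F := fun r =>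
    Ultrafilter.of_le Filter.atTop ((Filter.eventually_ge_atTop {r}).mono fun F hF =>
      Finset.singleton_subset_iff.mp hF)
  refine ⟨U, fun r F => s (if h : r ∈ F then (F.equivFin ⟨r, h⟩).1 else 0), ?_, ?_⟩
  · exact fun r => Filter.Eventually.of_forall fun F => hs _
  · intro r t hrt
    obtain ⟨F, hF, h1, h2⟩ := (hrt.and ((hU r).and (hU t))).exists
    have h3 := s_injective _ _ hF
    rw [dif_pos h1, dif_pos h2] at h3
    exact congrArg Subtype.val (F.equivFin.injective (Fin.ext h3))

end Ultraproduct

end CylData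

/-! ### Neat reducts form a pseudo-elementary class -/

namespace NeatSig

variable (I D : Type u) (S : Type) (a b : S)

/-- The function symbols: the operations of cylindric algebras on the sort `a`, those of the data
for a cylindric algebra on the sort `b`, an embedding and constants for the dimensions. -/
inductive Func : (l : ℕ) → (Fin l → S) → S → Type u
  | ca {l : ℕ} (f : CAFunc I l) : Func l (fun _ => a) a
  | emb : Func 1 (fun _ => a) b
  | bot : Func 0 (fun _ => b) b
  | top : Func 0 (fun _ => b) b
  | compl : Func 1 (fun _ => b) b
  | sup : Func 2 (fun _ => b) b
  | inf : Func 2 (fun _ => b) b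
  | c : Func 2 (fun _ => b) b
  | d : Func 2 (fun _ => b) b
  | dim (i : D) : Func 0 (fun _ => b) b

/-- The relation symbols of the data for a cylindric algebra. -/
inductive Rel : (l : ℕ) → (Fin l → S) → Type u
  | le : Rel 2 (fun _ => b)
  | ed : Rel 2 (fun _ => b)
  | jp : Rel 1 (fun _ => b)

end NeatSig

open ManySorted

section Signature

variable (I D : Type u) {S : Type} (a b : S)

/-- The signature for neat reducts: the neat reduct has the sort `a`, the cylindric algebra and its
dimensions have the sort `b`. -/
def neatSig : ManySorted.{u} S := ⟨NeatSig.Func I D S a b, NeatSig.Rel S b⟩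

/-- The language of cylindric algebras is a part of the signature for neat reducts. -/
def neatInclusion : Inclusion (caLanguage I) (neatSig I D a b) a where
  onFunc f := NeatSig.Func.ca f
  onRel r := Empty.elim r
  onFunc_injective l f g h := by
    cases h
    rfl
  onRel_injective l r := Empty.elim r

variable {I D a b}

namespace ManySorted.Model

variable (M : (neatSig I D a b).Model)

/-- The data for a cylindric algebra in a model. -/
def cylData : CylData (M.Carrier b) where
  le x y := M.rel (a := fun _ => b) NeatSig.Rel.le ![x, y]
  ed x y := M.rel (a := fun _ => b) NeatSig.Rel.ed ![x, y]
  jp x := M.rel (a := fun _ => b) NeatSig.Rel.jp ![x]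
  bot := M.func (a := fun _ => b) NeatSig.Func.bot ![]
  top := M.func (a := fun _ => b) NeatSig.Func.top ![]
  compl x := M.func (a := fun _ => b) NeatSig.Func.compl ![x]
  sup x y := M.func (a := fun _ => b) NeatSig.Func.sup ![x, y]
  inf x y := M.func (a := fun _ => b) NeatSig.Func.inf ![x, y]
  c x y := M.func (a := fun _ => b) NeatSig.Func.c ![x, y]
  d x y := M.func (a := fun _ => b) NeatSig.Func.d ![x, y]

/-- The embedding in a model. -/
def emb (x : M.Carrier a) : M.Carrier b := M.func (a := fun _ => a) NeatSig.Func.emb ![x]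

/-- The dimensions in a model. -/
def dim (i : D) : M.Carrier b := M.func (a := fun _ => b) (NeatSig.Func.dim i) ![]

end ManySorted.Model

namespace NeatSig

/-- Negation. -/
def neg (φ : (neatSig I D a b).Formula) : (neatSig I D a b).Formula := .imp φ .falsum

/-- Comparison of elements. -/
def fle (s t : (neatSig I D a b).Term b) : (neatSig I D a b).Formula :=
  .rel (a := fun _ => b) Rel.le ![s, t]

/-- Equality of dimensions. -/
def fed (s t : (neatSig I D a b).Term b) : (neatSig I D a b).Formula :=
  .rel (a := fun _ => b) Rel.ed ![s, t]

/-- The formula expressing that a dimension is removed. -/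
def fjp (s : (neatSig I D a b).Term b) : (neatSig I D a b).Formula :=
  .rel (a := fun _ => b) Rel.jp ![s]

/-- Cylindrification. -/
def tc (s t : (neatSig I D a b).Term b) : (neatSig I D a b).Term b :=
  .app (a := fun _ => b) Func.c ![s, t]

/-- The embedding. -/
def temb (s : (neatSig I D a b).Term a) : (neatSig I D a b).Term b :=
  .app (a := fun _ => a) Func.emb ![s]

/-- The constants for dimensions. -/
def tdim (i : D) : (neatSig I D a b).Term b := .app (a := fun _ => b) (Func.dim i) ![]

/-- Translation of terms. -/
def term : CylTerm → (neatSig I D a b).Term b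
  | .var i => .var b i
  | .bot => .app (a := fun _ => b) Func.bot ![]
  | .top => .app (a := fun _ => b) Func.top ![]
  | .compl s => .app (a := fun _ => b) Func.compl ![term s]
  | .sup s t => .app (a := fun _ => b) Func.sup ![term s, term t]
  | .inf s t => .app (a := fun _ => b) Func.inf ![term s, term t]
  | .c s t => tc (term s) (term t)
  | .d s t => .app (a := fun _ => b) Func.d ![term s, term t]

/-- Translation of atomic formulas. -/
def atom : CylAtom → (neatSig I D a b).Formula
  | .le s t => fle (term s) (term t)
  | .ed s t => fed (term s) (term t)
  | .jp s => fjp (term s)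

/-- Translation of clauses. -/
def clause : CylClause → (neatSig I D a b).Formula
  | .fact φ => atom φ
  | .imp φ ψ => .imp (atom φ) (atom ψ)
  | .imp₂ φ χ ψ => .imp (atom φ) (.imp (atom χ) (atom ψ))
  | .alt φ ψ => .imp (neg (atom φ)) (atom ψ)
  | .alt₃ φ χ ψ => .imp (neg (atom φ)) (.imp (neg (atom χ)) (atom ψ))

/-- The value in the cylindric algebra of an operation applied to terms in the neat reduct. -/
def image (ι : I ↪ D) {l : ℕ} (f : CAFunc I l) (ts : Fin l → (neatSig I D a b).Term a) :
    (neatSig I D a b).Term b :=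
  match l, f, ts with
  | _, .bot, _ => .app (a := fun _ => b) Func.bot ![]
  | _, .top, _ => .app (a := fun _ => b) Func.top ![]
  | _, .compl, ts => .app (a := fun _ => b) Func.compl ![temb (ts 0)]
  | _, .sup, ts => .app (a := fun _ => b) Func.sup ![temb (ts 0), temb (ts 1)]
  | _, .inf, ts => .app (a := fun _ => b) Func.inf ![temb (ts 0), temb (ts 1)]
  | _, .c i, ts => tc (tdim (ι i)) (temb (ts 0))
  | _, .d i j, _ => .app (a := fun _ => b) Func.d ![tdim (ι i), tdim (ι j)]

/-- The theory of neat reducts. -/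
def theory (ι : I ↪ D) : Set (neatSig I D a b).Formula :=
  {φ | (∃ cl ∈ cylAxioms, φ = clause cl) ∨
    (∃ (l : ℕ) (f : CAFunc I l),
      φ = fle (temb (.app (a := fun _ => a) (Func.ca f) fun i => .var a i))
        (image ι f fun i => .var a i) ∨
      φ = fle (image ι f fun i => .var a i)
        (temb (.app (a := fun _ => a) (Func.ca f) fun i => .var a i))) ∨
    φ = .imp (fle (temb (.var a 0)) (temb (.var a 1)))
      (.imp (fle (temb (.var a 1)) (temb (.var a 0))) (.eq (.var a 0) (.var a 1))) ∨
    φ = .imp (fjp (.var b 0)) (fle (tc (.var b 0) (temb (.var a 0))) (temb (.var a 0))) ∨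
    φ = .imp (.all b 1 (.imp (fjp (.var b 1)) (fle (tc (.var b 1) (.var b 0)) (.var b 0))))
      (neg (.all a 0 (.imp (fle (temb (.var a 0)) (.var b 0))
        (neg (fle (.var b 0) (temb (.var a 0))))))) ∨
    (∃ i, φ = neg (fjp (tdim (ι i)))) ∨
    (∃ i ∉ Set.range ι, φ = fjp (tdim i)) ∨
    ∃ i j, i ≠ j ∧ φ = neg (fed (tdim i) (tdim j))}

variable (M : (neatSig I D a b).Model) (v : M.Assignment)

theorem eval_app_zero {s s' : S} (f : (neatSig I D a b).Func 0 (fun _ => s) s') :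
    M.eval v (.app f ![]) = M.func (a := fun _ => s) f ![] := by
  simp only [Model.eval]
  congr 1
  ext i
  exact i.elim0

theorem eval_app_one {s s' : S} (f : (neatSig I D a b).Func 1 (fun _ => s) s')
    (t : (neatSig I D a b).Term s) :
    M.eval v (.app f ![t]) = M.func (a := fun _ => s) f ![M.eval v t] := by
  simp only [Model.eval]
  congr 1
  ext i
  fin_cases i
  rfl

theorem eval_app_two {s s' : S} (f : (neatSig I D a b).Func 2 (fun _ => s) s')
    (t t' : (neatSig I D a b).Term s) :
    M.eval v (.app f ![t, t']) = M.func (a := fun _ => s) f ![M.eval v t, M.eval v t'] := by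
  simp only [Model.eval]
  congr 1
  ext i
  fin_cases i <;> rfl

theorem eval_var (s : S) (i : ℕ) : M.eval v (.var s i) = v (s, i) := by simp only [Model.eval]

theorem eval_tc (s t : (neatSig I D a b).Term b) :
    M.eval v (tc s t) = M.cylData.c (M.eval v s) (M.eval v t) := eval_app_two M v _ s t

theorem eval_temb (s : (neatSig I D a b).Term a) : M.eval v (temb s) = M.emb (M.eval v s) :=
  eval_app_one M v _ s

theorem eval_tdim (i : D) : M.eval v (tdim i) = M.dim i := eval_app_zero M v _

theorem eval_term (t : CylTerm) : M.eval v (term t) = M.cylData.eval (fun i => v (b, i)) t := by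
  induction t with
  | var i => exact eval_var M v b i
  | bot => exact eval_app_zero M v _
  | top => exact eval_app_zero M v _
  | compl s hs => exact (eval_app_one M v _ _).trans (by rw [hs]; rfl)
  | sup s t hs ht => exact (eval_app_two M v _ _ _).trans (by rw [hs, ht]; rfl)
  | inf s t hs ht => exact (eval_app_two M v _ _ _).trans (by rw [hs, ht]; rfl)
  | c s t hs ht => exact (eval_tc M v _ _).trans (by rw [hs, ht]; rfl)
  | d s t hs ht => exact (eval_app_two M v _ _ _).trans (by rw [hs, ht]; rfl)

theorem eval_image (ι : I ↪ D) {l : ℕ} (f : CAFunc I l)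
    (ts : Fin l → (neatSig I D a b).Term a) :
    M.eval v (image ι f ts) =
      M.cylData.caOp (fun i => M.dim (ι i)) f fun i => M.emb (M.eval v (ts i)) := by
  cases f
  · exact eval_app_zero M v _
  · exact eval_app_zero M v _
  · exact (eval_app_one M v _ _).trans (by rw [eval_temb]; rfl)
  · exact (eval_app_two M v _ _ _).trans (by rw [eval_temb, eval_temb]; rfl)
  · exact (eval_app_two M v _ _ _).trans (by rw [eval_temb, eval_temb]; rfl)
  · exact (eval_tc M v _ _).trans (by rw [eval_tdim, eval_temb]; rfl)
  · exact (eval_app_two M v _ _ _).trans (by rw [eval_tdim, eval_tdim]; rfl)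

theorem exists_assignment (hab : a ≠ b) (x : ℕ → M.Carrier a) (y : ℕ → M.Carrier b) :
    ∃ v : M.Assignment, (∀ i, v (a, i) = x i) ∧ ∀ i, v (b, i) = y i := by
  classical
  let v₀ : M.Assignment := fun p => Classical.choice (M.nonempty p.1)
  refine ⟨fun p => if h : a = p.1 then h ▸ x p.2 else if h : b = p.1 then h ▸ y p.2 else v₀ p,
    fun i => ?_, fun i => ?_⟩
  · simp
  · simp [hab]

variable [DecidableEq S]

theorem sat_neg (φ : (neatSig I D a b).Formula) : M.Sat v (neg φ) ↔ ¬ M.Sat v φ := by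
  simp only [neg, Model.Sat]

theorem sat_fle (s t : (neatSig I D a b).Term b) :
    M.Sat v (fle s t) ↔ M.cylData.le (M.eval v s) (M.eval v t) := by
  simp only [fle, Model.Sat, Model.cylData]
  congr! 1
  ext i
  fin_cases i <;> rfl

theorem sat_fed (s t : (neatSig I D a b).Term b) :
    M.Sat v (fed s t) ↔ M.cylData.ed (M.eval v s) (M.eval v t) := by
  simp only [fed, Model.Sat, Model.cylData]
  congr! 1
  ext i
  fin_cases i <;> rfl

theorem sat_fjp (s : (neatSig I D a b).Term b) :
    M.Sat v (fjp s) ↔ M.cylData.jp (M.eval v s) := by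
  simp only [fjp, Model.Sat, Model.cylData]
  congr! 1
  ext i
  fin_cases i
  rfl

theorem sat_atom (φ : CylAtom) : M.Sat v (atom φ) ↔ M.cylData.Holds (fun i => v (b, i)) φ := by
  cases φ <;> simp only [atom, sat_fle, sat_fed, sat_fjp, eval_term, CylData.Holds]

theorem sat_clause (cl : CylClause) :
    M.Sat v (clause cl) ↔ M.cylData.HoldsClause (fun i => v (b, i)) cl := by
  cases cl <;> simp only [clause, Model.Sat, sat_neg, sat_atom, CylData.HoldsClause] <;> tauto

/-- Each kind of axiom translates a condition of `Presents` or a condition on the constants. Because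
`a ≠ b`, the values of the variables of the two sorts can be prescribed independently. -/
theorem models_theory_iff (hab : a ≠ b) (ι : I ↪ D) :
    M.Models (theory ι) ↔
      @CylData.Presents _ M.cylData I (fun i => M.dim (ι i)) (M.Carrier a)
        (M.sortReduct (neatInclusion I D a b)) M.emb ∧
      (∀ i ∉ Set.range ι, M.cylData.jp (M.dim i)) ∧
      ∀ i j, M.cylData.ed (M.dim i) (M.dim j) → i = j := by
  have asg := exists_assignment M hab
  have hne : ∀ s, Inhabited (M.Carrier s) := fun s => Classical.inhabited_of_nonempty (M.nonempty s)
  have upd_a : ∀ (v : M.Assignment) (x : M.Carrier a) i,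
      Function.update v (a, i) x (b, 0) = v (b, 0) :=
    fun v x i => Function.update_of_ne (fun h => hab (congrArg Prod.fst h).symm) _ _
  constructor
  · intro hM
    obtain ⟨v₀, -⟩ := asg (fun _ => default) (fun _ => default)
    have hd : ∀ i j, M.cylData.ed (M.dim i) (M.dim j) → i = j := by
      intro i j hij
      by_contra hne'
      have h1 := hM _ (.inr <| .inr <| .inr <| .inr <| .inr <| .inr <| .inr ⟨i, j, hne', rfl⟩) v₀
      rw [sat_neg, sat_fed, eval_tdim, eval_tdim] at h1
      exact h1 hij
    refine ⟨?_, ?_, hd⟩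
    · let := M.sortReduct (neatInclusion I D a b)
      refine ⟨?_, fun i j hij => ι.injective (hd _ _ hij), ?_, ?_, ?_, ?_, ?_⟩
      · intro cl hcl y
        obtain ⟨v, -, hv⟩ := asg (fun _ => default) y
        have h1 := hM _ (.inl ⟨cl, hcl, rfl⟩) v
        rw [sat_clause] at h1
        simpa only [hv] using h1
      · intro i hi
        have h1 := hM _ (.inr <| .inr <| .inr <| .inr <| .inr <| .inl ⟨i, rfl⟩) v₀
        rw [sat_neg, sat_fjp, eval_tdim] at h1
        exact h1 hi
      · intro l f x
        obtain ⟨v, hv, -⟩ := asg (fun i => if h : i < l then x ⟨i, h⟩ else default)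
          (fun _ => default)
        have h1 := hM _ (.inr <| .inl ⟨l, f, .inl rfl⟩) v
        have h2 := hM _ (.inr <| .inl ⟨l, f, .inr rfl⟩) v
        rw [sat_fle, eval_image, eval_temb] at h1 h2
        simp only [Model.eval, hv, Fin.is_lt, dif_pos, Fin.eta] at h1 h2
        exact ⟨h1, h2⟩
      · intro x y hxy
        obtain ⟨v, hv, -⟩ := asg (fun i => if i = 0 then x else y) (fun _ => default)
        have h1 := hM _ (.inr <| .inr <| .inl rfl) v
        simp only [Model.Sat, sat_fle, eval_temb, eval_var, hv, if_true, one_ne_zero,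
          if_false] at h1
        exact h1 hxy.1 hxy.2
      · intro x j hj
        obtain ⟨v, hv, hv'⟩ := asg (fun _ => x) (fun _ => j)
        have h1 := hM _ (.inr <| .inr <| .inr <| .inl rfl) v
        simp only [Model.Sat, sat_fle, sat_fjp, eval_tc, eval_temb, eval_var, hv, hv'] at h1
        exact h1 hj
      · intro y hy
        obtain ⟨v, -, hv⟩ := asg (fun _ => default) (fun _ => y)
        have h1 := hM _ (.inr <| .inr <| .inr <| .inr <| .inl rfl) v
        simp only [Model.Sat, sat_neg, sat_fle, sat_fjp, eval_tc, eval_temb, eval_var, upd_a,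
          Function.update_self, hv, not_forall, not_not] at h1
        have h2 : ∀ x, Function.update v (b, 1) x (b, 0) = y := fun x =>
          (Function.update_of_ne (by simp) _ _).trans (hv 0)
        simp only [h2] at h1
        obtain ⟨x, hx, hx'⟩ := h1 hy
        exact ⟨x, hx, hx'⟩
    · intro i hi
      have h1 := hM _ (.inr <| .inr <| .inr <| .inr <| .inr <| .inr <| .inl ⟨i, hi, rfl⟩) v₀
      rwa [sat_fjp, eval_tdim] at h1
  · rintro ⟨P, hj, hd⟩ φ hφ v
    let := M.sortReduct (neatInclusion I D a b)
    rcases hφ with ⟨cl, hcl, rfl⟩ | ⟨l, f, rfl | rfl⟩ | rfl | rfl | rfl | ⟨i, rfl⟩ |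
      ⟨i, hi, rfl⟩ | ⟨i, j, hij, rfl⟩
    · rw [sat_clause]
      exact P.pre cl hcl _
    · rw [sat_fle, eval_image, eval_temb]
      simp only [Model.eval]
      exact (P.hom f _).1
    · rw [sat_fle, eval_image, eval_temb]
      simp only [Model.eval]
      exact (P.hom f _).2
    · simp only [Model.Sat, sat_fle, eval_temb, eval_var]
      exact fun h1 h2 => P.injective _ _ ⟨h1, h2⟩
    · simp only [Model.Sat, sat_fle, sat_fjp, eval_tc, eval_temb, eval_var]
      exact P.fixed _ _
    · simp only [Model.Sat, sat_neg, sat_fle, sat_fjp, eval_tc, eval_temb, eval_var, upd_a,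
        Function.update_self, not_forall, not_not]
      intro hy
      have h2 : ∀ x, Function.update v (b, 1) x (b, 0) = v (b, 0) := fun x =>
        Function.update_of_ne (by simp) _ _
      simp only [h2] at hy
      obtain ⟨x, hx⟩ := P.surjective _ hy
      exact ⟨x, hx.1, hx.2⟩
    · rw [sat_neg, sat_fjp, eval_tdim]
      exact P.kept i
    · rw [sat_fjp, eval_tdim]
      exact hj i hi
    · rw [sat_neg, sat_fed, eval_tdim, eval_tdim]
      exact fun h => hij (hd i j h)

/-- The model given by an embedding in the data for a cylindric algebra. -/
def toModel (C : S → Type u) (hC : ∀ s, Nonempty (C s)) (SA : (caLanguage I).Structure (C a))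
    (N : CylData (C b)) (emb : C a → C b) (dm : D → C b) : (neatSig I D a b).Model where
  Carrier := C
  nonempty := hC
  func
    | .ca f, x => SA.funMap f x
    | .emb, x => emb (x 0)
    | .bot, _ => N.bot
    | .top, _ => N.top
    | .compl, x => N.compl (x 0)
    | .sup, x => N.sup (x 0) (x 1)
    | .inf, x => N.inf (x 0) (x 1)
    | .c, x => N.c (x 0) (x 1)
    | .d, x => N.d (x 0) (x 1)
    | .dim i, _ => dm i
  rel
    | .le, x => N.le (x 0) (x 1)
    | .ed, x => N.ed (x 0) (x 1)
    | .jp, x => N.jp (x 0)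

end NeatSig

end Signature

/-- The first sort carries the neat reduct, the second the pairs of an element and a dimension of
the large algebra. The axioms say nothing about the other sorts, which only need to be nonempty. -/
theorem isPseudoElementaryWith_nrCA {n m : Ordinal.{u}} (h : n ≤ m) (hm : m ≠ 0) (k : ℕ)
    [NeZero (k + 2)] : (NrCA h).IsPseudoElementaryWith (k + 2) := by
  have hab : (0 : Fin (k + 2)) ≠ Fin.succ 0 := (Fin.succ_ne_zero 0).symm
  refine ⟨neatSig n.ToType m.ToType 0 (Fin.succ 0), neatInclusion _ _ _ _,
    NeatSig.theory (ordinalInclusion h), fun A SA => ⟨?_, ?_⟩⟩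
  · rintro ⟨B, hB, ⟨e⟩⟩
    have : Nonempty m.ToType := Ordinal.nonempty_toType_iff.mpr hm
    have : Inhabited m.ToType := Classical.inhabited_of_nonempty this
    have hA : Nonempty A := ⟨e.symm ⊥⟩
    have P := CylData.ofAlgebra_presents (ordinalInclusion h) e
    let C : Fin (k + 2) → Type u := Fin.cons A fun _ => B × m.ToType
    have hC : ∀ s, Nonempty (C s) := by
      refine Fin.cases hA fun _ => ⟨((⊥ : B), default)⟩
    let M : (neatSig n.ToType m.ToType (0 : Fin (k + 2)) (Fin.succ 0)).Model :=
      NeatSig.toModel C hC SA (CylData.ofAlgebra m.ToType B (· ∉ Set.range (ordinalInclusion h)))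
        (fun x => ((e x).1, default)) fun i => ((⊥ : B), i)
    refine ⟨M, ?_, ⟨@FirstOrder.Language.Equiv.mk _ A A SA (M.sortReduct (neatInclusion _ _ _ _))
      (Equiv.refl A) (fun _ _ => rfl) fun r => Empty.elim r⟩⟩
    exact (NeatSig.models_theory_iff M hab (ordinalInclusion h)).mpr
      ⟨@CylData.Presents.mk _ _ _ _ _ (M.sortReduct (neatInclusion _ _ _ _)) _ P.pre
        P.kept_injective P.kept P.hom P.injective P.fixed P.surjective,
        fun i hi => hi, fun i j hij => hij⟩
  · rintro ⟨M, hM, ⟨e⟩⟩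
    obtain ⟨P, hj, hd⟩ := (NeatSig.models_theory_iff M hab (ordinalInclusion h)).mp hM
    let := M.sortReduct (neatInclusion n.ToType m.ToType (0 : Fin (k + 2)) (Fin.succ 0))
    exact (P.nrCA (fun r : RemovedDim h => M.dim r.1) (fun r => hj r.1 r.2)
      fun r s hrs => Subtype.ext (hd _ _ hrs)).of_equiv e

/-! ### Unsatisfiability of computable sets of propositional clauses -/

namespace PropClause

/-- The lists of truth values of length `n`. -/
def boolLists (n : ℕ) : List (List Bool) :=
  n.rec [List.nil] fun _ ih => ih.flatMap fun s => [s ++ [true], s ++ [false] ]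

theorem mem_boolLists {n : ℕ} {s : List Bool} : s ∈ boolLists n ↔ s.length = n := by
  induction n generalizing s with
  | zero => simp [boolLists]
  | succ n ih =>
    have h : s ∈ boolLists (n + 1) ↔ ∃ t ∈ boolLists n, s = t ++ [true] ∨ s = t ++ [false] := by
      simp [boolLists]
    rw [h]
    constructor
    · rintro ⟨t, ht, rfl | rfl⟩ <;> simp [ih.mp ht]
    · intro hs
      rcases List.eq_nil_or_concat s with rfl | ⟨t, b, rfl⟩
      · simp at hs
      · refine ⟨t, ih.mpr (by simpa using hs), ?_⟩
        cases b <;> simp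

theorem primrec_boolLists : Primrec boolLists := by
  have h1 : ∀ b : Bool, Primrec fun q : (ℕ × List (List Bool)) × List Bool => q.2 ++ [b] :=
    fun b => Primrec.list_append.comp Primrec.snd (Primrec.const _)
  have h2 : Primrec fun q : (ℕ × List (List Bool)) × List Bool =>
      [q.2 ++ [true], q.2 ++ [false] ] :=
    Primrec.list_cons.comp (h1 _) (Primrec.list_cons.comp (h1 _) (Primrec.const []))
  have h3 : Primrec fun p : ℕ × List (List Bool) =>
      p.2.flatMap fun s => [s ++ [true], s ++ [false] ] :=
    Primrec.list_flatMap Primrec.snd h2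
  exact Primrec.nat_rec₁ _ h3

/-- All literals of some clause are false under every partial assignment of length `N`. -/
def Refuted (N : ℕ) (Cs : List (List (ℕ × Bool))) : Prop :=
  ∀ s ∈ boolLists N, ∃ cl ∈ Cs, ∀ l ∈ cl, s[l.1]? = some (!l.2)

theorem primrecRel_refuted : PrimrecRel Refuted := by
  have h1 : PrimrecRel fun (l : ℕ × Bool) (s : List Bool) => s[l.1]? = some (!l.2) :=
    Primrec.eq.comp (Primrec.list_getElem?.comp Primrec.snd (Primrec.fst.comp Primrec.fst))
      (Primrec.option_some.comp (Primrec.not.comp (Primrec.snd.comp Primrec.fst)))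
  have h2 := h1.forall_mem_list.exists_mem_list
  have h3 : PrimrecRel fun (s : List Bool) (Cs : List (List (ℕ × Bool))) =>
      ∃ cl ∈ Cs, ∀ l ∈ cl, s[l.1]? = some (!l.2) :=
    h2.comp Primrec.snd Primrec.fst
  have h4 := h3.forall_mem_list
  exact h4.comp (primrec_boolLists.comp Primrec.fst) Primrec.snd

variable (L : ℕ → ℕ → List (List (ℕ × Bool)))

/-- The clauses with indices below `N`. -/
def initial (a N : ℕ) : List (List (ℕ × Bool)) := N.rec [] fun w ih => ih ++ L a w

variable {L}

theorem mem_initial {a N : ℕ} {cl : List (ℕ × Bool)} :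
    cl ∈ initial L a N ↔ ∃ w < N, cl ∈ L a w := by
  induction N with
  | zero => simp [initial]
  | succ N ih =>
    have h : cl ∈ initial L a (N + 1) ↔ cl ∈ initial L a N ∨ cl ∈ L a N := by simp [initial]
    simp only [h, ih, Nat.lt_succ_iff_lt_or_eq, or_and_right, exists_or, exists_eq_left]

theorem computable_initial (hL : Computable₂ L) : Computable₂ (initial L) := by
  refine Computable.nat_rec (f := fun p : ℕ × ℕ => p.2) (g := fun _ => [])
    (h := fun p q => q.2 ++ L p.1 q.1) Computable.snd (Computable.const []) ?_
  exact Computable.list_append.comp (Computable.snd.comp Computable.snd)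
    (hL.comp (Computable.fst.comp Computable.fst) (Computable.fst.comp Computable.snd))

/-- Compactness of `ℕ → Bool`: the assignments that satisfy the first `N` lists of clauses form a
decreasing sequence of closed sets. -/
theorem exists_refuted_iff (a : ℕ) : (∃ N, Refuted N (initial L a N)) ↔
    ¬ ∃ v : ℕ → Bool, ∀ w, ∀ cl ∈ L a w, ∃ l ∈ cl, v l.1 = l.2 := by
  constructor
  · rintro ⟨N, hN⟩ ⟨v, hv⟩
    obtain ⟨cl, hcl, h⟩ := hN (List.ofFn fun i : Fin N => v i) (mem_boolLists.mpr (by simp))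
    obtain ⟨w, -, hw⟩ := mem_initial.mp hcl
    obtain ⟨l, hl, hl'⟩ := hv w cl hw
    have h1 := h l hl
    simp [List.getElem?_ofFn, hl'] at h1
  · intro hv
    by_contra hN
    push Not at hN
    apply hv
    let F : ℕ → Set (ℕ → Bool) := fun N => {v | ∀ cl ∈ initial L a N, ∃ l ∈ cl, v l.1 = l.2}
    have hF : ∀ N, IsClosed (F N) := by
      intro N
      have h1 : F N = ⋂ cl ∈ {cl | cl ∈ initial L a N}, ⋃ l ∈ {l | l ∈ cl}, {v | v l.1 = l.2} := by
        ext v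
        simp [F]
      rw [h1]
      refine isClosed_biInter fun cl _ => (List.finite_toSet cl).isClosed_biUnion fun l _ => ?_
      exact isClosed_eq (continuous_apply l.1) continuous_const
    obtain ⟨v, hv⟩ := IsCompact.nonempty_iInter_of_sequence_nonempty_isCompact_isClosed F
      (fun N v hv cl hcl => hv cl (by
        obtain ⟨w, hw, h⟩ := mem_initial.mp hcl
        exact mem_initial.mpr ⟨w, hw.trans N.lt_succ_self, h⟩))
      (fun N => by
        obtain ⟨b, hb⟩ := (List.finite_toSet ((initial L a N).flatten.map Prod.fst)).bddAbove
        -- `b` bounds the variables in the first `N` lists, so this many truth values decide all of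
        -- them.
        have h1 := hN (N + b + 1)
        simp only [Refuted, not_forall] at h1
        obtain ⟨s, hs, h1⟩ := h1
        push Not at h1
        rw [mem_boolLists] at hs
        refine ⟨fun i => s.getD i true, fun cl hcl => ?_⟩
        obtain ⟨w, hw, h⟩ := mem_initial.mp hcl
        obtain ⟨l, hl, hl'⟩ := h1 cl (mem_initial.mpr ⟨w, by lia, h⟩)
        have h2 : l.1 ≤ b := hb (by
          simp only [Set.mem_ofPred_eq, List.mem_map, List.mem_flatten]
          exact ⟨l, ⟨cl, hcl, hl⟩, rfl⟩)
        refine ⟨l, hl, ?_⟩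
        have h3 : l.1 < s.length := by lia
        rw [List.getElem?_eq_getElem h3] at hl'
        simp only [List.getD_eq_getElem _ _ h3]
        revert hl'
        cases s[l.1] <;> cases l.2 <;> simp)
      (hF 0).isCompact hF
    refine ⟨v, fun w cl hcl => Set.mem_iInter.mp hv (w + 1) cl ?_⟩
    exact mem_initial.mpr ⟨w, w.lt_succ_self, hcl⟩

theorem rePred_unsatisfiable (hL : Computable₂ L) :
    REPred fun a => ¬ ∃ v : ℕ → Bool, ∀ w, ∀ cl ∈ L a w, ∃ l ∈ cl, v l.1 = l.2 := by
  classical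
  have h1 : ComputablePred fun p : ℕ × ℕ => Refuted p.2 (initial L p.1 p.2) := by
    obtain ⟨hd, h⟩ := primrecRel_refuted
    refine ⟨fun _ => inferInstance, ?_⟩
    refine (h.to_comp.comp (Computable.snd.pair (computable_initial hL))).of_eq fun p => ?_
    simp only [decide_eq_decide]
  obtain ⟨f, hf, hf'⟩ := ComputablePred.computable_iff.mp h1
  have h2 : REPred fun a => (Nat.rfind fun N => (Part.some (f (a, N)) : Part Bool)).Dom :=
    Partrec.dom_re (Partrec.rfind hf.partrec.to₂)
  refine h2.of_eq fun a => ?_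
  refine Nat.rfind_dom.trans (Iff.trans (exists_congr fun N => ?_) (exists_refuted_iff a))
  have h3 : Refuted N (initial L a N) ↔ f (a, N) = true := (congrFun hf' (a, N)).to_iff
  rw [h3]
  constructor
  · rintro ⟨h4, -⟩
    exact (Part.mem_some_iff.mp h4).symm
  · intro h4
    exact ⟨Part.mem_some_iff.mpr h4.symm, fun _ => trivial⟩

end PropClause

/-! ### Schemes of clauses about natural numbers -/

/-- Terms for natural numbers. -/
inductive CodeTerm
  | var (i : ℕ)
  | num (k : ℕ)
  | add (s t : CodeTerm)
  | mul (s t : CodeTerm)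
  | pair (s t : CodeTerm)

namespace CodeTerm

/-- The value of a term. -/
def eval (ε : ℕ → ℕ) : CodeTerm → ℕ
  | var i => ε i
  | num k => k
  | add s t => eval ε s + eval ε t
  | mul s t => eval ε s * eval ε t
  | pair s t => Nat.pair (eval ε s) (eval ε t)

theorem primrec_eval (t : CodeTerm) :
    Primrec fun l : List ℕ => t.eval fun i => l.getD i 0 := by
  induction t with
  | var i => exact (Primrec.list_getD 0).comp Primrec.id (Primrec.const i)
  | num k => exact Primrec.const k
  | add s t hs ht => exact Primrec.nat_add.comp hs ht
  | mul s t hs ht => exact Primrec.nat_mul.comp hs ht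
  | pair s t hs ht => exact Primrec₂.natPair.comp hs ht

end CodeTerm

/-- Schemes of clauses: the hypotheses imply one of the conclusions. -/
structure CodeClause where
  hyps : List CodeTerm
  concls : List CodeTerm

namespace CodeClause

variable (P : ℕ → Prop) (ε : ℕ → ℕ)

/-- Some term of the list has a value with the property `P`. -/
def HoldsSome : List CodeTerm → Prop
  | [] => False
  -- A case of its own, so that instances of schemes unfold by definition to plain implications and
  -- disjunctions, without a trailing `∨ False`.
  | [t] => P (t.eval ε)
  | t :: t' :: ts => P (t.eval ε) ∨ HoldsSome (t' :: ts)

/-- If all terms of the first list have values with the property `P`, then some term of the second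
list has. -/
def HoldsImp : List CodeTerm → List CodeTerm → Prop
  | [], ts => HoldsSome P ε ts
  | t :: hs, ts => P (t.eval ε) → HoldsImp hs ts

/-- The truth of an instance of a scheme. -/
def Holds (C : CodeClause) : Prop := HoldsImp P ε C.hyps C.concls

theorem holdsSome_iff (ts : List CodeTerm) : HoldsSome P ε ts ↔ ∃ t ∈ ts, P (t.eval ε) := by
  induction ts with
  | nil => simp [HoldsSome]
  | cons t ts ih =>
    cases ts with
    | nil => simp [HoldsSome]
    | cons t' ts => simp only [HoldsSome, ih, List.exists_mem_cons_iff]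

theorem holds_iff (C : CodeClause) :
    C.Holds P ε ↔ (∃ t ∈ C.hyps, ¬ P (t.eval ε)) ∨ ∃ t ∈ C.concls, P (t.eval ε) := by
  obtain ⟨hs, ts⟩ := C
  simp only [Holds]
  induction hs with
  | nil => simp [HoldsImp, holdsSome_iff]
  | cons t hs ih =>
    simp only [HoldsImp, ih, List.exists_mem_cons_iff]
    rw [imp_iff_not_or, or_assoc]

/-- The literals of an instance of a scheme. -/
def literals (C : CodeClause) : List (ℕ × Bool) :=
  C.hyps.map (fun t => (t.eval ε, false)) ++ C.concls.map fun t => (t.eval ε, true)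

theorem exists_literals_iff (C : CodeClause) (v : ℕ → Bool) :
    (∃ l ∈ C.literals ε, v l.1 = l.2) ↔ C.Holds (fun x => v x = true) ε := by
  rw [holds_iff]
  simp [literals, or_and_right, exists_or]

theorem primrec_literals (C : CodeClause) :
    Primrec fun l : List ℕ => C.literals fun i => l.getD i 0 := by
  have h : ∀ (b : Bool) (ts : List CodeTerm),
      Primrec fun l : List ℕ => ts.map fun t => (t.eval fun i => l.getD i 0, b) := by
    intro b ts
    induction ts with
    | nil => exact Primrec.const []
    | cons t ts ih => exact Primrec.list_cons.comp (t.primrec_eval.pair (Primrec.const b)) ih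
  exact Primrec.list_append.comp (h false C.hyps) (h true C.concls)

theorem primrec_map_literals (T : List CodeClause) :
    Primrec fun l : List ℕ => T.map fun C => C.literals fun i => l.getD i 0 := by
  induction T with
  | nil => exact Primrec.const []
  | cons C T ih => exact Primrec.list_cons.comp C.primrec_literals ih

theorem rePred_unsatisfiable (T : List CodeClause) {r o : ℕ → Prop} (hr : ComputablePred r)
    (ho : ComputablePred o) :
    REPred fun a => ¬ ∃ P : ℕ → Prop, (∀ x, P (Nat.pair 7 x) ↔ r x) ∧
      (∀ x, P (Nat.pair 8 x) ↔ o x) ∧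
      ∀ C ∈ T, ∀ l : List ℕ, C.Holds P fun i => (a :: l).getD i 0 := by
  classical
  obtain ⟨f, hf, rfl⟩ := ComputablePred.computable_iff.mp hr
  obtain ⟨g, hg, rfl⟩ := ComputablePred.computable_iff.mp ho
  -- Variable `0` of the schemes stands for the input `a`, and `w` codes the values of the others.
  -- The unit clauses fix the truth values at the labels `7` and `8`.
  let L : ℕ → ℕ → List (List (ℕ × Bool)) := fun a w =>
    [(Nat.pair 7 w, f w)] :: [(Nat.pair 8 w, g w)] ::
      T.map fun C => C.literals fun i => (a :: Denumerable.ofNat (List ℕ) w).getD i 0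
  have single : ∀ (k : ℕ) {f : ℕ → Bool}, Computable f →
      Computable fun q : ℕ × ℕ => [(Nat.pair k q.2, f q.2)] := fun k f hf =>
    Computable.list_cons.comp
      (((Primrec₂.natPair.comp (Primrec.const k) Primrec.snd).to_comp).pair
        (hf.comp Computable.snd)) (Computable.const [])
  have hL : Computable₂ L := by
    have h1 : Primrec fun q : ℕ × ℕ => q.1 :: Denumerable.ofNat (List ℕ) q.2 :=
      Primrec.list_cons.comp Primrec.fst ((Primrec.ofNat (List ℕ)).comp Primrec.snd)
    exact Computable.list_cons.comp (single 7 hf) (Computable.list_cons.comp (single 8 hg)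
      ((primrec_map_literals T).comp h1).to_comp)
  refine (PropClause.rePred_unsatisfiable hL).of_eq fun a => not_congr ?_
  have key : ∀ v : ℕ → Bool, (∀ w, ∀ cl ∈ L a w, ∃ l ∈ cl, v l.1 = l.2) ↔
      (∀ x, v (Nat.pair 7 x) = true ↔ f x = true) ∧ (∀ x, v (Nat.pair 8 x) = true ↔ g x = true) ∧
      ∀ C ∈ T, ∀ l : List ℕ, C.Holds (fun x => v x = true) fun i => (a :: l).getD i 0 := by
    intro v
    simp only [L, List.forall_mem_cons, List.forall_mem_map, exists_literals_iff, forall_and,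
      List.mem_singleton, exists_eq_left]
    refine and_congr (forall_congr' fun _ => Bool.eq_iff_iff)
      (and_congr (forall_congr' fun _ => Bool.eq_iff_iff) ?_)
    constructor
    · intro h C hC l
      have h1 := h (Encodable.encode l) C hC
      rwa [Denumerable.ofNat_encode] at h1
    · exact fun h w C hC => h C hC _
  constructor
  · rintro ⟨v, hv⟩
    exact ⟨fun x => v x = true, (key v).mp hv⟩
  · rintro ⟨P, h⟩
    refine ⟨fun x => decide (P x), (key fun x => decide (P x)).mpr ?_⟩
    simpa only [decide_eq_true_eq] using h

end CodeClause

/-! ### Satisfaction of formulas given by codes -/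

namespace CylData

variable {X : Type w} (M : CylData X) {I : Type u}

theorem IsPrecylindric.eqv_trans {M : CylData X} (h : M.IsPrecylindric) {x y z : X}
    (h1 : M.Eqv x y) (h2 : M.Eqv y z) : M.Eqv x z := h.elemSetoid.trans h1 h2

theorem IsPrecylindric.eqv_symm {M : CylData X} (h : M.IsPrecylindric) {x y : X}
    (h1 : M.Eqv x y) : M.Eqv y x := h.elemSetoid.symm h1

theorem IsPrecylindric.caOp_congr {M : CylData X} (h : M.IsPrecylindric) (k : I → X) {l : ℕ}
    (f : CAFunc I l) {x y : Fin l → X} (hxy : ∀ i, M.Eqv (x i) (y i)) :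
    M.Eqv (M.caOp k f x) (M.caOp k f y) := by
  cases f with
  | bot => exact ⟨h.refl _, h.refl _⟩
  | top => exact ⟨h.refl _, h.refl _⟩
  | compl => exact ⟨h.compl_anti (hxy 0).2, h.compl_anti (hxy 0).1⟩
  | sup => exact ⟨h.sup_mono (hxy 0).1 (hxy 1).1, h.sup_mono (hxy 0).2 (hxy 1).2⟩
  | inf => exact ⟨h.inf_mono (hxy 0).1 (hxy 1).1, h.inf_mono (hxy 0).2 (hxy 1).2⟩
  | c i =>
    have h1 : M.ed (k i) (k i) := h.axiom_get 13 (k i) (k i) (k i)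
    exact ⟨h.c_le h1 (hxy 0).1, h.c_le h1 (hxy 0).2⟩
  | d i j => exact ⟨h.refl _, h.refl _⟩

/-- Tarski's conditions on the values of terms and the satisfaction of formulas, given by codes.
The quantifiers range over the neat reduct; `E` is the set of assignments. -/
structure Tarski (e : I → ℕ) (k : I → X) {E : Type*} (val : ℕ → E → X) (upd : ℕ → E → X → E)
    (sat : ℕ → ℕ → E → Prop) : Prop where
  val_self : ∀ l ρ x, M.Eqv (val (Nat.pair 0 l) (upd l ρ x)) x
  val_lt : ∀ i l ρ x, i < l → M.Eqv (val (Nat.pair 0 i) (upd l ρ x)) (val (Nat.pair 0 i) ρ)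
  val_func : ∀ {l : ℕ} (f : CAFunc I l) (ts : Fin l → ℕ) ρ,
    M.Eqv (val (Nat.pair (caFuncCode e f + 1) (Encodable.encode (List.ofFn ts))) ρ)
      (M.caOp k f fun i => val (ts i) ρ)
  sat_falsum : ∀ l ρ, ¬ sat (Nat.pair 0 0) l ρ
  sat_equal : ∀ s t l ρ, sat (Nat.pair 1 (Nat.pair s t)) l ρ ↔ M.Eqv (val s ρ) (val t ρ)
  sat_imp : ∀ φ ψ l ρ, sat (Nat.pair 2 (Nat.pair φ ψ)) l ρ ↔ (sat φ l ρ → sat ψ l ρ)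
  sat_all : ∀ φ l ρ, sat (Nat.pair 3 φ) l ρ ↔ ∀ x, M.Fixed x → sat φ (l + 1) (upd l ρ x)

variable {M} {e : I → ℕ} {k : I → X} {E : Type*} {val : ℕ → E → X} {upd : ℕ → E → X → E}
  {sat : ℕ → ℕ → E → Prop} {A : Type v} [(caLanguage I).Structure A] {emb : A → X}

theorem Tarski.val_caTermCode (T : M.Tarski e k val upd sat) (P : M.Presents k A emb) {l : ℕ}
    (t : (caLanguage I).Term (Empty ⊕ Fin l)) {ρ : E} {xs : Fin l → A}
    (hρ : ∀ i : Fin l, M.Eqv (val (Nat.pair 0 i) ρ) (emb (xs i))) :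
    M.Eqv (val (caTermCode e (Sum.elim Empty.elim Fin.val) t) ρ)
      (emb (t.realize (Sum.elim default xs))) := by
  induction t with
  | var x =>
    rcases x with x | i
    · exact x.elim
    · exact hρ i
  | func f ts ih =>
    refine P.pre.eqv_trans (T.val_func (I := I) f _ ρ) ?_
    exact P.pre.eqv_trans (P.pre.caOp_congr k f ih) (P.pre.eqv_symm (P.hom f _))

/-- A quantifier binds the variable whose number is the current depth `l`, so the update at `l`
keeps all variables in scope. Up to `Eqv`, fixed elements of `X` are the elements of `A`. -/
theorem Tarski.sat_caFormulaCode (T : M.Tarski e k val upd sat) (P : M.Presents k A emb) {l : ℕ}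
    (φ : (caLanguage I).BoundedFormula Empty l) {ρ : E} {xs : Fin l → A}
    (hρ : ∀ i : Fin l, M.Eqv (val (Nat.pair 0 i) ρ) (emb (xs i))) :
    sat (caFormulaCode e φ) l ρ ↔ φ.Realize default xs := by
  induction φ generalizing ρ with
  | falsum => exact iff_of_false (T.sat_falsum _ ρ) id
  | equal t t' =>
    refine (T.sat_equal _ _ _ ρ).trans ?_
    have h1 := T.val_caTermCode P t hρ
    have h2 := T.val_caTermCode P t' hρ
    constructor
    · intro h
      exact P.injective _ _ (P.pre.eqv_trans (P.pre.eqv_symm h1) (P.pre.eqv_trans h h2))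
    · intro h
      refine P.pre.eqv_trans h1 (P.pre.eqv_trans ?_ (P.pre.eqv_symm h2))
      rw [show t.realize (Sum.elim default xs) = t'.realize (Sum.elim default xs) from h]
      exact ⟨P.pre.refl _, P.pre.refl _⟩
  | rel r ts => exact Empty.elim r
  | imp φ ψ hφ hψ => exact (T.sat_imp _ _ _ ρ).trans (imp_congr (hφ hρ) (hψ hρ))
  | @all l φ ih =>
    refine (T.sat_all _ _ ρ).trans ?_
    have step : ∀ x a, M.Eqv x (emb a) →
        (sat (caFormulaCode e φ) (l + 1) (upd l ρ x) ↔ φ.Realize default (Fin.snoc xs a)) := by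
      intro x a hxa
      refine ih fun i => ?_
      induction i using Fin.lastCases with
      | last =>
        rw [Fin.snoc_last]
        exact P.pre.eqv_trans (T.val_self l ρ x) hxa
      | cast i =>
        rw [Fin.snoc_castSucc]
        exact P.pre.eqv_trans (T.val_lt i l ρ x i.2) (hρ i)
    constructor
    · intro h a
      exact (step _ a ⟨P.pre.refl _, P.pre.refl _⟩).mp (h _ (P.fixed a))
    · intro h x hx
      obtain ⟨a, ha⟩ := P.surjective x hx
      exact (step x a (P.pre.eqv_symm ha)).mpr (h a)

theorem Tarski.sat_sentence (T : M.Tarski e k val upd sat) (P : M.Presents k A emb)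
    (φ : (caLanguage I).Sentence) (ρ : E) : sat (caFormulaCode e φ) 0 ρ ↔ A ⊨ φ :=
  T.sat_caFormulaCode P φ fun i => i.elim0

end CylData

/-! ### Clauses describing a neat reduct and the satisfaction of formulas in it

The elements of the cylindric algebra, its dimensions and the assignments are coded by natural
numbers, and so are the atomic statements about them. -/

namespace CodeTerm

/-- Comparison of elements. -/
def le (s t : CodeTerm) : CodeTerm := pair (num 0) (pair s t)

/-- Equality of dimensions. -/
def ed (s t : CodeTerm) : CodeTerm := pair (num 1) (pair s t)

/-- The dimension is removed. -/
def jp (s : CodeTerm) : CodeTerm := pair (num 2) s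

/-- The element is fixed by the removed cylindrifications. -/
def fx (s : CodeTerm) : CodeTerm := pair (num 3) s

/-- The formula is satisfied, given the number of variables in scope and an assignment. -/
def sat (s l r : CodeTerm) : CodeTerm := pair (num 4) (pair s (pair l r))

/-- The number codes a term, given the number of variables in scope. -/
def vt (l s : CodeTerm) : CodeTerm := pair (num 5) (pair l s)

/-- The number codes a formula, given the number of variables in scope. -/
def vf (l s : CodeTerm) : CodeTerm := pair (num 6) (pair l s)

/-- The number codes a dimension of the neat reduct. -/
def kept (s : CodeTerm) : CodeTerm := pair (num 7) s

/-- The number codes a constant for a removed dimension. -/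
def rem (s : CodeTerm) : CodeTerm := pair (num 8) s

/-- The codes for elements and dimensions. -/
def ofCyl : CylTerm → CodeTerm
  | .var i => var (i + 1)
  | .bot => pair (num 1) (num 0)
  | .top => pair (num 2) (num 0)
  | .compl s => pair (num 3) (ofCyl s)
  | .sup s t => pair (num 4) (pair (ofCyl s) (ofCyl t))
  | .inf s t => pair (num 5) (pair (ofCyl s) (ofCyl t))
  | .c s t => pair (num 6) (pair (ofCyl s) (ofCyl t))
  | .d s t => pair (num 7) (pair (ofCyl s) (ofCyl t))

/-- Cylindrification. -/
def c (s t : CodeTerm) : CodeTerm := pair (num 6) (pair s t)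

/-- The dimensions of the neat reduct. -/
def keptDim (s : CodeTerm) : CodeTerm := pair (num 8) s

/-- The constants for removed dimensions. -/
def remDim (s : CodeTerm) : CodeTerm := pair (num 9) s

/-- A removed dimension whose cylindrification does not fix the given element, if there is one. -/
def witDim (s : CodeTerm) : CodeTerm := pair (num 10) s

/-- The value of a term under an assignment. -/
def val (s r : CodeTerm) : CodeTerm := pair (num 11) (pair s r)

/-- A counterexample to a universally quantified formula, if there is one. -/
def wit (s l r : CodeTerm) : CodeTerm := pair (num 12) (pair s (pair l r))

/-- Assignments. -/
def upd (l r x : CodeTerm) : CodeTerm := pair (num 14) (pair l (pair r x))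

/-- The code of a list of one number. -/
def list₁ (s : CodeTerm) : CodeTerm := add (pair s (num 0)) (num 1)

/-- The code of a list of two numbers. -/
def list₂ (s t : CodeTerm) : CodeTerm := add (pair s (list₁ t)) (num 1)

/-- The code of the operation symbol for a cylindrification, plus one. -/
def symC (s : CodeTerm) : CodeTerm := add (add (num 5) (mul (num 2) s)) (num 1)

/-- The code of the operation symbol for a diagonal element, plus one. -/
def symD (s t : CodeTerm) : CodeTerm := add (add (num 6) (mul (num 2) (pair s t))) (num 1)

/-- A number greater than `s`. -/
def above (s t : CodeTerm) : CodeTerm := add (add s t) (num 1)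

end CodeTerm

namespace CodeClause

open CodeTerm

/-- The codes for atomic formulas about a cylindric algebra. -/
def ofAtom : CylAtom → CodeTerm
  | .le s t => le (ofCyl s) (ofCyl t)
  | .ed s t => ed (ofCyl s) (ofCyl t)
  | .jp s => jp (ofCyl s)

/-- The schemes for clauses about a cylindric algebra. -/
def ofClause : CylClause → CodeClause
  | .fact φ => ⟨[], [ofAtom φ]⟩
  | .imp φ ψ => ⟨[ofAtom φ], [ofAtom ψ]⟩
  | .imp₂ φ χ ψ => ⟨[ofAtom φ, ofAtom χ], [ofAtom ψ]⟩
  | .alt φ ψ => ⟨[], [ofAtom φ, ofAtom ψ]⟩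
  | .alt₃ φ χ ψ => ⟨[], [ofAtom φ, ofAtom χ, ofAtom ψ]⟩

/-- Schemes about fixed elements. -/
def fixedSchemes : List CodeClause :=
  let x := var 1
  let y := var 2
  [⟨[fx x, jp y], [le (c y x) x]⟩,
   ⟨[], [fx x, jp (witDim x)]⟩,
   ⟨[le (c (witDim x) x) x], [fx x]⟩]

/-- Schemes about dimensions. -/
def dimSchemes : List CodeClause :=
  let x := var 1
  let y := var 2
  [⟨[kept x, jp (keptDim x)], []⟩,
   ⟨[kept x, kept (above x y), ed (keptDim x) (keptDim (above x y))], []⟩,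
   ⟨[rem x], [jp (remDim x)]⟩,
   ⟨[rem x, rem (above x y), ed (remDim x) (remDim (above x y))], []⟩]

/-- Two schemes expressing that the codes represent the same element. -/
def eqv (s t : CodeTerm) : List CodeClause := [⟨[], [le s t]⟩, ⟨[], [le t s]⟩]

/-- Pairs of codes that represent the same element. -/
def valEquations : List (CodeTerm × CodeTerm) :=
  let r := var 1
  let x := var 2
  let y := var 3
  let z := var 4
  [(val (pair (num 0) x) (upd x r y), y),
   (val (pair (num 0) x) (upd (above x z) r y), val (pair (num 0) x) r),
   (val (pair (num 1) (num 0)) r, pair (num 1) (num 0)),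
   (val (pair (num 2) (num 0)) r, pair (num 2) (num 0)),
   (val (pair (num 3) (list₁ x)) r, pair (num 3) (val x r)),
   (val (pair (num 4) (list₂ x y)) r, pair (num 4) (pair (val x r) (val y r))),
   (val (pair (num 5) (list₂ x y)) r, pair (num 5) (pair (val x r) (val y r))),
   (val (pair (symC z) (list₁ x)) r, pair (num 6) (pair (keptDim z) (val x r))),
   (val (pair (symD x y) (num 0)) r, pair (num 7) (pair (keptDim x) (keptDim y)))]

/-- Schemes about the satisfaction of formulas. -/
def satSchemes : List CodeClause :=
  let l := var 1
  let r := var 2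
  let x := var 3
  let y := var 4
  [⟨[sat (pair (num 0) (num 0)) l r], []⟩,
   ⟨[sat (pair (num 1) (pair x y)) l r], [le (val x r) (val y r)]⟩,
   ⟨[sat (pair (num 1) (pair x y)) l r], [le (val y r) (val x r)]⟩,
   ⟨[le (val x r) (val y r), le (val y r) (val x r)], [sat (pair (num 1) (pair x y)) l r]⟩,
   ⟨[sat (pair (num 2) (pair x y)) l r, sat x l r], [sat y l r]⟩,
   ⟨[], [sat (pair (num 2) (pair x y)) l r, sat x l r]⟩,
   ⟨[sat y l r], [sat (pair (num 2) (pair x y)) l r]⟩,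
   ⟨[sat (pair (num 3) x) l r, fx y], [sat x (add l (num 1)) (upd l r y)]⟩,
   ⟨[], [sat (pair (num 3) x) l r, fx (wit x l r)]⟩,
   ⟨[sat x (add l (num 1)) (upd l r (wit x l r))], [sat (pair (num 3) x) l r]⟩]

/-- Schemes about codes of terms and formulas. -/
def validSchemes : List CodeClause :=
  let l := var 1
  let x := var 2
  let y := var 3
  let z := var 4
  [⟨[], [vt (above x y) (pair (num 0) x)]⟩,
   ⟨[], [vt l (pair (num 1) (num 0))]⟩,
   ⟨[], [vt l (pair (num 2) (num 0))]⟩,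
   ⟨[vt l x], [vt l (pair (num 3) (list₁ x))]⟩,
   ⟨[vt l x, vt l y], [vt l (pair (num 4) (list₂ x y))]⟩,
   ⟨[vt l x, vt l y], [vt l (pair (num 5) (list₂ x y))]⟩,
   ⟨[kept z, vt l x], [vt l (pair (symC z) (list₁ x))]⟩,
   ⟨[kept x, kept y], [vt l (pair (symD x y) (num 0))]⟩,
   ⟨[], [vf l (pair (num 0) (num 0))]⟩,
   ⟨[vt l x, vt l y], [vf l (pair (num 1) (pair x y))]⟩,
   ⟨[vf l x, vf l y], [vf l (pair (num 2) (pair x y))]⟩,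
   ⟨[vf (add l (num 1)) x], [vf l (pair (num 3) x)]⟩,
   ⟨[vf (num 0) (var 0), sat (var 0) (num 0) (num 0)], []⟩]

/-- All schemes. -/
def schemes : List CodeClause :=
  cylAxioms.map ofClause ++ (fixedSchemes ++ (dimSchemes ++
    (valEquations.flatMap (fun p => eqv p.1 p.2) ++ (satSchemes ++ validSchemes))))

/-- The data for a cylindric algebra given by the true atomic statements. -/
def codeData (P : ℕ → Prop) : CylData ℕ where
  le x y := P (Nat.pair 0 (Nat.pair x y))
  ed x y := P (Nat.pair 1 (Nat.pair x y))
  jp x := P (Nat.pair 2 x)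
  bot := Nat.pair 1 0
  top := Nat.pair 2 0
  compl x := Nat.pair 3 x
  sup x y := Nat.pair 4 (Nat.pair x y)
  inf x y := Nat.pair 5 (Nat.pair x y)
  c x y := Nat.pair 6 (Nat.pair x y)
  d x y := Nat.pair 7 (Nat.pair x y)

theorem eval_ofCyl (P : ℕ → Prop) (ε : ℕ → ℕ) (t : CylTerm) :
    (ofCyl t).eval ε = (codeData P).eval (fun i => ε (i + 1)) t := by
  induction t <;> simp_all [ofCyl, CodeTerm.eval, CylData.eval, codeData]

theorem holds_ofClause (P : ℕ → Prop) (ε : ℕ → ℕ) (cl : CylClause) :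
    (ofClause cl).Holds P ε ↔ (codeData P).HoldsClause (fun i => ε (i + 1)) cl := by
  have h : ∀ φ, P ((ofAtom φ).eval ε) ↔ (codeData P).Holds (fun i => ε (i + 1)) φ := by
    intro φ
    cases φ <;> simp only [CylData.Holds, ← eval_ofCyl] <;> rfl
  cases cl <;> simp only [CylData.HoldsClause, ← h] <;> rfl

/-- The instances of the schemes are true. -/
def Good (T : List CodeClause) (P : ℕ → Prop) (a : ℕ) : Prop :=
  ∀ C ∈ T, ∀ l : List ℕ, C.Holds P fun i => (a :: l).getD i 0

theorem good_append {T T' : List CodeClause} {P : ℕ → Prop} {a : ℕ} :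
    Good (T ++ T') P a ↔ Good T P a ∧ Good T' P a := List.forall_mem_append

theorem Good.get {T : List CodeClause} {P : ℕ → Prop} {a : ℕ} (h : Good T P a)
    (k : Fin T.length) (x y z w : ℕ) : (T.get k).Holds P fun i => [a, x, y, z, w].getD i 0 :=
  h _ (List.get_mem T k) [x, y, z, w]

variable {P : ℕ → Prop} {a : ℕ}

theorem Good.isPrecylindric (h : Good (cylAxioms.map ofClause) P a) :
    (codeData P).IsPrecylindric := by
  intro cl hcl v
  have h1 := h _ (List.mem_map_of_mem hcl) [v 0, v 1, v 2]
  rw [holds_ofClause] at h1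
  simp only [cylAxioms, List.mem_cons, List.not_mem_nil, or_false] at hcl
  rcases hcl with rfl | rfl | rfl | rfl | rfl | rfl | rfl | rfl | rfl | rfl | rfl | rfl | rfl |
    rfl | rfl | rfl | rfl | rfl | rfl | rfl | rfl | rfl | rfl | rfl | rfl | rfl | rfl | rfl |
    rfl | rfl <;>
  exact h1

/-- Unless `x` is declared fixed, the Skolem term `witDim x` denotes a removed dimension whose
cylindrification moves it. -/
theorem Good.fixed_iff (h : Good fixedSchemes P a) (x : ℕ) :
    P (Nat.pair 3 x) ↔ (codeData P).Fixed x := by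
  constructor
  · intro hx j hj
    exact h.get (0 : Fin 3) x j 0 0 hx hj
  · intro hx
    by_contra h1
    have h2 : P (Nat.pair 2 (Nat.pair 10 x)) := (h.get (1 : Fin 3) x 0 0 0).resolve_left h1
    exact h1 (h.get (2 : Fin 3) x 0 0 0 (hx _ h2))

theorem Good.eqv (h : Good (valEquations.flatMap fun p => CodeClause.eqv p.1 p.2) P a)
    (k : Fin 9) (x y z w : ℕ) :
    (codeData P).Eqv
      ((valEquations.get k).1.eval fun i => [a, x, y, z, w].getD i 0)
      ((valEquations.get k).2.eval fun i => [a, x, y, z, w].getD i 0) := by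
  have h1 : ∀ C ∈ CodeClause.eqv (valEquations.get k).1 (valEquations.get k).2,
      C.Holds P fun i => [a, x, y, z, w].getD i 0 := fun C hC =>
    h C (List.mem_flatMap.mpr ⟨_, List.get_mem valEquations k, hC⟩) [x, y, z, w]
  simp only [CodeClause.eqv, List.forall_mem_cons] at h1
  exact ⟨h1.1, h1.2.1⟩

theorem Good.tarski {I : Type u} (e : I → ℕ) (hF : Good fixedSchemes P a)
    (hV : Good (valEquations.flatMap fun p => CodeClause.eqv p.1 p.2) P a)
    (hS : Good satSchemes P a) :
    (codeData P).Tarski e (fun i => Nat.pair 8 (e i)) (fun t r => Nat.pair 11 (Nat.pair t r))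
      (fun l r x => Nat.pair 14 (Nat.pair l (Nat.pair r x)))
      (fun s l r => P (Nat.pair 4 (Nat.pair s (Nat.pair l r)))) where
  val_self l r x := hV.eqv 0 r l x 0
  val_lt i l r x h := by
    obtain ⟨z, rfl⟩ := Nat.exists_eq_add_of_lt h
    exact hV.eqv 1 r i x z
  val_func f ts r := by
    cases f with
    | bot => exact hV.eqv 2 r 0 0 0
    | top => exact hV.eqv 3 r 0 0 0
    | compl => exact hV.eqv 4 r (ts 0) 0 0
    | sup => exact hV.eqv 5 r (ts 0) (ts 1) 0
    | inf => exact hV.eqv 6 r (ts 0) (ts 1) 0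
    | c i => exact hV.eqv 7 r (ts 0) 0 (e i)
    | d i j => exact hV.eqv 8 r (e i) (e j) 0
  sat_falsum l r := hS.get (0 : Fin 10) l r 0 0
  sat_equal s t l r := ⟨fun h => ⟨hS.get (1 : Fin 10) l r s t h, hS.get (2 : Fin 10) l r s t h⟩,
    fun h => hS.get (3 : Fin 10) l r s t h.1 h.2⟩
  sat_imp φ ψ l r := by
    refine ⟨hS.get (4 : Fin 10) l r φ ψ, fun h => ?_⟩
    rcases hS.get (5 : Fin 10) l r φ ψ with h1 | h1
    · exact h1
    · exact hS.get (6 : Fin 10) l r φ ψ (h h1)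
  sat_all φ l r := by
    refine ⟨fun h x hx => hS.get (7 : Fin 10) l r φ x h ((hF.fixed_iff x).mpr hx), fun h => ?_⟩
    rcases hS.get (8 : Fin 10) l r φ 0 with h1 | h1
    · exact h1
    · exact hS.get (9 : Fin 10) l r φ 0 (h _ ((hF.fixed_iff _).mp h1))

theorem Good.kept (h : Good dimSchemes P a) {x : ℕ} (hx : P (Nat.pair 7 x)) :
    ¬ (codeData P).jp (Nat.pair 8 x) := h.get (0 : Fin 4) x 0 0 0 hx

/-- The schemes cannot state `x ≠ y`. Instead they range over the pairs `x`, `above x z`, which are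
all pairs `x < y`. -/
theorem Good.kept_injective (h : Good dimSchemes P a) (hp : (codeData P).IsPrecylindric)
    {x y : ℕ} (hx : P (Nat.pair 7 x)) (hy : P (Nat.pair 7 y))
    (hxy : (codeData P).ed (Nat.pair 8 x) (Nat.pair 8 y)) : x = y := by
  by_contra hne
  rcases lt_or_gt_of_ne hne with h1 | h1 <;> obtain ⟨z, rfl⟩ := Nat.exists_eq_add_of_lt h1
  · exact h.get (1 : Fin 4) _ z 0 0 hx hy hxy
  · exact h.get (1 : Fin 4) _ z 0 0 hy hx (hp.ed_symm hxy)

theorem Good.removed (h : Good dimSchemes P a) {x : ℕ} (hx : P (Nat.pair 8 x)) :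
    (codeData P).jp (Nat.pair 9 x) := h.get (2 : Fin 4) x 0 0 0 hx

theorem Good.removed_injective (h : Good dimSchemes P a) (hp : (codeData P).IsPrecylindric)
    {x y : ℕ} (hx : P (Nat.pair 8 x)) (hy : P (Nat.pair 8 y))
    (hxy : (codeData P).ed (Nat.pair 9 x) (Nat.pair 9 y)) : x = y := by
  by_contra hne
  rcases lt_or_gt_of_ne hne with h1 | h1 <;> obtain ⟨z, rfl⟩ := Nat.exists_eq_add_of_lt h1
  · exact h.get (3 : Fin 4) _ z 0 0 hx hy hxy
  · exact h.get (3 : Fin 4) _ z 0 0 hy hx (hp.ed_symm hxy)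

theorem Good.valid_term {I : Type u} {e : I → ℕ} (h : Good validSchemes P a)
    (he : ∀ i, P (Nat.pair 7 (e i))) {l : ℕ} (t : (caLanguage I).Term (Empty ⊕ Fin l)) :
    P (Nat.pair 5 (Nat.pair l (caTermCode e (Sum.elim Empty.elim Fin.val) t))) := by
  induction t with
  | var x =>
    rcases x with x | i
    · exact x.elim
    · obtain ⟨y, hy⟩ := Nat.exists_eq_add_of_lt i.2
      have h1 : P (Nat.pair 5 (Nat.pair (i + y + 1) (Nat.pair 0 i))) :=
        h.get (0 : Fin 13) 0 i y 0
      rwa [← hy] at h1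
  | func f ts ih =>
    cases f with
    | bot => exact h.get (1 : Fin 13) l 0 0 0
    | top => exact h.get (2 : Fin 13) l 0 0 0
    | compl => exact h.get (3 : Fin 13) l _ 0 0 (ih 0)
    | sup => exact h.get (4 : Fin 13) l _ _ 0 (ih 0) (ih 1)
    | inf => exact h.get (5 : Fin 13) l _ _ 0 (ih 0) (ih 1)
    | c i => exact h.get (6 : Fin 13) l _ 0 (e i) (he i) (ih 0)
    | d i j => exact h.get (7 : Fin 13) l (e i) (e j) 0 (he i) (he j)

/-- The schemes force `vf` on genuine codes only. So the last scheme demands the falsity of `a` if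
`a` codes a sentence, and can be satisfied vacuously otherwise. -/
theorem Good.valid_formula {I : Type u} {e : I → ℕ} (h : Good validSchemes P a)
    (he : ∀ i, P (Nat.pair 7 (e i))) {l : ℕ} (φ : (caLanguage I).BoundedFormula Empty l) :
    P (Nat.pair 6 (Nat.pair l (caFormulaCode e φ))) := by
  induction φ with
  | @falsum l => exact h.get (8 : Fin 13) l 0 0 0
  | @equal l t t' => exact h.get (9 : Fin 13) l _ _ 0 (h.valid_term he t) (h.valid_term he t')
  | rel r ts => exact Empty.elim r
  | @imp l φ ψ hφ hψ => exact h.get (10 : Fin 13) l _ _ 0 hφ hψ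
  | @all l φ ih => exact h.get (11 : Fin 13) l _ 0 0 ih

theorem Good.not_sat (h : Good validSchemes P a) (ha : P (Nat.pair 6 (Nat.pair 0 a))) :
    ¬ P (Nat.pair 4 (Nat.pair a (Nat.pair 0 0))) := h.get (12 : Fin 13) 0 0 0 0 ha

end CodeClause

/-! ### Models of the schemes are countermodels -/

namespace CylData

variable {X : Type w} (M : CylData X)

/-- The data lifted to another universe. -/
def ulift : CylData (ULift.{u} X) where
  le x y := M.le x.down y.down
  ed x y := M.ed x.down y.down
  jp x := M.jp x.down
  bot := ⟨M.bot⟩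
  top := ⟨M.top⟩
  compl x := ⟨M.compl x.down⟩
  sup x y := ⟨M.sup x.down y.down⟩
  inf x y := ⟨M.inf x.down y.down⟩
  c x y := ⟨M.c x.down y.down⟩
  d x y := ⟨M.d x.down y.down⟩

theorem IsPrecylindric.ulift {M : CylData X} (h : M.IsPrecylindric) :
    (CylData.ulift.{u} M).IsPrecylindric := by
  have h1 : (CylData.ulift.{u} M).Interprets (fun x => h.elem x.down) (fun x => h.dim x.down)
      h.Removed := by
    constructor <;> intros
    · exact h.interprets.le _ _
    · exact h.interprets.ed _ _
    · exact h.interprets.jp _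
    all_goals rfl
  exact h1.isPrecylindric

theorem Presents.of_ulift {M : CylData X} {I : Type v} {k : I → X} (h : M.IsPrecylindric)
    {A : Type*} [(caLanguage I).Structure A] {emb : A → ULift.{u} X}
    (P : (CylData.ulift.{u} M).Presents (fun i => ⟨k i⟩) A emb) :
    M.Presents k A fun x => (emb x).down where
  pre := h
  kept_injective := P.kept_injective
  kept := P.kept
  hom f x := by
    have h1 := P.hom f x
    cases f <;> exact h1
  injective := P.injective
  fixed x j hj := P.fixed x ⟨j⟩ hj
  surjective y hy := P.surjective ⟨y⟩ fun j hj => hy j.down hj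

end CylData

namespace CodeClause

/-- The true atomic statements are precylindric data on `ℕ`. They present an algebra in which the
sentence fails, by the Tarski conditions. If there is not a constant for each removed dimension,
there are infinitely many constants, and an ultrapower provides enough dimensions without changing
the truth of sentences. -/
theorem Good.exists_countermodel {n m : Ordinal.{u}} {h : n ≤ m} {e : n.ToType → ℕ}
    (he : Function.Injective e) {P : ℕ → Prop} (hk : ∀ i, P (Nat.pair 7 (e i)))
    (hr : (∃ g : RemovedDim h → ℕ, Function.Injective g ∧ ∀ r, P (Nat.pair 8 (g r))) ∨
      ∀ j, P (Nat.pair 8 j))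
    {φ : (caLanguage n.ToType).Sentence} (hP : Good schemes P (caFormulaCode e φ)) :
    ∃ (A : Type u) (S : (caLanguage n.ToType).Structure A), NrCA h A S ∧ ¬ A ⊨ φ := by
  simp only [schemes, good_append] at hP
  obtain ⟨hC, hF, hD, hV, hS, hL⟩ := hP
  have pre := hC.isPrecylindric
  obtain ⟨A, SA, emb, Q⟩ := pre.ulift.exists_presents (I := n.ToType)
    (k := fun i => (⟨Nat.pair 8 (e i)⟩ : ULift.{u} ℕ))
    (fun i j hij => he (hD.kept_injective pre (hk i) (hk j) hij)) fun i => hD.kept (hk i)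
  have hA : ¬ A ⊨ φ := by
    rw [← (Good.tarski e hF hV hS).sat_sentence (CylData.Presents.of_ulift pre Q) φ (0 : ℕ)]
    exact hL.not_sat (hL.valid_formula hk φ)
  rcases hr with ⟨g, hg, hg'⟩ | hr
  · exact ⟨A, SA, Q.nrCA (h := h) (fun r => ⟨Nat.pair 9 (g r)⟩) (fun r => hD.removed (hg' r))
      fun r s hrs => hg (hD.removed_injective pre (hg' r) (hg' s) hrs), hA⟩
  · obtain ⟨U, o, ho, ho'⟩ := CylData.exists_ultrafilter_removed (codeData P).ulift (RemovedDim h)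
      (fun j => (⟨Nat.pair 9 j⟩ : ULift.{u} ℕ)) (fun j => hD.removed (hr j))
      fun i j hij => hD.removed_injective pre (hr i) (hr j) hij
    have : Nonempty A :=
      ⟨FirstOrder.Language.Structure.funMap (L := caLanguage n.ToType) (n := 0) CAFunc.bot ![]⟩
    refine ⟨_, _, (Q.ultrapower U).nrCA (h := h) o ho ho', ?_⟩
    rw [FirstOrder.Language.Ultraproduct.sentence_realize]
    simpa using hA

end CodeClause

/-! ### Countermodels give models of the schemes -/

/-- Recursion on natural numbers that are read as pairs of a label and an argument, where the
values at numbers up to the argument are available. -/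
def labelRec {β : Type*} [Inhabited β] (G : (ℕ → β) → ℕ → ℕ → β) (n : ℕ) : β :=
  G (fun k => if _h : n.unpair.1 ≠ 0 ∧ k ≤ n.unpair.2 then labelRec G k else default)
    n.unpair.1 n.unpair.2
termination_by n
decreasing_by
  have h1 := Nat.pair_lt_pair_left n.unpair.2 (Nat.pos_of_ne_zero _h.1)
  rw [Nat.pair_unpair] at h1
  exact (_h.2.trans (Nat.right_le_pair _ _)).trans_lt h1

/-- Label `0` gets no recursive values: `Nat.pair 0 p` equals `p` for `p ≤ 1`, so the recursion
would not descend. -/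
theorem labelRec_pair {β : Type*} [Inhabited β] (G : (ℕ → β) → ℕ → ℕ → β) (s p : ℕ) :
    labelRec G (Nat.pair s p) =
      G (fun k => if s ≠ 0 ∧ k ≤ p then labelRec G k else default) s p := by
  rw [labelRec]
  simp

section Valuation

variable {B : Type u} {D : Type v} [CylindricAlgebra D B]

theorem ofAlgebra_eqv_iff {P : D → Prop} [Inhabited D] {x y : B × D} :
    (CylData.ofAlgebra D B P).Eqv x y ↔ x.1 = y.1 := le_antisymm_iff.symm

theorem fixed_iff_mem_neatReduct [Inhabited D] {I : Type*} (ι : I ↪ D) (x : B × D) :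
    (CylData.ofAlgebra D B (· ∉ Set.range ι)).Fixed x ↔ x.1 ∈ neatReduct ι B :=
  ⟨fun h j hj => le_antisymm (h (⊥, j) hj) (le_c _ _), fun h j hj => (h j.2 hj).le⟩

variable [Inhabited B]

/-- The value of a term given by its code, where `kd` gives the meaning of the codes of
dimensions. -/
noncomputable def termValue (kd : ℕ → D) : ℕ → (ℕ → B) → B :=
  labelRec fun rec s p ρ => match s with
    | 0 => ρ p
    | 1 => ⊥
    | 2 => ⊤
    | 3 => (rec (p - 1).unpair.1 ρ)ᶜ
    | 4 => rec (p - 1).unpair.1 ρ ⊔ rec ((p - 1).unpair.2 - 1).unpair.1 ρ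
    | 5 => rec (p - 1).unpair.1 ρ ⊓ rec ((p - 1).unpair.2 - 1).unpair.1 ρ
    | s + 6 =>
      if s % 2 = 0 then c (kd (s / 2)) (rec (p - 1).unpair.1 ρ)
      else d (kd (s / 2).unpair.1) (kd (s / 2).unpair.2)

/-- The satisfaction of a formula given by its code, where the quantifiers range over the elements
with the property `F`. -/
def formulaSat (kd : ℕ → D) (F : B → Prop) : ℕ → ℕ → (ℕ → B) → Prop :=
  labelRec fun rec s p l ρ => match s with
    | 0 => False
    | 1 => termValue kd p.unpair.1 ρ = termValue kd p.unpair.2 ρ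
    | 2 => rec p.unpair.1 l ρ → rec p.unpair.2 l ρ
    | 3 => ∀ x, F x → rec p (l + 1) (Function.update ρ l x)
    | _ => False

theorem termValue_func {I : Type w} {e : I → ℕ} {kd : ℕ → D} {ι : I → D}
    (hkd : ∀ i, kd (e i) = ι i) [Inhabited D] (P : D → Prop) {l : ℕ} (f : CAFunc I l)
    (ts : Fin l → ℕ) (ρ : ℕ → B) :
    termValue kd (Nat.pair (caFuncCode e f + 1) (Encodable.encode (List.ofFn ts))) ρ =
      ((CylData.ofAlgebra D B P).caOp (fun i => (⊥, ι i)) f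
        fun i => (termValue kd (ts i) ρ, default)).1 := by
  have h1 : ∀ x y : ℕ, x ≤ Nat.pair x y + 1 := fun x y =>
    (Nat.left_le_pair x y).trans (Nat.le_succ _)
  have h2 : ∀ x y z : ℕ, y ≤ Nat.pair x (Nat.pair y z + 1) + 1 := fun x y z =>
    (h1 y z).trans ((Nat.right_le_pair _ _).trans (Nat.le_succ _))
  -- Beyond `6`, the parity of the label tells cylindrifications from diagonal elements.
  have h3 : ∀ x, 5 + 2 * x + 1 = 2 * x + 6 := fun x => by lia
  have h4 : ∀ x, 6 + 2 * x + 1 = 2 * x + 1 + 6 := fun x => by lia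
  have h6 : ∀ x, (2 * x + 1) / 2 = x := fun x => by lia
  cases f with
  | bot => rw [termValue, labelRec_pair]; rfl
  | top => rw [termValue, labelRec_pair]; rfl
  | compl =>
    change termValue kd (Nat.pair 3 (Nat.pair (ts 0) 0 + 1)) ρ = (termValue kd (ts 0) ρ)ᶜ
    rw [termValue, labelRec_pair]
    simp [h1]
  | sup =>
    change termValue kd (Nat.pair 4 (Nat.pair (ts 0) (Nat.pair (ts 1) 0 + 1) + 1)) ρ =
      termValue kd (ts 0) ρ ⊔ termValue kd (ts 1) ρ
    rw [termValue, labelRec_pair]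
    simp [h1, h2]
  | inf =>
    change termValue kd (Nat.pair 5 (Nat.pair (ts 0) (Nat.pair (ts 1) 0 + 1) + 1)) ρ =
      termValue kd (ts 0) ρ ⊓ termValue kd (ts 1) ρ
    rw [termValue, labelRec_pair]
    simp [h1, h2]
  | c i =>
    change termValue kd (Nat.pair (5 + 2 * e i + 1) (Nat.pair (ts 0) 0 + 1)) ρ =
      c (ι i) (termValue kd (ts 0) ρ)
    rw [termValue, labelRec_pair, h3]
    simp [h1, hkd]
  | d i j =>
    change termValue kd (Nat.pair (6 + 2 * Nat.pair (e i) (e j) + 1) 0) ρ = d (ι i) (ι j)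
    rw [termValue, labelRec_pair, h4]
    simp [h6, hkd]

theorem termValue_var (kd : ℕ → D) (i : ℕ) (ρ : ℕ → B) :
    termValue kd (Nat.pair 0 i) ρ = ρ i := by
  rw [termValue, labelRec_pair]

theorem formulaSat_falsum (kd : ℕ → D) (F : B → Prop) (l : ℕ) (ρ : ℕ → B) :
    ¬ formulaSat kd F (Nat.pair 0 0) l ρ := by
  rw [formulaSat, labelRec_pair]
  exact id

theorem formulaSat_equal (kd : ℕ → D) (F : B → Prop) (s t l : ℕ) (ρ : ℕ → B) :
    formulaSat kd F (Nat.pair 1 (Nat.pair s t)) l ρ ↔ termValue kd s ρ = termValue kd t ρ := by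
  rw [formulaSat, labelRec_pair]
  simp

theorem formulaSat_imp (kd : ℕ → D) (F : B → Prop) (s t l : ℕ) (ρ : ℕ → B) :
    formulaSat kd F (Nat.pair 2 (Nat.pair s t)) l ρ ↔
      (formulaSat kd F s l ρ → formulaSat kd F t l ρ) := by
  rw [formulaSat, labelRec_pair]
  simp [Nat.left_le_pair, Nat.right_le_pair]

theorem formulaSat_all (kd : ℕ → D) (F : B → Prop) (s l : ℕ) (ρ : ℕ → B) :
    formulaSat kd F (Nat.pair 3 s) l ρ ↔
      ∀ x, F x → formulaSat kd F s (l + 1) (Function.update ρ l x) := by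
  rw [formulaSat, labelRec_pair]
  simp

variable {I : Type u} [Inhabited D] (ι : I ↪ D)

theorem tarski_formulaSat {e : I → ℕ} {kd : ℕ → D} (hkd : ∀ i, kd (e i) = ι i) :
    (CylData.ofAlgebra D B (· ∉ Set.range ι)).Tarski e (fun i => (⊥, ι i))
      (fun t ρ => (termValue kd t ρ, default)) (fun l ρ x => Function.update ρ l x.1)
      (formulaSat kd (· ∈ neatReduct ι B)) where
  val_self l ρ x := by
    rw [ofAlgebra_eqv_iff, termValue_var, Function.update_self]
  val_lt i l ρ x h := by
    rw [ofAlgebra_eqv_iff, termValue_var, termValue_var, Function.update_of_ne h.ne]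
  val_func f ts ρ := ofAlgebra_eqv_iff.mpr (termValue_func hkd _ f ts ρ)
  sat_falsum := formulaSat_falsum _ _
  sat_equal s t l ρ := by rw [ofAlgebra_eqv_iff, formulaSat_equal]
  sat_imp := formulaSat_imp _ _
  sat_all s l ρ := by
    simp only [formulaSat_all, fixed_iff_mem_neatReduct]
    exact ⟨fun h x hx => h x.1 hx, fun h x hx => h (x, default) hx⟩

open Classical in
/-- The elements, dimensions and assignments given by codes. -/
noncomputable def codeValue (kd rd : ℕ → D) : ℕ → B × D × (ℕ → B) :=
  labelRec fun rec s p => match s with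
    | 1 => (⊥, default)
    | 2 => (⊤, default)
    | 3 => ((rec p).1ᶜ, default)
    | 4 => ((rec p.unpair.1).1 ⊔ (rec p.unpair.2).1, default)
    | 5 => ((rec p.unpair.1).1 ⊓ (rec p.unpair.2).1, default)
    | 6 => (c (rec p.unpair.1).2.1 (rec p.unpair.2).1, default)
    | 7 => (d (rec p.unpair.1).2.1 (rec p.unpair.2).2.1, default)
    | 8 => (⊥, kd p, default)
    | 9 => (⊥, rd p, default)
    | 10 => (⊥, Classical.epsilon fun j => j ∉ Set.range ι ∧ c j (rec p).1 ≠ (rec p).1, default)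
    | 11 => (termValue kd p.unpair.1 (rec p.unpair.2).2.2, default)
    | 12 => (Classical.epsilon fun x => x ∈ neatReduct ι B ∧
        ¬ formulaSat kd (· ∈ neatReduct ι B) p.unpair.1 (p.unpair.2.unpair.1 + 1)
          (Function.update (rec p.unpair.2.unpair.2).2.2 p.unpair.2.unpair.1 x), default)
    | 14 => (⊥, default, Function.update (rec p.unpair.2.unpair.1).2.2 p.unpair.1
        (rec p.unpair.2.unpair.2).1)
    | _ => default

/-- The truth of an atomic statement given by its code. -/
def codeTruth (P₀ P₁ : ℕ → ℕ → Prop) (P₂ P₃ : ℕ → Prop) (P₄ : ℕ → ℕ → ℕ → Prop)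
    (P₅ P₆ : ℕ → ℕ → Prop) (P₇ P₈ : ℕ → Prop) (n : ℕ) : Prop :=
  match n.unpair.1, n.unpair.2 with
  | 0, p => P₀ p.unpair.1 p.unpair.2
  | 1, p => P₁ p.unpair.1 p.unpair.2
  | 2, p => P₂ p
  | 3, p => P₃ p
  | 4, p => P₄ p.unpair.1 p.unpair.2.unpair.1 p.unpair.2.unpair.2
  | 5, p => P₅ p.unpair.1 p.unpair.2
  | 6, p => P₆ p.unpair.1 p.unpair.2
  | 7, p => P₇ p
  | 8, p => P₈ p
  | _, _ => False

namespace CodeClause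

open CodeTerm

theorem good_of_forall {T : List CodeClause} {P : ℕ → Prop} {a : ℕ}
    (h : ∀ C ∈ T, ∀ ε : ℕ → ℕ, ε 0 = a → C.Holds P ε) : Good T P a :=
  fun C hC _ => h C hC _ rfl

/-- All codes are interpreted in the algebra: Skolem terms by choice, `vt` and `vf` by the genuine
codes. Each scheme then states a fact about the algebra, and only the last one, which says that `a`
is false, depends on `ha`. -/
theorem exists_good {e : I → ℕ} (he : Function.Injective e) (O : ℕ → Prop) (rd : ℕ → D)
    (hrd : ∀ j, O j → rd j ∉ Set.range ι) (rd_injective : ∀ i j, O i → O j → rd i = rd j → i = j)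
    (a : ℕ) (ha : ∀ φ : (caLanguage I).Sentence, caFormulaCode e φ = a → ¬ neatReduct ι B ⊨ φ) :
    ∃ P : ℕ → Prop, (∀ x, P (Nat.pair 7 x) ↔ x ∈ Set.range e) ∧ (∀ x, P (Nat.pair 8 x) ↔ O x) ∧
      Good schemes P a := by
  let kd : ℕ → D := Function.extend e ι default
  have hkd : ∀ i, kd (e i) = ι i := he.extend_apply ι default
  let V : ℕ → B × D × (ℕ → B) := codeValue ι kd rd
  let VT : ℕ → ℕ → Prop := fun l s => ∃ t : (caLanguage I).Term (Empty ⊕ Fin l),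
    caTermCode e (Sum.elim Empty.elim Fin.val) t = s
  let VF : ℕ → ℕ → Prop := fun l s => ∃ φ : (caLanguage I).BoundedFormula Empty l,
    caFormulaCode e φ = s
  let P : ℕ → Prop := codeTruth (fun x y => (V x).1 ≤ (V y).1) (fun x y => (V x).2.1 = (V y).2.1)
    (fun x => (V x).2.1 ∉ Set.range ι) (fun x => (V x).1 ∈ neatReduct ι B)
    (fun s l r => formulaSat kd (· ∈ neatReduct ι B) s l (V r).2.2)
    VT VF (fun x => x ∈ Set.range e) O
  have v1 : V (Nat.pair 1 0) = (⊥, default) := by simp [V, codeValue, labelRec_pair]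
  have v2 : V (Nat.pair 2 0) = (⊤, default) := by simp [V, codeValue, labelRec_pair]
  have v3 : ∀ x, V (Nat.pair 3 x) = ((V x).1ᶜ, default) := by
    simp [V, codeValue, labelRec_pair]
  have v4 : ∀ x y, V (Nat.pair 4 (Nat.pair x y)) = ((V x).1 ⊔ (V y).1, default) := by
    simp [V, codeValue, labelRec_pair, Nat.left_le_pair, Nat.right_le_pair]
  have v5 : ∀ x y, V (Nat.pair 5 (Nat.pair x y)) = ((V x).1 ⊓ (V y).1, default) := by
    simp [V, codeValue, labelRec_pair, Nat.left_le_pair, Nat.right_le_pair]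
  have v6 : ∀ x y, V (Nat.pair 6 (Nat.pair x y)) = (c (V x).2.1 (V y).1, default) := by
    simp [V, codeValue, labelRec_pair, Nat.left_le_pair, Nat.right_le_pair]
  have v7 : ∀ x y, V (Nat.pair 7 (Nat.pair x y)) = (d (V x).2.1 (V y).2.1, default) := by
    simp [V, codeValue, labelRec_pair, Nat.left_le_pair, Nat.right_le_pair]
  have v8 : ∀ x, V (Nat.pair 8 x) = (⊥, kd x, default) := by
    simp [V, codeValue, labelRec_pair]
  have v9 : ∀ x, V (Nat.pair 9 x) = (⊥, rd x, default) := by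
    simp [V, codeValue, labelRec_pair]
  have v10 : ∀ x, V (Nat.pair 10 x) =
      (⊥, Classical.epsilon fun j => j ∉ Set.range ι ∧ c j (V x).1 ≠ (V x).1, default) := by
    simp [V, codeValue, labelRec_pair]
  have v11 : ∀ s r, V (Nat.pair 11 (Nat.pair s r)) = (termValue kd s (V r).2.2, default) := by
    simp [V, codeValue, labelRec_pair, Nat.right_le_pair]
  have h12 : ∀ s l r : ℕ, r ≤ Nat.pair s (Nat.pair l r) := fun s l r =>
    (Nat.right_le_pair l r).trans (Nat.right_le_pair s _)
  have h14 : ∀ s l r : ℕ, l ≤ Nat.pair s (Nat.pair l r) := fun s l r =>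
    (Nat.left_le_pair l r).trans (Nat.right_le_pair s _)
  have v12 : ∀ s l r, V (Nat.pair 12 (Nat.pair s (Nat.pair l r))) =
      (Classical.epsilon fun x => x ∈ neatReduct ι B ∧
        ¬ formulaSat kd (· ∈ neatReduct ι B) s (l + 1) (Function.update (V r).2.2 l x),
        default) := by
    simp [V, codeValue, labelRec_pair, h12]
  have v14 : ∀ l r x, V (Nat.pair 14 (Nat.pair l (Nat.pair r x))) =
      (⊥, default, Function.update (V r).2.2 l (V x).1) := by
    simp [V, codeValue, labelRec_pair, h12, h14]
  have p0 : ∀ x y, P (Nat.pair 0 (Nat.pair x y)) ↔ (V x).1 ≤ (V y).1 := by simp [P, codeTruth]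
  have p1 : ∀ x y, P (Nat.pair 1 (Nat.pair x y)) ↔ (V x).2.1 = (V y).2.1 := by
    simp [P, codeTruth]
  have p2 : ∀ x, P (Nat.pair 2 x) ↔ (V x).2.1 ∉ Set.range ι := by simp [P, codeTruth]
  have p3 : ∀ x, P (Nat.pair 3 x) ↔ (V x).1 ∈ neatReduct ι B := by simp [P, codeTruth]
  have p4 : ∀ s l r, P (Nat.pair 4 (Nat.pair s (Nat.pair l r))) ↔
      formulaSat kd (· ∈ neatReduct ι B) s l (V r).2.2 := by simp [P, codeTruth]
  have p5 : ∀ l s, P (Nat.pair 5 (Nat.pair l s)) ↔ VT l s := by simp [P, codeTruth]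
  have p6 : ∀ l s, P (Nat.pair 6 (Nat.pair l s)) ↔ VF l s := by simp [P, codeTruth]
  have p7 : ∀ x, P (Nat.pair 7 x) ↔ x ∈ Set.range e := by simp [P, codeTruth]
  have p8 : ∀ x, P (Nat.pair 8 x) ↔ O x := by simp [P, codeTruth]
  have T := tarski_formulaSat (B := B) ι hkd
  refine ⟨P, p7, p8, ?_⟩
  simp only [schemes, good_append]
  refine ⟨?_, ?_, ?_, ?_, ?_, ?_⟩
  · have h1 : (codeData P).Interprets (fun x => (V x).1) (fun x => (V x).2.1)
        (· ∉ Set.range ι) := by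
      refine ⟨p0, p1, p2, ?_, ?_, ?_, ?_, ?_, ?_, ?_⟩ <;> intros <;>
        simp only [codeData, v1, v2, v3, v4, v5, v6, v7]
    refine good_of_forall fun C hC ε _ => ?_
    obtain ⟨cl, hcl, rfl⟩ := List.mem_map.mp hC
    rw [holds_ofClause]
    exact h1.isPrecylindric cl hcl _
  · refine good_of_forall ?_
    simp only [fixedSchemes, List.forall_mem_cons, List.not_mem_nil, false_imp_iff,
      implies_true, and_true, Holds, HoldsImp, HoldsSome, CodeTerm.eval, le, jp,
      fx, CodeTerm.c, witDim, p0, p2, p3, v6, v10]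
    have key : ∀ b : B, b ∉ neatReduct ι B → (Classical.epsilon fun j =>
        j ∉ Set.range ι ∧ CylindricAlgebra.c j b ≠ b) ∉ Set.range ι ∧ CylindricAlgebra.c
          (Classical.epsilon fun j => j ∉ Set.range ι ∧ CylindricAlgebra.c j b ≠ b) b ≠ b := by
      intro b hb
      refine Classical.epsilon_spec (p := fun j => j ∉ Set.range ι ∧ CylindricAlgebra.c j b ≠ b) ?_
      by_contra h
      push Not at h
      exact hb h
    refine ⟨fun ε _ h hj => (h _ hj).le, fun ε _ => ?_, fun ε _ h => ?_⟩
    · exact or_iff_not_imp_left.mpr fun h => (key _ h).1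
    · by_contra hb
      exact (key _ hb).2 (le_antisymm h (le_c _ _))
  · refine good_of_forall ?_
    simp only [dimSchemes, List.forall_mem_cons, List.not_mem_nil, false_imp_iff,
      implies_true, and_true, Holds, HoldsImp, HoldsSome, CodeTerm.eval, kept, jp,
      keptDim, ed, above, rem, remDim, p1, p2, p7, p8, v8, v9]
    refine ⟨?_, ?_, fun ε _ h => hrd _ h, fun ε _ h1 h2 h => ?_⟩
    · rintro ε - ⟨i, hi⟩ h
      exact h ⟨i, by rw [← hi, hkd]⟩
    · rintro ε - ⟨i, hi⟩ ⟨j, hj⟩ h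
      rw [← hj, ← hi, hkd, hkd] at h
      have h1 := congrArg e (ι.injective h)
      lia
    · have h3 := rd_injective _ _ h1 h2 h
      lia
  · refine good_of_forall ?_
    simp only [valEquations, List.flatMap_cons, List.flatMap_nil, eqv, List.forall_mem_append,
      List.forall_mem_cons, List.not_mem_nil, false_imp_iff,
      implies_true, and_true, Holds, HoldsImp, HoldsSome, CodeTerm.eval, val, upd, above, le,
      list₁, list₂, symC, symD, keptDim, p0, v1, v2, v3, v4, v5, v6, v7, v8, v11, v14]
    -- The equations are required for all numbers, not only for codes of dimensions. Hence the
    -- evaluation lemma is used with `ℕ` as the set of dimensions, coded by `id`.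
    have tv : ∀ {l : ℕ} (f : CAFunc ℕ l) (ts : Fin l → ℕ) (ρ : ℕ → B), _ :=
      termValue_func (B := B) (e := (id : ℕ → ℕ)) (kd := kd) (fun _ => rfl) fun _ => True
    have hne : ∀ x y : ℕ, x ≠ x + y + 1 := fun x y => by lia
    have t1 : ∀ ρ : ℕ → B, termValue kd (Nat.pair 1 0) ρ = ⊥ := tv .bot ![]
    have t2 : ∀ ρ : ℕ → B, termValue kd (Nat.pair 2 0) ρ = ⊤ := tv .top ![]
    have t3 : ∀ x (ρ : ℕ → B), termValue kd (Nat.pair 3 (Nat.pair x 0 + 1)) ρ =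
      (termValue kd x ρ)ᶜ := fun x => tv .compl ![x]
    have t4 : ∀ x y (ρ : ℕ → B), termValue kd (Nat.pair 4 (Nat.pair x (Nat.pair y 0 + 1) + 1)) ρ =
      termValue kd x ρ ⊔ termValue kd y ρ := fun x y => tv .sup ![x, y]
    have t5 : ∀ x y (ρ : ℕ → B), termValue kd (Nat.pair 5 (Nat.pair x (Nat.pair y 0 + 1) + 1)) ρ =
      termValue kd x ρ ⊓ termValue kd y ρ := fun x y => tv .inf ![x, y]
    have t6 : ∀ x y (ρ : ℕ → B), termValue kd (Nat.pair (5 + 2 * y + 1) (Nat.pair x 0 + 1)) ρ =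
      CylindricAlgebra.c (kd y) (termValue kd x ρ) := fun x y => tv (.c y) ![x]
    have t7 : ∀ x y (ρ : ℕ → B), termValue kd (Nat.pair (6 + 2 * Nat.pair x y + 1) 0) ρ =
      d (kd x) (kd y) := fun x y => tv (.d x y) ![]
    simp only [termValue_var, Function.update_self, Function.update_of_ne (hne _ _), t1, t2, t3, t4,
      t5, t6, t7, le_refl, implies_true, and_true]
  · refine good_of_forall ?_
    simp only [satSchemes, List.forall_mem_cons, List.not_mem_nil, false_imp_iff,
      implies_true, and_true, Holds, HoldsImp, HoldsSome, CodeTerm.eval, sat, val,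
      upd, le, fx, wit, p0, p3, p4, v11, v12, v14]
    have key : ∀ (s l : ℕ) (ρ : ℕ → B),
        ¬ formulaSat kd (· ∈ neatReduct ι B) (Nat.pair 3 s) l ρ →
        (Classical.epsilon fun x => x ∈ neatReduct ι B ∧ ¬ formulaSat kd (· ∈ neatReduct ι B) s
          (l + 1) (Function.update ρ l x)) ∈ neatReduct ι B ∧
        ¬ formulaSat kd (· ∈ neatReduct ι B) s (l + 1) (Function.update ρ l
          (Classical.epsilon fun x => x ∈ neatReduct ι B ∧ ¬ formulaSat kd (· ∈ neatReduct ι B) s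
            (l + 1) (Function.update ρ l x))) := by
      intro s l ρ h
      refine Classical.epsilon_spec (p := fun x => x ∈ neatReduct ι B ∧
        ¬ formulaSat kd (· ∈ neatReduct ι B) s (l + 1) (Function.update ρ l x)) ?_
      rw [formulaSat_all] at h
      push Not at h
      exact h
    refine ⟨fun ε _ => formulaSat_falsum _ _ _ _, fun ε _ h => ?_, fun ε _ h => ?_,
      fun ε _ h1 h2 => ?_, fun ε _ => (formulaSat_imp _ _ _ _ _ _).mp, fun ε _ => ?_,
      fun ε _ h => (formulaSat_imp _ _ _ _ _ _).mpr fun _ => h, fun ε _ h hx => ?_, fun ε _ => ?_,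
      fun ε _ h => ?_⟩
    · exact ((formulaSat_equal _ _ _ _ _ _).mp h).le
    · exact ((formulaSat_equal _ _ _ _ _ _).mp h).ge
    · exact (formulaSat_equal _ _ _ _ _ _).mpr (le_antisymm h1 h2)
    · exact or_iff_not_imp_right.mpr fun h =>
        (formulaSat_imp _ _ _ _ _ _).mpr fun h1 => absurd h1 h
    · exact (formulaSat_all _ _ _ _ _).mp h _ hx
    · exact or_iff_not_imp_left.mpr fun h => (key _ _ _ h).1
    · by_contra h1
      exact (key _ _ _ h1).2 h
  · refine good_of_forall ?_
    simp only [validSchemes, List.forall_mem_cons, List.not_mem_nil, false_imp_iff,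
      implies_true, and_true, Holds, HoldsImp, HoldsSome, CodeTerm.eval, sat,
      vt, vf, above, list₁, list₂, symC, symD, kept, p4, p5, p6, p7]
    let app := fun {k l : ℕ} (f : CAFunc I k) (ts : Fin k → (caLanguage I).Term (Empty ⊕ Fin l)) =>
      FirstOrder.Language.Term.func (L := caLanguage I) f ts
    refine ⟨fun ε _ => ?_, fun ε _ => ⟨app .bot ![], rfl⟩, fun ε _ => ⟨app .top ![], rfl⟩,
      ?_, ?_, ?_, ?_, ?_, fun ε _ => ⟨.falsum, rfl⟩, ?_, ?_, ?_, ?_⟩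
    · exact ⟨.var (Sum.inr ⟨ε 2, by lia⟩), rfl⟩
    · rintro ε - ⟨t, ht⟩
      rw [← ht]
      exact ⟨app .compl ![t], rfl⟩
    · rintro ε - ⟨t, ht⟩ ⟨t', ht'⟩
      rw [← ht, ← ht']
      exact ⟨app .sup ![t, t'], rfl⟩
    · rintro ε - ⟨t, ht⟩ ⟨t', ht'⟩
      rw [← ht, ← ht']
      exact ⟨app .inf ![t, t'], rfl⟩
    · rintro ε - ⟨i, hi⟩ ⟨t, ht⟩
      rw [← hi, ← ht]
      exact ⟨app (.c i) ![t], rfl⟩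
    · rintro ε - ⟨i, hi⟩ ⟨j, hj⟩
      rw [← hi, ← hj]
      exact ⟨app (.d i j) ![], rfl⟩
    · rintro ε - ⟨t, ht⟩ ⟨t', ht'⟩
      rw [← ht, ← ht']
      exact ⟨.equal t t', rfl⟩
    · rintro ε - ⟨φ, hφ⟩ ⟨ψ, hψ⟩
      rw [← hφ, ← hψ]
      exact ⟨.imp φ ψ, rfl⟩
    · rintro ε - ⟨φ, hφ⟩
      rw [← hφ]
      exact ⟨.all φ, rfl⟩
    · rintro ε hε ⟨φ, hφ⟩ h
      rw [hε] at hφ h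
      refine ha φ hφ ?_
      rw [← hφ] at h
      exact (T.sat_sentence (CylData.ofAlgebra_presents ι
        (FirstOrder.Language.Equiv.refl (caLanguage I) (neatReduct ι B))) φ _).mp h

end CodeClause

end Valuation

/-! ### Recursive enumerability and the main theorem -/

theorem StructureClass.theory_elementaryClosure {L : FirstOrder.Language.{v, w}}
    (K : StructureClass.{u} L) : K.elementaryClosure.theory = K.theory := by
  ext φ
  refine ⟨fun h A S hA => h A S (K.le_elementaryClosure hA), fun h A S hA => ?_⟩
  exact hA.realize_of_mem φ h

/-- A decidable set of natural numbers that can be used to number a set, or an infinite part of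
it. -/
theorem exists_computable_numbering (α : Type u) :
    ∃ O : ℕ → Prop, ComputablePred O ∧
      (∃ f : ∀ j, O j → α, ∀ i j hi hj, f i hi = f j hj → i = j) ∧
      ((∃ g : α → ℕ, Function.Injective g ∧ ∀ r, O (g r)) ∨ ∀ j, O j) := by
  rcases finite_or_infinite α with hα | hα
  · let g := Finite.equivFin α
    refine ⟨fun j => j < Nat.card α, ?_, ⟨fun j hj => g.symm ⟨j, hj⟩, ?_⟩,
      Or.inl ⟨fun r => (g r).1, fun r s h => g.injective (Fin.ext h), fun r => (g r).2⟩⟩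
    · have h := (Primrec.nat_lt.comp Primrec.id (Primrec.const (Nat.card α))).decide.to_comp
      exact ⟨inferInstance, h⟩
    · intro i j hi hj h
      simpa using g.symm.injective h
  · refine ⟨fun _ => True, ⟨inferInstance, Computable.const true⟩,
      ⟨fun j _ => Infinite.natEmbedding α j, ?_⟩, Or.inr fun _ => trivial⟩
    exact fun i j _ _ h => (Infinite.natEmbedding α).injective h

/-- Sentences with the same code are true in the same neat reducts. -/
theorem realize_iff_of_caFormulaCode_eq {I D B : Type u} [CylindricAlgebra D B] [Inhabited D]
    (ι : I ↪ D) {e : I → ℕ} (he : Function.Injective e) {φ ψ : (caLanguage I).Sentence}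
    (h : caFormulaCode e φ = caFormulaCode e ψ) : neatReduct ι B ⊨ φ ↔ neatReduct ι B ⊨ ψ := by
  let : Inhabited B := ⟨⊥⟩
  have T := tarski_formulaSat (B := B) ι (he.extend_apply ι default)
  have P := CylData.ofAlgebra_presents ι
    (FirstOrder.Language.Equiv.refl (caLanguage I) (neatReduct ι B))
  -- Satisfaction is computed from the code alone, so injectivity of the Gödel numbering is not
  -- needed.
  rw [← T.sat_sentence P φ default, ← T.sat_sentence P ψ default, h]

/-- Serves for numbers that code no sentence: their clauses must be satisfiable too, and any algebra
will do. -/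
instance (I : Type v) : CylindricAlgebra I PUnit.{u + 1} where
  c _ x := x
  d _ _ := ⊤
  c_bot _ := rfl
  le_c _ _ := le_rfl
  c_inf_c _ _ _ := rfl
  c_comm _ _ _ := rfl
  d_self _ := rfl
  d_eq _ _ _ _ _ := rfl
  c_d_disjoint _ _ _ _ := rfl

/-- A number is the code of a sentence true in all neat reducts iff its clauses are unsatisfiable.
One direction turns a countermodel into a truth assignment, the other a truth assignment into a
countermodel. -/
theorem isREClass_nrCA {n m : Ordinal.{u}} (h : n ≤ m) (hm : m ≠ 0) :
    IsREClass (NrCA h).elementaryClosure := by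
  intro e he hr
  obtain ⟨O, hO, ⟨f, hf⟩, hg⟩ := exists_computable_numbering (RemovedDim h)
  refine (CodeClause.rePred_unsatisfiable CodeClause.schemes hr hO).of_eq fun a => ?_
  rw [StructureClass.theory_elementaryClosure]
  have : Nonempty m.ToType := Ordinal.nonempty_toType_iff.mpr hm
  let : Inhabited m.ToType := Classical.inhabited_of_nonempty this
  constructor
  · intro h1
    by_contra h2
    push Not at h2
    have h3 : ∃ (B : Type u) (_ : CylindricAlgebra m.ToType B),
        ∀ φ : (caLanguage n.ToType).Sentence, caFormulaCode e φ = a →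
          ¬ neatReduct (ordinalInclusion h) B ⊨ φ := by
      by_cases h4 : ∃ φ : (caLanguage n.ToType).Sentence, caFormulaCode e φ = a
      · obtain ⟨φ, rfl⟩ := h4
        have h5 : φ ∉ (NrCA h).theory := fun h6 => h2 φ h6 rfl
        simp only [StructureClass.theory, Set.mem_ofPred_eq] at h5
        push Not at h5
        obtain ⟨A, S, ⟨B, hB, ⟨g⟩⟩, hA⟩ := h5
        refine ⟨B, hB, fun ψ hψ => ?_⟩
        rw [realize_iff_of_caFormulaCode_eq _ he hψ,
          ← FirstOrder.Language.StrongHomClass.realize_sentence g]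
        exact hA
      · exact ⟨PUnit, inferInstance, fun φ hφ => absurd ⟨φ, hφ⟩ h4⟩
    obtain ⟨B, hB, h4⟩ := h3
    let : Inhabited B := ⟨⊥⟩
    classical
    refine h1 (CodeClause.exists_good (B := B) (ordinalInclusion h) he O
      (fun j => if hj : O j then (f j hj).1 else default) (fun j hj => ?_) (fun i j hi hj hij => ?_)
      a h4)
    · rw [dif_pos hj]
      exact (f j hj).2
    · rw [dif_pos hi, dif_pos hj] at hij
      exact hf i j hi hj (Subtype.ext hij)
  · rintro ⟨φ, hφ, rfl⟩ ⟨P, h7, h8, hP⟩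
    obtain ⟨A, S, hA, hA'⟩ := CodeClause.Good.exists_countermodel (h := h) he
      (fun i => (h7 _).mpr ⟨i, rfl⟩)
      (hg.imp (fun ⟨g, hg, hg'⟩ => ⟨g, hg, fun r => (h8 _).mpr (hg' r)⟩)
        fun hg j => (h8 _).mpr (hg j)) hP
    exact hA' (hφ A S hA)

theorem theorem1 (n m : Ordinal.{u}) (hn : 1 < n) (hnm : n < m) :
    (NrCA hnm.le).IsPseudoElementary ∧
    (m < Ordinal.omega0 → (NrCA hnm.le).IsPseudoElementaryWith 2) ∧
    (n < Ordinal.omega0 → Ordinal.omega0 ≤ m → (NrCA hnm.le).IsPseudoElementaryWith 3) ∧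
    (Ordinal.omega0 ≤ n → (NrCA hnm.le).IsPseudoElementaryWith 4) ∧
    ¬ (NrCA hnm.le).IsElementary ∧
    IsREClass (NrCA hnm.le).elementaryClosure ∧
    (2 < n → ¬ (NrCA hnm.le).elementaryClosure.IsFinitelyAxiomatizable) := by
  have hm : m ≠ 0 := (zero_le.trans_lt hnm).ne'
  exact ⟨⟨2, inferInstance, isPseudoElementaryWith_nrCA hnm.le hm 0⟩,
    fun _ => isPseudoElementaryWith_nrCA hnm.le hm 0,
    fun _ _ => isPseudoElementaryWith_nrCA hnm.le hm 1,
    fun _ => isPseudoElementaryWith_nrCA hnm.le hm 2,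
    not_isElementary_nrCA hn hnm, isREClass_nrCA hnm.le hm,
    fun _ => not_isFinitelyAxiomatizable_nrCA hn hnm⟩
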